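/- **Setting.** Let $m\ge 1$ and, for $i=1,\dots,m$, let $F_i$ be a Borel probability measure on a Polish space $\mathcal X_i$ with support $\Xi_i$; let $\mathcal P_i$ be the set of all finite convex combinations of $F_i$ and Dirac measures at points of $\Xi_i$. Let $\psi(P_1,\dots,P_m)\in\mathbb R$ be a performance measure. A simulation replication driven by $P=(P_1,\dots,P_m)$ is a real random variable $\hat\psi(P)$ whose law depends measurably on $P$, with $\mathbb E[\hat\psi(P)]=\psi(P)$ for $P\in\prod_i\mathcal P_i$; put $\tau^2(P)=\mathbb E[(\hat\psi(P)-\psi(P))^2]$ and $\mu_4(P)=\mathbb E[(\hat\psi(P)-\psi(P))^4]$. For each $i$ there are $n_i\ge1$ i.i.d. data $X_{i,1},\dots,X_{i,n_i}\sim F_i$, independent over $i$, with empirical distribution $\widehat F_i$. All limits are along a sequence of data sizes with every $n_i\to\infty$; $n=\frac1m\sum_i n_i$, and $\sigma_I^2=\mathrm{Var}[\psi(\widehat F_1,\dots,\widehat F_m)]$. For sequences, $a=\omega(b)$ means $|a/b|\to\infty$, and $a=\Omega(b)$ means that $|a/b|\ge C$ eventually for some constant $C>0$. **Algorithm.** Given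 integers $B,R\ge2$ and $0<\theta\le1$ with $s_i=\lfloor\theta n_i\rfloor\ge1$ for all $i$: draw $B$ independent resamples, each consisting, for every $i$, of $s_i$ points drawn uniformly with replacement from the $i$-th data set; with the empirical distributions of the $b$-th resample run $R$ independent replications $\hat\psi_{b,1},\dots,\hat\psi_{b,R}$. With $\bar\psi^b=\frac1R\sum_r\hat\psi_{b,r}$, $\bar{\bar\psi}=\frac1B\sum_b\bar\psi^b$ and $V=\frac1{B(R-1)}\sum_{b,r}(\hat\psi_{b,r}-\bar\psi^b)^2$ output $$\hat\sigma^2_{SVB}=\theta\Big(\frac1{B-1}\sum_{b}(\bar\psi^b-\bar{\bar\psi})^2-\frac VR\Big).$$ The total simulation budget used is $BR$. The sequence $(\theta,B,R)$ is called relatively consistent if $\hat\sigma^2_{SVB}/\sigma_I^2\to1$ in probability. Let $\widehat F^*_{s_i,i}$ be the resampled empirical distributions of one resample, $\mathbb E_*$ the expectation over the resample given the data, and $s=\frac1m\sum_i s_i$. **Assumptions.** 1. $\max_in_i/\min_in_i\le c$ eventually, for some constant $c$. 2. There are measurable functions $(P,x)\mapsto g_i(P;x)$ such that for all $P,Q\in\prod_i\mathcal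 P_i$: $g_i(P;\cdot)$ is $Q_i$-integrable, $\int g_i(P;x)\,dP_i(x)=0$, and, as $\nu\to0$ in $[0,1]^m$, $\psi\big(((1-\nu_i)P_i+\nu_iQ_i)_i\big)-\psi(P)=\sum_i\nu_i\int g_i(P;x)\,d(Q_i-P_i)(x)+o\big((\sum_i\nu_i^2)^{1/2}\big)$. 3. With $g_i=g_i(F;\cdot)$ and $\epsilon=\psi(\widehat F)-\psi(F)-\sum_i\int g_i\,d(\widehat F_i-F_i)$: $\mathbb E[\epsilon^2]=o(1/n)$, $\mathrm{Var}_{F_i}[g_i(X_i)]>0$ and $\mathbb E_{F_i}[g_i^4(X_i)]<\infty$. 4. (a) With $\hat g_i=g_i(\widehat F;\cdot)$: $\mathbb E[(\hat g_i-g_i)^4(X_{i,1})]\to0$. (b) For every $\overline F\in\prod_i\{\widehat F_i,\widehat F^*_{s_i,i}\}$, $\epsilon^*=\psi(\overline F)-\psi(\widehat F)-\sum_i\int\hat g_i\,d(\overline F_i-\widehat F_i)$ satisfies $\mathbb E_*[(\epsilon^*)^4]=o_p(s^{-2})$. 5. $\tau^2(F)<\infty$ and $\tau^2(\widehat F)\to\tau^2(F)$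 in probability. 6. For every such $\overline F$, $\mathbb E_*[(\tau^2(\overline F)-\tau^2(\widehat F))^2]=o_p(1)$. 7. For every such $\overline F$, $\mathbb E_*[\mu_4(\overline F)]=O_p(1)$. **Statement.** Suppose that 1, 2, 3, 4(a) and 5 hold. All parameter sequences $(\theta,B,R)$ below are admissible for the algorithm, i.e. $B,R\ge2$, $0<\theta\le1$ and $\lfloor\theta n_i\rfloor\ge1$. Consider the configuration $$B=\omega(1),\qquad BR^2=\omega((\theta n)^2),\qquad \theta=\omega(1/n).\tag{$*$}$$ (i) If $\theta=\omega(1/n)$, $B=\omega(1)$, $R=\Omega(\theta n)$, and 4(b), 6, 7 hold for this $\theta$, then $(*)$ holds and $(\theta,B,R)$ is relatively consistent. (ii) Let $\theta=\omega(1/n)$. Every $B,R$ satisfying $(*)$ use a budget $BR=\omega(\theta n)$ (in particular $BR=\omega(n)$ when $\theta\equiv1$, which is the standard variance bootstrap); conversely, for every integer budget $N=\omega(\theta n)$ there are $B=\omega(1)$, $R=\Omega(\theta n)$ with $BR\le N$ eventually. (iii) If 4(b), 6, 7 hold for every admissible $\theta=\omega(1/n)$, then for every integer budget $N=\omega(1)$,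 however slowly it grows, there are $\theta=\omega(1/n)$ and $B,R$ with $BR\le N$ eventually such that $(\theta,B,R)$ is relatively consistent. (iv) Conversely, every relatively consistent $(\theta,B,R)$ has $BR=\omega(1)$. Thus the minimum budget required for relative consistency is $N=\omega(1)$, reached with $\theta=\omega(1/n)$. -/

import Mathlib

open MeasureTheory ProbabilityTheory Filter Topology
open scoped ENNReal NNReal

namespace InputVariance

noncomputable section

/-! ### Orders of magnitude -/

/-- `a = ω(b)`: `|a / b| → ∞`. -/
def IsLittleOmega (a b : ℕ → ℝ) : Prop :=
  Tendsto (fun k => |a k / b k|) atTop atTop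

/-- `a = Ω(b)`: `|a / b| ≥ C` eventually, for some constant `C > 0`. -/
def IsBigOmega (a b : ℕ → ℝ) : Prop :=
  ∃ C : ℝ, 0 < C ∧ ∀ᶠ k in atTop, C ≤ |a k / b k|

/-- Convergence in probability to a constant of a sequence of random variables, the `k`-th one
living on its own probability space `(Ω k, μ k)`. -/
def TendstoInProb {Ω : ℕ → Type*} [∀ k, MeasurableSpace (Ω k)] (μ : ∀ k, Measure (Ω k))
    (A : ∀ k, Ω k → ℝ) (a : ℝ) : Prop :=
  ∀ ε : ℝ, 0 < ε → Tendsto (fun k => μ k {ω | ε ≤ |A k ω - a|}) atTop (𝓝 0)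

/-- `A = O_p(1)` for nonnegative, possibly infinite random variables. -/
def IsBoundedInProb {Ω : ℕ → Type*} [∀ k, MeasurableSpace (Ω k)] (μ : ∀ k, Measure (Ω k))
    (A : ∀ k, Ω k → ℝ≥0∞) : Prop :=
  ∀ ε : ℝ≥0∞, 0 < ε → ∃ M : ℝ≥0, ∀ᶠ k in atTop, μ k {ω | (M : ℝ≥0∞) < A k ω} < ε

/-! ### Distributions -/

/-- The empirical distribution of `x 0, …, x (s - 1)`. -/
def empirical {E : Type*} [MeasurableSpace E] {s : ℕ} (x : Fin s → E) : Measure E :=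
  (s : ℝ≥0∞)⁻¹ • ∑ j, Measure.dirac (x j)

/-- The mixture `(1 - t) P + t Q`. -/
def mix {E : Type*} [MeasurableSpace E] (t : unitInterval) (P Q : Measure E) : Measure E :=
  ENNReal.ofReal (1 - (t : ℝ)) • P + ENNReal.ofReal (t : ℝ) • Q

/-- The convex hull of `F` and of the Dirac measures at the points of the support of `F`. -/
def hull {E : Type*} [TopologicalSpace E] [MeasurableSpace E] (F : Measure E) :
    Set (Measure E) :=
  {P | ∃ (l : ℕ) (ν₀ : ℝ≥0) (ν : Fin l → ℝ≥0) (x : Fin l → E),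
    ν₀ + ∑ k, ν k = 1 ∧ (∀ k, x k ∈ F.support) ∧
      P = ν₀ • F + ∑ k, ν k • Measure.dirac (x k)}

section Model

variable {m : ℕ} {𝒳 : Fin m → Type*}

/-! ### Data, resampling, simulation -/

/-- Data sets of sizes `n 0, …, n (m - 1)`, one for each input model. -/
abbrev Data (𝒳 : Fin m → Type*) (n : Fin m → ℕ) : Type _ := (i : Fin m) → Fin (n i) → 𝒳 i

/-- The indices drawn in one resample of sizes `s i` from data of sizes `n i`
(with replacement). -/
abbrev Resample (n s : Fin m → ℕ) : Type := (i : Fin m) → Fin (s i) → Fin (n i)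

/-- The average input data size `n`. -/
def avgSize (n : Fin m → ℕ) : ℝ := (∑ i, (n i : ℝ)) / m

/-- The subsample sizes `s i = ⌊θ n i⌋`. -/
def subSize (θ : ℝ) (n : Fin m → ℕ) : Fin m → ℕ := fun i => ⌊θ * (n i : ℝ)⌋₊

/-- `E_*` of a real function of the resample, which is uniformly distributed. -/
def starMean {n s : Fin m → ℕ} (f : Resample n s → ℝ) : ℝ :=
  (∑ ι, f ι) / (Fintype.card (Resample n s) : ℝ)

/-- `E_*` of a `[0, ∞]`-valued function of the resample. -/
def starMeanENN {n s : Fin m → ℕ} (f : Resample n s → ℝ≥0∞) : ℝ≥0∞ :=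
  (∑ ι, f ι) / (Fintype.card (Resample n s) : ℝ≥0∞)

variable [∀ i, MeasurableSpace (𝒳 i)]

/-- The law of the data: all points independent, those of the `i`-th set distributed as `F i`. -/
def dataLaw (F : ∀ i, Measure (𝒳 i)) (n : Fin m → ℕ) : Measure (Data 𝒳 n) :=
  Measure.pi fun i => Measure.pi fun _ : Fin (n i) => F i

/-- The tuple of empirical distributions of the data. -/
def empAll {n : Fin m → ℕ} (x : Data 𝒳 n) : ∀ i, Measure (𝒳 i) := fun i => empirical (x i)

/-- The tuple whose `i`-th entry is the resampled empirical distribution for `i ∈ S` and the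
empirical distribution of the data for `i ∉ S`. -/
def barF (S : Finset (Fin m)) {n s : Fin m → ℕ} (x : Data 𝒳 n) (ι : Resample n s) :
    ∀ i, Measure (𝒳 i) :=
  fun i => if i ∈ S then empirical (fun j => x i (ι i j)) else empirical (x i)

/-- The input variance `σ_I² = Var[ψ(F̂_1, …, F̂_m)]`. -/
def inputVar (F : ∀ i, Measure (𝒳 i)) (ψ : (∀ i, Measure (𝒳 i)) → ℝ) (n : Fin m → ℕ) : ℝ :=
  variance (fun x : Data 𝒳 n => ψ (empAll x)) (dataLaw F n)

/-- The variance `τ²(P)` of one simulation replication driven by `P`. -/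
def tauSq (ψ : (∀ i, Measure (𝒳 i)) → ℝ) (sim : Kernel (∀ i, Measure (𝒳 i)) ℝ)
    (P : ∀ i, Measure (𝒳 i)) : ℝ :=
  ∫ y, (y - ψ P) ^ 2 ∂(sim P)

/-- The fourth central moment `μ₄(P)` of one simulation replication driven by `P`. -/
def mu4 (ψ : (∀ i, Measure (𝒳 i)) → ℝ) (sim : Kernel (∀ i, Measure (𝒳 i)) ℝ)
    (P : ∀ i, Measure (𝒳 i)) : ℝ≥0∞ :=
  ∫⁻ y, ENNReal.ofReal ((y - ψ P) ^ 4) ∂(sim P)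

/-- Conditionally on the data `x`, the law of the `R` replications driven by one resample: the
resample is uniform, and given it the replications are i.i.d. -/
def blockLaw (sim : Kernel (∀ i, Measure (𝒳 i)) ℝ) {n : Fin m → ℕ} (s : Fin m → ℕ) (R : ℕ)
    (x : Data 𝒳 n) : Measure (Fin R → ℝ) :=
  (Fintype.card (Resample n s) : ℝ≥0∞)⁻¹ •
    ∑ ι : Resample n s, Measure.pi fun _ : Fin R => sim (barF Finset.univ x ι)

/-- Conditionally on the data `x`, the law of all `B R` replications: the `B` resamples, with
their replications, are i.i.d. -/
def runLaw (sim : Kernel (∀ i, Measure (𝒳 i)) ℝ) {n : Fin m → ℕ} (s : Fin m → ℕ) (B R : ℕ)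
    (x : Data 𝒳 n) : Measure (Fin B → Fin R → ℝ) :=
  Measure.pi fun _ : Fin B => blockLaw sim s R x

/-! ### The estimator -/

/-- `ψ̄^b`. -/
def blockMean {B R : ℕ} (y : Fin B → Fin R → ℝ) (b : Fin B) : ℝ := (∑ r, y b r) / R

/-- The grand mean of all replications. -/
def grandMean {B R : ℕ} (y : Fin B → Fin R → ℝ) : ℝ := (∑ b, blockMean y b) / B

/-- The within-group variance `V`. -/
def withinVar {B R : ℕ} (y : Fin B → Fin R → ℝ) : ℝ :=
  (∑ b, ∑ r, (y b r - blockMean y b) ^ 2) / (B * ((R : ℝ) - 1))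

/-- The output `σ̂²_SVB` computed from the replications `y`. -/
def svb (θ : ℝ) {B R : ℕ} (y : Fin B → Fin R → ℝ) : ℝ :=
  θ * ((∑ b, (blockMean y b - grandMean y) ^ 2) / ((B : ℝ) - 1) - withinVar y / R)

/-- Relative consistency: `σ̂²_SVB / σ_I² → 1` in probability, where the probability of an
event is the expectation over the data of its conditional probability given the data. -/
def RelConsistent (F : ∀ i, Measure (𝒳 i)) (ψ : (∀ i, Measure (𝒳 i)) → ℝ)
    (sim : Kernel (∀ i, Measure (𝒳 i)) ℝ) (n : ℕ → Fin m → ℕ)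
    (θ : ℕ → ℝ) (B R : ℕ → ℕ) : Prop :=
  ∀ ε : ℝ, 0 < ε → Tendsto (fun k =>
    ∫⁻ x, runLaw sim (subSize (θ k) (n k)) (B k) (R k) x
      {y | ε ≤ |svb (θ k) y / inputVar F ψ (n k) - 1|} ∂(dataLaw F (n k))) atTop (𝓝 0)

/-! ### Procedural configurations -/

/-- Subsample ratios in `(0, 1]` for which no subsample is empty. -/
def AdmissibleRatio (n : ℕ → Fin m → ℕ) (θ : ℕ → ℝ) : Prop :=
  ∀ k, 0 < θ k ∧ θ k ≤ 1 ∧ ∀ i, 1 ≤ subSize (θ k) (n k) i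

/-- Parameters with which the algorithm can be run. -/
def Admissible (n : ℕ → Fin m → ℕ) (θ : ℕ → ℝ) (B R : ℕ → ℕ) : Prop :=
  AdmissibleRatio n θ ∧ ∀ k, 2 ≤ B k ∧ 2 ≤ R k

/-- `θ = ω(1/n)`. -/
def RatioGrows (n : ℕ → Fin m → ℕ) (θ : ℕ → ℝ) : Prop :=
  IsLittleOmega θ (fun k => 1 / avgSize (n k))

/-- `B = ω(1)`, `B R² = ω((θ n)²)` and `θ = ω(1/n)`. -/
def Configured (n : ℕ → Fin m → ℕ) (θ : ℕ → ℝ) (B R : ℕ → ℕ) : Prop :=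
  IsLittleOmega (fun k => (B k : ℝ)) (fun _ => 1) ∧
  IsLittleOmega (fun k => (B k : ℝ) * (R k : ℝ) ^ 2) (fun k => (θ k * avgSize (n k)) ^ 2) ∧
  RatioGrows n θ

/-! ### Regularity conditions -/

/-- All data sizes grow to infinity and stay comparable. -/
def BalancedData (n : ℕ → Fin m → ℕ) : Prop :=
  (∀ i, Tendsto (fun k => n k i) atTop atTop) ∧
  ∃ c : ℝ, 0 < c ∧ ∀ᶠ k in atTop, ∀ i j, (n k i : ℝ) ≤ c * (n k j : ℝ)

/-- `sim` produces unbiased replications of `ψ` under all relevant input distributions. -/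
def Unbiased [∀ i, TopologicalSpace (𝒳 i)] (F : ∀ i, Measure (𝒳 i))
    (ψ : (∀ i, Measure (𝒳 i)) → ℝ) (sim : Kernel (∀ i, Measure (𝒳 i)) ℝ) : Prop :=
  ∀ P : ∀ i, Measure (𝒳 i), (∀ i, P i ∈ hull (F i)) →
    Integrable (fun y : ℝ => y) (sim P) ∧ ∫ y, y ∂(sim P) = ψ P

/-- Gateaux differentiability of `ψ` with influence functions `g i P`. -/
def FirstOrderDiff [∀ i, TopologicalSpace (𝒳 i)] (F : ∀ i, Measure (𝒳 i))
    (ψ : (∀ i, Measure (𝒳 i)) → ℝ) (g : ∀ i, (∀ j, Measure (𝒳 j)) → 𝒳 i → ℝ) : Prop :=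
  ∀ P : ∀ i, Measure (𝒳 i), (∀ i, P i ∈ hull (F i)) →
    (∀ i, ∫ x, g i P x ∂(P i) = 0) ∧
    ∀ Q : ∀ i, Measure (𝒳 i), (∀ i, Q i ∈ hull (F i)) →
      (∀ i, Integrable (g i P) (Q i)) ∧
      (fun ν : Fin m → unitInterval =>
        ψ (fun i => mix (ν i) (P i) (Q i)) - ψ P -
          ∑ i, (ν i : ℝ) * (∫ x, g i P x ∂(Q i) - ∫ x, g i P x ∂(P i)))
        =o[𝓝 0] (fun ν : Fin m → unitInterval => Real.sqrt (∑ i, (ν i : ℝ) ^ 2))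

/-- The remainder of the linear expansion of `ψ` from `P` to `Q`. -/
def remainder (ψ : (∀ i, Measure (𝒳 i)) → ℝ) (g : ∀ i, (∀ j, Measure (𝒳 j)) → 𝒳 i → ℝ)
    (P Q : ∀ i, Measure (𝒳 i)) : ℝ :=
  ψ Q - ψ P - ∑ i, (∫ x, g i P x ∂(Q i) - ∫ x, g i P x ∂(P i))

/-- Smoothness at the true input models: `E[ε²] = o(1/n)`, and the influence functions at the
truth have positive variance and finite fourth moment. -/
def SmoothAtTruth (F : ∀ i, Measure (𝒳 i)) (ψ : (∀ i, Measure (𝒳 i)) → ℝ)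
    (g : ∀ i, (∀ j, Measure (𝒳 j)) → 𝒳 i → ℝ) (n : ℕ → Fin m → ℕ) : Prop :=
  Tendsto (fun k => ENNReal.ofReal (avgSize (n k)) *
    ∫⁻ x : Data 𝒳 (n k), ENNReal.ofReal (remainder ψ g F (empAll x) ^ 2) ∂(dataLaw F (n k)))
    atTop (𝓝 0) ∧
  ∀ i, 0 < variance (g i F) (F i) ∧ Integrable (fun x => g i F x ^ 4) (F i)

/-- `E[(ĝ_i - g_i)⁴(X_{i,1})] → 0` for every `i`. -/
def InfluenceConverges (F : ∀ i, Measure (𝒳 i))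
    (g : ∀ i, (∀ j, Measure (𝒳 j)) → 𝒳 i → ℝ) (n : ℕ → Fin m → ℕ)
    (hn : ∀ k i, 0 < n k i) : Prop :=
  ∀ i, Tendsto (fun k => ∫⁻ x : Data 𝒳 (n k), ENNReal.ofReal
    ((g i (empAll x) (x i ⟨0, hn k i⟩) - g i F (x i ⟨0, hn k i⟩)) ^ 4) ∂(dataLaw F (n k)))
    atTop (𝓝 0)

/-- `E_*[(ε*)⁴] = o_p(s⁻²)` for every choice of resampled and non-resampled input models, where
`s` is the average subsample size. -/
def SmoothAtEmpirical (F : ∀ i, Measure (𝒳 i)) (ψ : (∀ i, Measure (𝒳 i)) → ℝ)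
    (g : ∀ i, (∀ j, Measure (𝒳 j)) → 𝒳 i → ℝ) (n : ℕ → Fin m → ℕ) (θ : ℕ → ℝ) : Prop :=
  ∀ S : Finset (Fin m), TendstoInProb (fun k => dataLaw F (n k))
    (fun k x => starMean (fun ι : Resample (n k) (subSize (θ k) (n k)) =>
        remainder ψ g (empAll x) (barF S x ι) ^ 4) * avgSize (subSize (θ k) (n k)) ^ 2) 0

/-- `τ̂² → τ²` in probability, with `τ²` finite. -/
def EmpiricalVarConverges (F : ∀ i, Measure (𝒳 i)) (ψ : (∀ i, Measure (𝒳 i)) → ℝ)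
    (sim : Kernel (∀ i, Measure (𝒳 i)) ℝ) (n : ℕ → Fin m → ℕ) : Prop :=
  Integrable (fun y : ℝ => (y - ψ F) ^ 2) (sim F) ∧
  TendstoInProb (fun k => dataLaw F (n k)) (fun _ x => tauSq ψ sim (empAll x)) (tauSq ψ sim F)

/-- `E_*[(τ²(F̄) - τ̂²)²] = o_p(1)` for every choice of `F̄`. -/
def BootstrapVarConverges (F : ∀ i, Measure (𝒳 i)) (ψ : (∀ i, Measure (𝒳 i)) → ℝ)
    (sim : Kernel (∀ i, Measure (𝒳 i)) ℝ) (n : ℕ → Fin m → ℕ) (θ : ℕ → ℝ) : Prop :=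
  ∀ S : Finset (Fin m), TendstoInProb (fun k => dataLaw F (n k))
    (fun k x => starMean (fun ι : Resample (n k) (subSize (θ k) (n k)) =>
        (tauSq ψ sim (barF S x ι) - tauSq ψ sim (empAll x)) ^ 2)) 0

/-- `E_*[μ₄(F̄)] = O_p(1)` for every choice of `F̄`. -/
def FourthMomentBounded (F : ∀ i, Measure (𝒳 i)) (ψ : (∀ i, Measure (𝒳 i)) → ℝ)
    (sim : Kernel (∀ i, Measure (𝒳 i)) ℝ) (n : ℕ → Fin m → ℕ) (θ : ℕ → ℝ) : Prop :=
  ∀ S : Finset (Fin m), IsBoundedInProb (fun k => dataLaw F (n k))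
    (fun k x => starMeanENN (fun ι : Resample (n k) (subSize (θ k) (n k)) =>
        mu4 ψ sim (barF S x ι)))

/-- The regularity conditions that involve the subsample sizes. -/
def ResamplingRegular (F : ∀ i, Measure (𝒳 i)) (ψ : (∀ i, Measure (𝒳 i)) → ℝ)
    (sim : Kernel (∀ i, Measure (𝒳 i)) ℝ) (g : ∀ i, (∀ j, Measure (𝒳 j)) → 𝒳 i → ℝ)
    (n : ℕ → Fin m → ℕ) (θ : ℕ → ℝ) : Prop :=
  SmoothAtEmpirical F ψ g n θ ∧ BootstrapVarConverges F ψ sim n θ ∧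
    FourthMomentBounded F ψ sim n θ

end Model

end

end InputVariance

namespace InputVariance

/-! ### Orders of magnitude and the choice of parameters -/

section Sizes

variable {m : ℕ}

/-! Sufficiency is a conditional second-moment argument. Given the data, the blocks are i.i.d. with
a law that is a uniform mixture, over resamples, of product measures. Centre the block mean at the
overall bootstrap mean and call it `U`. Then `U ^ 2 - rowVar / R` has mean exactly the bootstrap
variance, since the correction `V / R` removes the simulation noise. Hence `svb` differs from `θ *
bootVar` by an average of `B` centred i.i.d. terms plus a term of order `1 / B`, and its mean
absolute error is at most `5 θ √(Q / B)`, where `Q` bounds the fourth moment of `U` and the second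
moment of `U ^ 2 - rowVar / R` (`integral_abs_svb_sub_le`). Both the bootstrap fourth moment and the
simulation contribution to `Q`, of order `1 / R ^ 2`, are `O((θ n)⁻²)` once `R = Ω(θ n)`, so the
error is `O(1 / (n √B))` in probability, which is negligible against `σ_I²`, of order `1 / n`.

It remains to compare `θ * bootVar` with `σ_I²`. By the linear expansion at the truth, `σ_I²` is `∑
i, σ i / n i` up to `o(1 / n)` (`tendsto_inputVar`). By the expansion at the empirical
distributions, `bootVar` is `∑ i, V i / s i` with `V i` the empirical second moment of the empirical
influence function (`boot_moments`). Exchangeability turns the hypothesis on one data point into one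
on empirical averages, so `V i` tends to `σ i` in probability; rounding `θ n i` to `s i` costs a
relative error of order `1 / (θ n)`. `runLaw_svb_ratio_le` assembles these estimates on a good event
and `relConsistent` passes to the limit.

Necessity needs no moments (`le_measureReal_svb_far`). Replace the first two blocks by independent
copies. In the mixed second difference of `svb` all terms additive over blocks cancel, leaving a
multiple of the product of the two differences of block means (`svb_cross`). If `svb / σ_I²` were
close to `1` with high probability, this product would be small, so two independent blocks would
usually have close means. With boundedly many blocks all means would then be close at once, and `svb
/ σ_I²` would be at most `1 / 2`. So `B → ∞`, and with it `B R`.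

The budget claims are arithmetic: `(B R / (θ n)) ^ 2` is the product of the two diverging ratios in
the configuration, and a slowly growing `θ n` leaves room for any diverging budget (`exists_ratio`,
`exists_replications`). -/

lemma avgSize_pos (hm : 0 < m) {n : Fin m → ℕ} (hn : ∀ i, 0 < n i) : 0 < avgSize n := by
  have : Nonempty (Fin m) := ⟨⟨0, hm⟩⟩
  have hs : (0 : ℝ) < ∑ i, (n i : ℝ) :=
    Finset.sum_pos (fun i _ => by exact_mod_cast hn i) Finset.univ_nonempty
  exact div_pos hs (by exact_mod_cast hm)

lemma le_mul_avgSize (hm : 0 < m) (n : Fin m → ℕ) (i : Fin m) : (n i : ℝ) ≤ m * avgSize n := by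
  have hm' : (m : ℝ) ≠ 0 := by exact_mod_cast hm.ne'
  rw [avgSize, mul_div_cancel₀ _ hm']
  exact Finset.single_le_sum (f := fun i => (n i : ℝ)) (fun _ _ => by positivity)
    (Finset.mem_univ i)

lemma avgSize_le (hm : 0 < m) {n : Fin m → ℕ} {a : ℝ} (h : ∀ i, (n i : ℝ) ≤ a) :
    avgSize n ≤ a := by
  have hm' : (0 : ℝ) < m := by exact_mod_cast hm
  rw [avgSize, div_le_iff₀ hm']
  calc ∑ i, (n i : ℝ) ≤ ∑ _i : Fin m, a := Finset.sum_le_sum fun i _ => h i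
    _ = a * m := by simp [mul_comm]

lemma le_avgSize (hm : 0 < m) {n : Fin m → ℕ} {a : ℝ} (h : ∀ i, a ≤ (n i : ℝ)) :
    a ≤ avgSize n := by
  have hm' : (0 : ℝ) < m := by exact_mod_cast hm
  rw [avgSize, le_div_iff₀ hm']
  calc a * m = ∑ _i : Fin m, a := by simp [mul_comm]
    _ ≤ ∑ i, (n i : ℝ) := Finset.sum_le_sum fun i _ => h i

lemma tendsto_avgSize (hm : 0 < m) {n : ℕ → Fin m → ℕ} (hbal : BalancedData n) :
    Tendsto (fun k => avgSize (n k)) atTop atTop := by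
  refine tendsto_atTop.2 fun a => ?_
  have h : ∀ᶠ k in atTop, ∀ i, a ≤ (n k i : ℝ) :=
    eventually_all.2 fun i =>
      (tendsto_natCast_atTop_atTop.comp (hbal.1 i)).eventually_ge_atTop a
  filter_upwards [h] with k hk using le_avgSize hm hk

lemma BalancedData.exists_le (hm : 0 < m) {n : ℕ → Fin m → ℕ} (hbal : BalancedData n) :
    ∃ c : ℝ, 0 < c ∧ ∀ᶠ k in atTop, ∀ i, avgSize (n k) ≤ c * n k i := by
  obtain ⟨c, hc, h⟩ := hbal.2
  exact ⟨c, hc, by filter_upwards [h] with k hk i using avgSize_le hm fun j => hk j i⟩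

lemma tendsto_of_ratioGrows {n : ℕ → Fin m → ℕ} {θ : ℕ → ℝ} (hm : 0 < m)
    (hn : ∀ k i, 0 < n k i) (hθ : ∀ k, 0 < θ k) (h : RatioGrows n θ) :
    Tendsto (fun k => θ k * avgSize (n k)) atTop atTop := by
  refine h.congr fun k => ?_
  rw [div_div_eq_mul_div, div_one, abs_of_pos (mul_pos (hθ k) (avgSize_pos hm (hn k)))]

lemma ratioGrows_of_tendsto {n : ℕ → Fin m → ℕ} {θ : ℕ → ℝ} (hm : 0 < m)
    (hn : ∀ k i, 0 < n k i) (hθ : ∀ k, 0 < θ k)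
    (h : Tendsto (fun k => θ k * avgSize (n k)) atTop atTop) : RatioGrows n θ := by
  refine h.congr fun k => ?_
  rw [div_div_eq_mul_div, div_one, abs_of_pos (mul_pos (hθ k) (avgSize_pos hm (hn k)))]

lemma configured_of_isBigOmega {n : ℕ → Fin m → ℕ} {θ : ℕ → ℝ} {B R : ℕ → ℕ}
    (h : RatioGrows n θ) (hB : IsLittleOmega (fun k => (B k : ℝ)) (fun _ => 1))
    (hR : IsBigOmega (fun k => (R k : ℝ)) (fun k => θ k * avgSize (n k))) :
    Configured n θ B R := by
  refine ⟨hB, ?_, h⟩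
  obtain ⟨C, hC, hCR⟩ := hR
  have h1 : Tendsto (fun k => |(B k : ℝ) / 1| * C ^ 2) atTop atTop :=
    Tendsto.atTop_mul_const (by positivity) hB
  refine tendsto_atTop_mono' _ ?_ h1
  filter_upwards [hCR] with k hk
  have : |(B k : ℝ) * (R k : ℝ) ^ 2 / (θ k * avgSize (n k)) ^ 2|
      = |(B k : ℝ) / 1| * |(R k : ℝ) / (θ k * avgSize (n k))| ^ 2 := by
    rw [div_one, sq_abs, mul_div_assoc, abs_mul, div_pow, abs_of_nonneg (by positivity)]
    congr 1
    exact abs_of_nonneg (by positivity)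
  rw [this]
  gcongr

/-- The product of `B` and `B R² / (θ n)²`, both of which diverge, is the square of `B R / (θ n)`.
-/
lemma isLittleOmega_budget {n : ℕ → Fin m → ℕ} {θ : ℕ → ℝ} {B R : ℕ → ℕ}
    (h : Configured n θ B R) :
    IsLittleOmega (fun k => (B k : ℝ) * (R k : ℝ)) (fun k => θ k * avgSize (n k)) := by
  have h1 := h.1.atTop_mul_atTop₀ h.2.1
  have h2 : Tendsto (fun k => |(B k : ℝ) * R k / (θ k * avgSize (n k))| ^ 2) atTop atTop := by
    refine h1.congr fun k => ?_
    rw [div_one, ← abs_mul, ← abs_pow]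
    congr 1
    rw [div_pow]; ring
  have h3 := tendsto_atTop.1 h2
  refine tendsto_atTop.2 fun a => ?_
  filter_upwards [h3 (a ^ 2)] with k hk
  exact le_of_abs_le (by simpa using abs_le_of_sq_le_sq' hk (abs_nonneg _) |> abs_le.2)

lemma exists_replications {n : ℕ → Fin m → ℕ} {θ : ℕ → ℝ} (hm : 0 < m)
    (hn : ∀ k i, 0 < n k i) (hθ : AdmissibleRatio n θ) (h : RatioGrows n θ) {N : ℕ → ℕ}
    (hN : IsLittleOmega (fun k => (N k : ℝ)) (fun k => θ k * avgSize (n k))) :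
    ∃ B R : ℕ → ℕ, Admissible n θ B R ∧
      IsLittleOmega (fun k => (B k : ℝ)) (fun _ => 1) ∧
      IsBigOmega (fun k => (R k : ℝ)) (fun k => θ k * avgSize (n k)) ∧
      ∀ᶠ k in atTop, B k * R k ≤ N k := by
  set t : ℕ → ℝ := fun k => θ k * avgSize (n k) with ht
  have htpos : ∀ k, 0 < t k := fun k => mul_pos (hθ k).1 (avgSize_pos hm (hn k))
  have htt : Tendsto t atTop atTop := tendsto_of_ratioGrows hm hn (fun k => (hθ k).1) h
  -- The replications per block are just enough for `Ω(θ n)` and the rest of the budget goes into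
  -- blocks. The floors at `2` give admissibility for every `k`; the one in `B` is eventually
  -- inactive, so the budget is exceeded at most finitely often.
  set R : ℕ → ℕ := fun k => max 2 ⌈t k⌉₊ with hR
  set B : ℕ → ℕ := fun k => max 2 (N k / R k) with hB
  have hR2 : ∀ k, 2 ≤ R k := fun k => le_max_left _ _
  have hRt : ∀ k, t k ≤ R k := fun k =>
    (Nat.le_ceil _).trans (by exact_mod_cast le_max_right 2 ⌈t k⌉₊)
  have hNR : Tendsto (fun k => N k / R k) atTop atTop := by
    refine tendsto_atTop.2 fun b => ?_
    filter_upwards [htt.eventually_ge_atTop 1, hN.eventually_ge_atTop (3 * b)] with k h1 h2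
    have hRk : (R k : ℝ) ≤ 3 * t k := by
      have h4 : ((⌈t k⌉₊ : ℕ) : ℝ) < t k + 1 := Nat.ceil_lt_add_one (htpos k).le
      simp only [hR, Nat.cast_max, Nat.cast_ofNat]
      exact max_le (by linarith) (by linarith)
    rw [abs_of_nonneg (by have := htpos k; positivity), le_div_iff₀ (htpos k)] at h2
    rw [Nat.le_div_iff_mul_le (by have := hR2 k; omega)]
    have : (b : ℝ) * R k ≤ N k := by
      calc (b : ℝ) * R k ≤ b * (3 * t k) := by gcongr
        _ ≤ N k := by linarith
    exact_mod_cast this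
  refine ⟨B, R, ⟨hθ, fun k => ⟨le_max_left _ _, hR2 k⟩⟩, ?_, ⟨1, one_pos, ?_⟩, ?_⟩
  · have : Tendsto B atTop atTop := tendsto_atTop_mono (fun k => le_max_right _ _) hNR
    refine (tendsto_natCast_atTop_atTop.comp this).congr fun k => ?_
    simp
  · refine Eventually.of_forall fun k => ?_
    have h1 := htpos k
    change 1 ≤ |(R k : ℝ) / t k|
    rw [abs_of_nonneg (by positivity), le_div_iff₀ h1, one_mul]
    exact hRt k
  · filter_upwards [hNR.eventually_ge_atTop 2] with k hk
    have : B k = N k / R k := max_eq_right hk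
    rw [this]
    exact Nat.div_mul_le_self _ _

/-- Taking `θ n` of order `min n √N` makes it diverge while `N / (θ n) ≥ √N` still diverges. -/
lemma exists_ratio {n : ℕ → Fin m → ℕ} (hm : 0 < m) (hn : ∀ k i, 0 < n k i)
    (hbal : BalancedData n) {N : ℕ → ℕ} (hN : IsLittleOmega (fun k => (N k : ℝ)) (fun _ => 1)) :
    ∃ θ : ℕ → ℝ, AdmissibleRatio n θ ∧ RatioGrows n θ ∧
      IsLittleOmega (fun k => (N k : ℝ)) (fun k => θ k * avgSize (n k)) := by
  have : Nonempty (Fin m) := ⟨⟨0, hm⟩⟩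
  have hN' : Tendsto (fun k => (N k : ℝ)) atTop atTop := by
    refine hN.congr fun k => ?_
    simp
  have hsq : Tendsto (fun k => Real.sqrt (N k)) atTop atTop := Real.tendsto_sqrt_atTop.comp hN'
  obtain ⟨c, hc, hcn⟩ := hbal.exists_le hm
  choose i hi using fun k => Finite.exists_min (n k)
  set A : ℕ → ℝ := fun k => avgSize (n k) with hA
  have hApos : ∀ k, 0 < A k := fun k => avgSize_pos hm (hn k)
  -- The lower bound `1 / min n` keeps every subsample nonempty. By balance it is at most `c / A k`,
  -- hence dominated by `√N / A k` as soon as `√N ≥ c`.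
  set θ : ℕ → ℝ := fun k => max (1 / (n k (i k) : ℝ)) (min 1 (Real.sqrt (N k) / A k)) with hθ
  have hipos : ∀ k, (1 : ℝ) ≤ n k (i k) := fun k => by exact_mod_cast hn k (i k)
  have hθpos : ∀ k, 0 < θ k := fun k =>
    lt_max_of_lt_left (by have := hipos k; positivity)
  have hgrow : Tendsto (fun k => θ k * A k) atTop atTop := by
    refine tendsto_atTop.2 fun a => ?_
    filter_upwards [(tendsto_avgSize hm hbal).eventually_ge_atTop a, hsq.eventually_ge_atTop a]
      with k h1 h2
    have h3 : min (A k) (Real.sqrt (N k)) ≤ θ k * A k := by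
      calc min (A k) (Real.sqrt (N k)) = min 1 (Real.sqrt (N k) / A k) * A k := by
            rw [min_mul_of_nonneg _ _ (hApos k).le, one_mul, div_mul_cancel₀ _ (hApos k).ne']
        _ ≤ θ k * A k := mul_le_mul_of_nonneg_right (le_max_right _ _) (hApos k).le
    exact (le_min h1 h2).trans h3
  refine ⟨θ, fun k => ⟨hθpos k, ?_, fun j => ?_⟩, ratioGrows_of_tendsto hm hn hθpos hgrow, ?_⟩
  · refine max_le ?_ (min_le_left _ _)
    rw [div_le_one (by linarith [hipos k])]
    exact hipos k
  · refine Nat.le_floor ?_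
    have h1 : (n k (i k) : ℝ) ≤ n k j := by exact_mod_cast hi k j
    have h0 := hipos k
    calc ((1 : ℕ) : ℝ) = 1 / (n k (i k) : ℝ) * n k (i k) := by
          rw [one_div_mul_cancel (by linarith)]; simp
      _ ≤ θ k * n k j := mul_le_mul (le_max_left _ _) h1 (by linarith) (hθpos k).le
  · refine tendsto_atTop.2 fun a => ?_
    filter_upwards [hcn, hsq.eventually_ge_atTop c, hsq.eventually_ge_atTop a,
      hsq.eventually_ge_atTop 1] with k h1 h2 h3 h4
    have hp : 0 < θ k * A k := mul_pos (hθpos k) (hApos k)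
    have h5 : θ k * A k ≤ Real.sqrt (N k) := by
      have hi1 := hipos k
      rw [← le_div_iff₀ (hApos k)]
      refine max_le ?_ (min_le_right _ _)
      rw [div_le_div_iff₀ (by linarith) (hApos k), one_mul]
      exact (h1 (i k)).trans (by gcongr)
    have h6 : Real.sqrt (N k) ≤ (N k : ℝ) / (θ k * A k) := by
      rw [le_div_iff₀ hp]
      calc Real.sqrt (N k) * (θ k * A k) ≤ Real.sqrt (N k) * Real.sqrt (N k) := by gcongr
        _ = N k := Real.mul_self_sqrt (by positivity)
    exact (h3.trans h6).trans (le_abs_self _)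

end Sizes

/-! ### A bounded number of resamples is never enough -/

section FewBlocks

lemma sum_sub_mean_sq {B : ℕ} (hB : 0 < B) (u : Fin B → ℝ) :
    ∑ b, (u b - (∑ b, u b) / B) ^ 2 = ∑ b, u b ^ 2 - (∑ b, u b) ^ 2 / B := by
  have hB' : (B : ℝ) ≠ 0 := by exact_mod_cast hB.ne'
  simp only [sub_sq, Finset.sum_add_distrib, Finset.sum_sub_distrib, Finset.sum_const,
    Finset.card_univ, Fintype.card_fin, nsmul_eq_mul, ← Finset.sum_mul, ← Finset.mul_sum]
  field_simp
  ring

lemma sum_sub_mean_sq_le {B : ℕ} (hB : 0 < B) (u : Fin B → ℝ) (c : ℝ) :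
    ∑ b, (u b - (∑ b, u b) / B) ^ 2 ≤ ∑ b, (u b - c) ^ 2 := by
  have hB' : (B : ℝ) ≠ 0 := by exact_mod_cast hB.ne'
  have h := sum_sub_mean_sq hB u
  have h2 : ∑ b, (u b - c) ^ 2
      = ∑ b, u b ^ 2 - (∑ b, u b) ^ 2 / B + B * ((∑ b, u b) / B - c) ^ 2 := by
    simp only [sub_sq, Finset.sum_add_distrib, Finset.sum_sub_distrib, Finset.sum_const,
      Finset.card_univ, Fintype.card_fin, nsmul_eq_mul, ← Finset.sum_mul, ← Finset.mul_sum]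
    field_simp
    ring
  rw [h, h2]
  have : 0 ≤ (B : ℝ) * ((∑ b, u b) / B - c) ^ 2 := by positivity
  linarith

/-- The mean of one block. -/
noncomputable def rowMean {R : ℕ} (z : Fin R → ℝ) : ℝ := (∑ r, z r) / R

/-- The unbiased sample variance of one block. -/
noncomputable def rowVar {R : ℕ} (z : Fin R → ℝ) : ℝ :=
  (∑ r, (z r - rowMean z) ^ 2) / ((R : ℝ) - 1)

@[fun_prop]
lemma measurable_rowMean {R : ℕ} : Measurable (rowMean : (Fin R → ℝ) → ℝ) := by
  unfold rowMean; fun_prop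

@[fun_prop]
lemma measurable_rowVar {R : ℕ} : Measurable (rowVar : (Fin R → ℝ) → ℝ) := by
  unfold rowVar; fun_prop

lemma rowVar_nonneg {R : ℕ} (hR : 2 ≤ R) (z : Fin R → ℝ) : 0 ≤ rowVar z := by
  have : (2 : ℝ) ≤ R := by exact_mod_cast hR
  exact div_nonneg (Finset.sum_nonneg fun _ _ => sq_nonneg _) (by linarith)

lemma withinVar_eq {B R : ℕ} (y : Fin B → Fin R → ℝ) :
    withinVar y = (∑ b, rowVar (y b)) / B := by
  simp only [withinVar, rowVar, ← Finset.sum_div, div_div]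
  rw [mul_comm]
  rfl

lemma svb_eq (θ : ℝ) {B R : ℕ} (y : Fin B → Fin R → ℝ) :
    svb θ y = θ * ((∑ b, (rowMean (y b) - (∑ b, rowMean (y b)) / B) ^ 2) / ((B : ℝ) - 1)
      - (∑ b, rowVar (y b)) / B / R) := by
  rw [svb, withinVar_eq]
  rfl

@[fun_prop]
lemma measurable_svb (θ : ℝ) {B R : ℕ} : Measurable (svb θ : (Fin B → Fin R → ℝ) → ℝ) := by
  have : (svb θ : (Fin B → Fin R → ℝ) → ℝ) = fun y => _ := funext (svb_eq θ)
  rw [this]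
  fun_prop

/-- Isolates the squared sum of block means, the only term that couples different blocks. -/
lemma svb_eq_sum (θ : ℝ) {B R : ℕ} (hB : 0 < B) (y : Fin B → Fin R → ℝ) :
    svb θ y = θ * (∑ b, (rowMean (y b) ^ 2 / ((B : ℝ) - 1) - rowVar (y b) / B / R)
      - (∑ b, rowMean (y b)) ^ 2 / B / ((B : ℝ) - 1)) := by
  rw [svb_eq, sum_sub_mean_sq hB]
  simp only [Finset.sum_sub_distrib, Finset.sum_div]
  rw [sub_div, Finset.sum_div]
  ring

/-- Recombination of two copies of the blocks `b₀` and `b₁`. -/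
def recombine {E : Type*} {B : ℕ} (b₀ b₁ : Fin B) (p q : E × E → E) (y : Fin B → E × E) :
    Fin B → E :=
  fun b => if b = b₀ then p (y b) else if b = b₁ then q (y b) else (y b).1

/-- A mixed second difference in two blocks kills every function of a single block. What survives is
the cross product in the squared sum of block means, so the within-block variances play no role. -/
lemma svb_cross (θ : ℝ) {B R : ℕ} (hB : 2 ≤ B) {b₀ b₁ : Fin B} (hb : b₀ ≠ b₁)
    (y : Fin B → (Fin R → ℝ) × (Fin R → ℝ)) :
    svb θ (recombine b₀ b₁ Prod.fst Prod.fst y) - svb θ (recombine b₀ b₁ Prod.snd Prod.fst y)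
      - svb θ (recombine b₀ b₁ Prod.fst Prod.snd y) + svb θ (recombine b₀ b₁ Prod.snd Prod.snd y)
      = - (2 * θ / (B * ((B : ℝ) - 1))) * ((rowMean (y b₀).1 - rowMean (y b₀).2)
        * (rowMean (y b₁).1 - rowMean (y b₁).2)) := by
  have hB' : (2 : ℝ) ≤ B := by exact_mod_cast hB
  have key : ∀ (f : (Fin R → ℝ) → ℝ) (p q : (Fin R → ℝ) × (Fin R → ℝ) → (Fin R → ℝ)),
      ∑ b, f (recombine b₀ b₁ p q y b)
        = ∑ b ∈ Finset.univ \ {b₀, b₁}, f (y b).1 + (f (p (y b₀)) + f (q (y b₁))) := by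
    intro f p q
    rw [← Finset.sum_sdiff (Finset.subset_univ {b₀, b₁}), Finset.sum_pair hb]
    congr 1
    · refine Finset.sum_congr rfl fun b hbm => ?_
      simp only [Finset.mem_sdiff, Finset.mem_insert, Finset.mem_singleton, not_or] at hbm
      simp [recombine, hbm.2.1, hbm.2.2]
    · simp [recombine, hb.symm]
  have hB1 : (B : ℝ) - 1 ≠ 0 := by linarith
  have hB0 : (B : ℝ) ≠ 0 := by linarith
  simp only [svb_eq_sum θ (by omega : 0 < B)]
  simp only [key rowMean, key fun z => rowMean z ^ 2 / ((B : ℝ) - 1) - rowVar z / B / R]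
  generalize ∑ b ∈ Finset.univ \ {b₀, b₁}, rowMean (y b).1 = s
  generalize ∑ b ∈ Finset.univ \ {b₀, b₁},
    (rowMean (y b).1 ^ 2 / ((B : ℝ) - 1) - rowVar (y b).1 / B / R) = t
  field_simp
  ring

lemma measurePreserving_recombine {E : Type*} [MeasurableSpace E] {B : ℕ} (b₀ b₁ : Fin B)
    {p q : E × E → E} (ν : Measure E) [IsProbabilityMeasure ν]
    (hp : MeasurePreserving p (ν.prod ν) ν) (hq : MeasurePreserving q (ν.prod ν) ν) :
    MeasurePreserving (recombine b₀ b₁ p q) (Measure.pi fun _ : Fin B => ν.prod ν)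
      (Measure.pi fun _ : Fin B => ν) := by
  refine measurePreserving_pi (fun _ : Fin B => ν.prod ν) (fun _ => ν)
    (f := fun b z => if b = b₀ then p z else if b = b₁ then q z else z.1) fun b => ?_
  by_cases h0 : b = b₀
  · simpa [h0] using hp
  · by_cases h1 : b = b₁
    · simpa [h0, h1, h1 ▸ h0] using hq
    · simpa [h0, h1] using measurePreserving_fst

set_option maxHeartbeats 800000 in
/-- The estimator cannot be close to `1` with probability close to one if there are few blocks. -/
lemma le_measureReal_svb_far {B R M : ℕ} (hB : 2 ≤ B) (hBM : B ≤ M) (hR : 2 ≤ R)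
    (ν : Measure (Fin R → ℝ)) [IsProbabilityMeasure ν] {lam : ℝ} (hlam : 0 ≤ lam) :
    1 / (16 * (M : ℝ) ^ 2) ≤ (Measure.pi fun _ : Fin B => ν).real
      {y | 1 / (8 * (M : ℝ) ^ 2) ≤ |svb lam y - 1|} := by
  have hB' : (2 : ℝ) ≤ B := by exact_mod_cast hB
  have hM' : (B : ℝ) ≤ M := by exact_mod_cast hBM
  have hR' : (2 : ℝ) ≤ R := by exact_mod_cast hR
  -- Chosen so that `4 ε · M² / 2 = 1 / 4`: four values within `ε` of `1` have a second difference
  -- below `4 ε`, and `B (B - 1) / 2 ≤ M² / 2` undoes the factor in `svb_cross`.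
  set ε : ℝ := 1 / (8 * (M : ℝ) ^ 2) with hε
  have hM4 : (4 : ℝ) ≤ (M : ℝ) ^ 2 := by nlinarith
  have hεle : ε ≤ 1 / 2 := by
    rw [hε]; apply one_div_le_one_div_of_le <;> linarith
  set bad : Set (Fin B → Fin R → ℝ) := {y | ε ≤ |svb lam y - 1|} with hbad
  have hbadm : MeasurableSet bad := measurableSet_le measurable_const (by fun_prop)
  set π := Measure.pi fun _ : Fin B => ν with hπ
  set δ := π.real bad with hδ
  let b₀ : Fin B := ⟨0, by omega⟩
  let b₁ : Fin B := ⟨1, by omega⟩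
  have hb : b₀ ≠ b₁ := by simp [b₀, b₁]
  set A : Set ((Fin R → ℝ) × (Fin R → ℝ)) :=
    {z | 1 / 4 < lam * (rowMean z.1 - rowMean z.2) ^ 2} with hA
  have hAm : MeasurableSet A := measurableSet_lt measurable_const (by fun_prop)
  set p := (ν.prod ν).real A with hp
  -- two far pairs force one of the recombinations to be bad
  have hp2 : p ^ 2 ≤ 4 * δ := by
    set P := Measure.pi fun _ : Fin B => ν.prod ν with hP
    have hind : iIndepFun (fun (b : Fin B) (y : Fin B → (Fin R → ℝ) × (Fin R → ℝ)) => y b) P :=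
      iIndepFun_pi (X := fun _ z => z) fun _ => aemeasurable_id
    have h1 : P.real ((fun y => y b₀) ⁻¹' A ∩ (fun y => y b₁) ⁻¹' A) = p ^ 2 := by
      rw [measureReal_def, (hind.indepFun hb).measure_inter_preimage_eq_mul _ _ hAm hAm,
        (measurePreserving_eval (fun _ : Fin B => ν.prod ν) b₀).measure_preimage
          hAm.nullMeasurableSet,
        (measurePreserving_eval (fun _ : Fin B => ν.prod ν) b₁).measure_preimage
          hAm.nullMeasurableSet, ENNReal.toReal_mul, sq]
      rfl
    have h2 : ∀ f g : (Fin R → ℝ) × (Fin R → ℝ) → (Fin R → ℝ),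
        MeasurePreserving f (ν.prod ν) ν → MeasurePreserving g (ν.prod ν) ν →
        P.real (recombine b₀ b₁ f g ⁻¹' bad) = δ := by
      intro f g hf hg
      rw [measureReal_def, (measurePreserving_recombine b₀ b₁ ν hf hg).measure_preimage
        hbadm.nullMeasurableSet]
      rfl
    have hsub : (fun y => y b₀) ⁻¹' A ∩ (fun y => y b₁) ⁻¹' A ⊆
        ((recombine b₀ b₁ Prod.fst Prod.fst ⁻¹' bad ∪ recombine b₀ b₁ Prod.snd Prod.fst ⁻¹' bad)
        ∪ recombine b₀ b₁ Prod.fst Prod.snd ⁻¹' bad) ∪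
          recombine b₀ b₁ Prod.snd Prod.snd ⁻¹' bad := by
      rintro y ⟨hy0, hy1⟩
      by_contra hcon
      simp only [Set.mem_union, Set.mem_preimage, hbad, Set.mem_ofPred_eq, not_or, not_le] at hcon
      obtain ⟨⟨⟨c1, c2⟩, c3⟩, c4⟩ := hcon
      have hx := svb_cross lam hB hb y
      rw [abs_lt] at c1 c2 c3 c4
      set u := rowMean (y b₀).1 - rowMean (y b₀).2
      set v := rowMean (y b₁).1 - rowMean (y b₁).2
      have hu : 1 / 4 < lam * u ^ 2 := hy0
      have hv : 1 / 4 < lam * v ^ 2 := hy1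
      have hBB : 0 < (B : ℝ) * (B - 1) := by nlinarith
      have hsm : |2 * lam / (B * ((B : ℝ) - 1)) * (u * v)| < 4 * ε := by
        rw [abs_lt]; constructor <;> linarith
      have hlt : |lam * (u * v)| < 1 / 4 := by
        have : lam * (u * v)
            = (2 * lam / (B * ((B : ℝ) - 1)) * (u * v)) * (B * ((B : ℝ) - 1) / 2) := by
          have hB1 : (B : ℝ) - 1 ≠ 0 := by linarith
          field_simp
        rw [this, abs_mul, abs_of_pos (by positivity : 0 < (B : ℝ) * (B - 1) / 2)]
        calc _ < 4 * ε * (B * ((B : ℝ) - 1) / 2) := by gcongr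
          _ ≤ 4 * ε * ((M : ℝ) ^ 2 / 2) := by
            have : 0 ≤ ε := by positivity
            gcongr
            nlinarith
          _ = 1 / 4 := by
            rw [hε]
            have : (M : ℝ) ≠ 0 := by nlinarith
            field_simp; norm_num
      have hsq : (lam * (u * v)) ^ 2 < (1 / 4) ^ 2 := by
        rw [← sq_abs]; gcongr
      nlinarith [mul_lt_mul'' hu hv (by norm_num) (by norm_num)]
    have h3 : P.real ((fun y => y b₀) ⁻¹' A ∩ (fun y => y b₁) ⁻¹' A) ≤ δ + δ + δ + δ := by
      refine (measureReal_mono hsub).trans ?_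
      have f1 : MeasurePreserving (Prod.fst : _ → (Fin R → ℝ)) (ν.prod ν) ν :=
        measurePreserving_fst
      have f2 : MeasurePreserving (Prod.snd : _ → (Fin R → ℝ)) (ν.prod ν) ν :=
        measurePreserving_snd
      refine (measureReal_union_le _ _).trans (add_le_add ?_ (h2 _ _ f2 f2).le)
      refine (measureReal_union_le _ _).trans (add_le_add ?_ (h2 _ _ f1 f2).le)
      exact (measureReal_union_le _ _).trans (add_le_add (h2 _ _ f1 f1).le (h2 _ _ f2 f1).le)
    linarith
  -- if all blocks are close to each other, the estimator is small
  have hone : 1 ≤ δ + B * p := by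
    have hcov : (Set.univ : Set (Fin B → Fin R → ℝ)) ⊆
        bad ∪ ⋃ b : Fin B, {y | b ≠ b₀ ∧ (y b, y b₀) ∈ A} := by
      intro y _
      by_contra hcon
      simp only [Set.mem_union, Set.mem_iUnion, hbad, hA, Set.mem_ofPred_eq, not_or, not_le,
        not_exists, not_and, not_lt] at hcon
      obtain ⟨c1, c2⟩ := hcon
      have c3 : ∀ b, lam * (rowMean (y b) - rowMean (y b₀)) ^ 2 ≤ 1 / 4 := by
        intro b
        by_cases hbb : b = b₀
        · simp [hbb]
        · exact c2 b hbb
      -- Dropping the nonnegative correction and centring at block `b₀` instead of the grand mean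
      -- only increases the value, and `B / (4 (B - 1)) ≤ 1 / 2` for `B ≥ 2`. This contradicts a
      -- value within `ε ≤ 1 / 2` of `1`.
      have c4 : svb lam y ≤ 1 / 2 := by
        rw [svb_eq]
        have hv : 0 ≤ (∑ b, rowVar (y b)) / B / R :=
          div_nonneg (div_nonneg (Finset.sum_nonneg fun b _ => rowVar_nonneg hR _)
            (by positivity)) (by positivity)
        have hs := sum_sub_mean_sq_le (by omega : 0 < B) (fun b => rowMean (y b))
          (rowMean (y b₀))
        calc _ ≤ lam * ((∑ b, (rowMean (y b) - rowMean (y b₀)) ^ 2) / ((B : ℝ) - 1)) := by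
              refine mul_le_mul_of_nonneg_left ?_ hlam
              have : (0 : ℝ) ≤ (B : ℝ) - 1 := by linarith
              refine (sub_le_self _ hv).trans ?_
              gcongr
          _ = (∑ b, lam * (rowMean (y b) - rowMean (y b₀)) ^ 2) / ((B : ℝ) - 1) := by
              rw [← Finset.mul_sum, mul_div_assoc]
          _ ≤ (∑ _b : Fin B, (1 / 4 : ℝ)) / ((B : ℝ) - 1) := by
              have : (0 : ℝ) ≤ (B : ℝ) - 1 := by linarith
              gcongr with b _
              exact c3 b
          _ ≤ 1 / 2 := by
              simp only [Finset.sum_const, Finset.card_univ, Fintype.card_fin, nsmul_eq_mul]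
              rw [div_le_iff₀ (by linarith)]
              linarith
      rw [abs_lt] at c1
      linarith [c1.1]
    have hpair : ∀ b : Fin B, π.real {y | b ≠ b₀ ∧ (y b, y b₀) ∈ A} ≤ p := by
      intro b
      by_cases hbb : b = b₀
      · simp only [hbb, ne_eq, not_true_eq_false, false_and, Set.ofPred_false, measureReal_empty]
        exact measureReal_nonneg
      have hind : iIndepFun (fun (b : Fin B) (y : Fin B → (Fin R → ℝ)) => y b) π :=
        iIndepFun_pi (X := fun _ z => z) fun _ => aemeasurable_id
      have hmap := (indepFun_iff_map_prod_eq_prod_map_map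
        (measurable_pi_apply b).aemeasurable (measurable_pi_apply b₀).aemeasurable).1
        (hind.indepFun hbb)
      rw [(measurePreserving_eval (fun _ : Fin B => ν) b).map_eq,
        (measurePreserving_eval (fun _ : Fin B => ν) b₀).map_eq] at hmap
      rw [hp, ← hmap, map_measureReal_apply (by fun_prop) hAm]
      exact measureReal_mono fun y hy => hy.2
    calc (1 : ℝ) = π.real Set.univ := by simp
      _ ≤ π.real (bad ∪ ⋃ b : Fin B, {y | b ≠ b₀ ∧ (y b, y b₀) ∈ A}) := measureReal_mono hcov
      _ ≤ δ + π.real (⋃ b : Fin B, {y | b ≠ b₀ ∧ (y b, y b₀) ∈ A}) := measureReal_union_le _ _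
      _ ≤ δ + ∑ b : Fin B, π.real {y | b ≠ b₀ ∧ (y b, y b₀) ∈ A} := by
          gcongr; exact measureReal_iUnion_fintype_le _
      _ ≤ δ + ∑ _b : Fin B, p := by gcongr with b _; exact hpair b
      _ = δ + B * p := by simp
  have hp0 : 0 ≤ p := measureReal_nonneg
  -- If `δ < 1 / (16 M²)` then `p² ≤ 4 δ` gives `p < 1 / (2 M)`, whence `δ + B p < 1 / 4 + 1 / 2 <
  -- 1`.
  by_contra! hlt
  have hMpos : (0 : ℝ) < M := by linarith
  have hp3 : p < 1 / (2 * M) := by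
    refine lt_of_pow_lt_pow_left₀ 2 (by positivity) ?_
    calc p ^ 2 ≤ 4 * δ := hp2
      _ < 4 * (1 / (16 * (M : ℝ) ^ 2)) := by gcongr
      _ = (1 / (2 * M)) ^ 2 := by rw [div_pow, mul_pow]; field_simp; norm_num
  have h5 : (B : ℝ) * p ≤ 1 / 2 := by
    calc (B : ℝ) * p ≤ M * (1 / (2 * M)) := by gcongr
      _ = 1 / 2 := by field_simp
  have h6 : 1 / (16 * (M : ℝ) ^ 2) ≤ 1 / 4 := by
    apply one_div_le_one_div_of_le <;> linarith
  linarith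

end FewBlocks

/-! ### From the bound for few blocks to the necessary budget -/

section Necessity

variable {m : ℕ} {𝒳 : Fin m → Type*} [∀ i, MeasurableSpace (𝒳 i)]

lemma card_resample_pos {n : Fin m → ℕ} (hn : ∀ i, 0 < n i) (s : Fin m → ℕ) :
    0 < Fintype.card (Resample n s) := by
  have : ∀ i, Nonempty (Fin (n i)) := fun i => ⟨⟨0, hn i⟩⟩
  exact Fintype.card_pos

lemma isProbabilityMeasure_blockLaw (sim : Kernel (∀ i, Measure (𝒳 i)) ℝ) [IsMarkovKernel sim]
    {n : Fin m → ℕ} (hn : ∀ i, 0 < n i) (s : Fin m → ℕ) (R : ℕ) (x : Data 𝒳 n) :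
    IsProbabilityMeasure (blockLaw sim s R x) := by
  refine ⟨?_⟩
  have := (card_resample_pos hn s).ne'
  simp only [blockLaw, Measure.smul_apply, Measure.finsetSum_apply, measure_univ,
    Finset.sum_const, Finset.card_univ, smul_eq_mul, nsmul_eq_mul, mul_one]
  exact ENNReal.inv_mul_cancel (by exact_mod_cast this) (ENNReal.natCast_ne_top _)

/-- The bound for few blocks holds for every block law, hence conditionally on every data set with
the same constants, and survives integration over the data. -/
lemma isLittleOmega_of_relConsistent (F : ∀ i, Measure (𝒳 i)) [∀ i, IsProbabilityMeasure (F i)]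
    (ψ : (∀ i, Measure (𝒳 i)) → ℝ) (sim : Kernel (∀ i, Measure (𝒳 i)) ℝ) [IsMarkovKernel sim]
    (n : ℕ → Fin m → ℕ) (hn : ∀ k i, 0 < n k i) (θ : ℕ → ℝ) (B R : ℕ → ℕ)
    (hadm : Admissible n θ B R) (h : RelConsistent F ψ sim n θ B R) :
    Tendsto (fun k => (B k : ℝ)) atTop atTop := by
  refine tendsto_natCast_atTop_atTop.comp (tendsto_atTop.2 fun M₀ => ?_)
  set M := M₀ + 1 with hM
  have hMpos : (0 : ℝ) < M := by rw [hM]; positivity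
  have h1 := h (1 / (8 * (M : ℝ) ^ 2)) (by positivity)
  have h2 := h1.eventually_lt_const
    (ENNReal.ofReal_pos.2 (by positivity : (0 : ℝ) < 1 / (16 * (M : ℝ) ^ 2)))
  filter_upwards [h2] with k hk
  by_contra! hlt
  refine absurd hk (not_lt.2 ?_)
  have hprob : IsProbabilityMeasure (dataLaw F (n k)) := by unfold dataLaw; infer_instance
  calc ENNReal.ofReal (1 / (16 * (M : ℝ) ^ 2))
      = ∫⁻ _x, ENNReal.ofReal (1 / (16 * (M : ℝ) ^ 2)) ∂(dataLaw F (n k)) := by simp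
    _ ≤ _ := by
      refine lintegral_mono fun x => ?_
      have := isProbabilityMeasure_blockLaw sim (hn k) (subSize (θ k) (n k)) (R k) x
      have hvar : 0 ≤ inputVar F ψ (n k) := variance_nonneg _ _
      have key := le_measureReal_svb_far (M := M) (hadm.2 k).1 (by omega) (hadm.2 k).2
        (blockLaw sim (subSize (θ k) (n k)) (R k) x)
        (div_nonneg (hadm.1 k).1.le hvar)
      refine (ENNReal.ofReal_le_ofReal key).trans ?_
      rw [measureReal_def, ENNReal.ofReal_toReal (measure_ne_top _ _)]
      refine measure_mono fun y hy => ?_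
      simp only [Set.mem_ofPred_eq] at hy ⊢
      -- Linearity in `θ` absorbs the normalisation. A vanishing input variance is covered, both
      -- sides then being `0`.
      have : svb (θ k) y / inputVar F ψ (n k) = svb (θ k / inputVar F ψ (n k)) y := by
        simp only [svb]; ring
      rwa [this]

lemma isLittleOmega_budget_of_relConsistent (F : ∀ i, Measure (𝒳 i))
    [∀ i, IsProbabilityMeasure (F i)]
    (ψ : (∀ i, Measure (𝒳 i)) → ℝ) (sim : Kernel (∀ i, Measure (𝒳 i)) ℝ) [IsMarkovKernel sim]
    (n : ℕ → Fin m → ℕ) (hn : ∀ k i, 0 < n k i) (θ : ℕ → ℝ) (B R : ℕ → ℕ)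
    (hadm : Admissible n θ B R) (h : RelConsistent F ψ sim n θ B R) :
    IsLittleOmega (fun k => (B k : ℝ) * (R k : ℝ)) (fun _ => 1) := by
  refine tendsto_atTop_mono (fun k => ?_)
    (isLittleOmega_of_relConsistent F ψ sim n hn θ B R hadm h)
  have hR : (1 : ℝ) ≤ R k := by exact_mod_cast le_trans (by norm_num) (hadm.2 k).2
  rw [div_one]
  exact (le_mul_of_one_le_right (by positivity) hR).trans (le_abs_self _)

end Necessity

/-! ### Moment inequalities -/

section Moments

variable {Ω : Type*} [MeasurableSpace Ω] {μ : Measure Ω}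

lemma sq_integral_mul_le {X Y : Ω → ℝ} (hX : MemLp X 2 μ) (hY : MemLp Y 2 μ) :
    (∫ ω, X ω * Y ω ∂μ) ^ 2 ≤ (∫ ω, X ω ^ 2 ∂μ) * ∫ ω, Y ω ^ 2 ∂μ := by
  have hXY : Integrable (fun ω => X ω * Y ω) μ := hX.integrable_mul hY
  have h : ∀ t : ℝ, 0 ≤ (∫ ω, Y ω ^ 2 ∂μ) * (t * t) + (2 * ∫ ω, X ω * Y ω ∂μ) * t
      + ∫ ω, X ω ^ 2 ∂μ := by
    intro t
    have h1 : ∫ ω, (X ω + t * Y ω) ^ 2 ∂μ = (∫ ω, Y ω ^ 2 ∂μ) * (t * t)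
        + (2 * ∫ ω, X ω * Y ω ∂μ) * t + ∫ ω, X ω ^ 2 ∂μ := by
      have h2 : ∀ ω, (X ω + t * Y ω) ^ 2
          = (t * t) * Y ω ^ 2 + (2 * t) * (X ω * Y ω) + X ω ^ 2 := fun ω => by ring
      simp only [h2]
      rw [integral_add ((hY.integrable_sq.const_mul _).fun_add (hXY.const_mul _)) hX.integrable_sq,
        integral_add (hY.integrable_sq.const_mul _) (hXY.const_mul _), integral_const_mul,
        integral_const_mul]
      ring
    rw [← h1]
    exact integral_nonneg fun ω => sq_nonneg _
  have := discrim_le_zero h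
  rw [discrim] at this
  nlinarith

lemma abs_integral_mul_le {X Y : Ω → ℝ} (hX : MemLp X 2 μ) (hY : MemLp Y 2 μ) :
    |∫ ω, X ω * Y ω ∂μ| ≤ √(∫ ω, X ω ^ 2 ∂μ) * √(∫ ω, Y ω ^ 2 ∂μ) := by
  rw [← Real.sqrt_mul (integral_nonneg fun ω => sq_nonneg _)]
  exact Real.abs_le_sqrt (sq_integral_mul_le hX hY)

lemma sq_integral_le [IsProbabilityMeasure μ] {X : Ω → ℝ} (hX : MemLp X 2 μ) :
    (∫ ω, X ω ∂μ) ^ 2 ≤ ∫ ω, X ω ^ 2 ∂μ := by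
  have := sq_integral_mul_le hX (memLp_const (1 : ℝ))
  simpa using this

lemma abs_integral_add_sq_sub_le {X Y : Ω → ℝ} (hX : MemLp X 2 μ) (hY : MemLp Y 2 μ) :
    |∫ ω, (X ω + Y ω) ^ 2 ∂μ - ∫ ω, X ω ^ 2 ∂μ| ≤
      2 * (√(∫ ω, X ω ^ 2 ∂μ) * √(∫ ω, Y ω ^ 2 ∂μ)) + ∫ ω, Y ω ^ 2 ∂μ := by
  have hXY : Integrable (fun ω => X ω * Y ω) μ := hX.integrable_mul hY
  have h1 : ∫ ω, (X ω + Y ω) ^ 2 ∂μ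
      = ∫ ω, X ω ^ 2 ∂μ + 2 * ∫ ω, X ω * Y ω ∂μ + ∫ ω, Y ω ^ 2 ∂μ := by
    have h2 : ∀ ω, (X ω + Y ω) ^ 2 = X ω ^ 2 + 2 * (X ω * Y ω) + Y ω ^ 2 := fun ω => by ring
    simp only [h2]
    rw [integral_add (hX.integrable_sq.fun_add (hXY.const_mul _)) hY.integrable_sq,
      integral_add hX.integrable_sq (hXY.const_mul _), integral_const_mul]
  have h3 : 0 ≤ ∫ ω, Y ω ^ 2 ∂μ := integral_nonneg fun ω => sq_nonneg _
  have h4 := abs_integral_mul_le hX hY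
  rw [h1, abs_le]
  rw [abs_le] at h4
  constructor <;> linarith

/-- The variance is stable under perturbations that are small in mean square. -/
lemma abs_variance_add_sub_le [IsProbabilityMeasure μ] {X Y : Ω → ℝ} (hX : MemLp X 2 μ)
    (hX0 : ∫ ω, X ω ∂μ = 0) (hY : MemLp Y 2 μ) (c : ℝ) :
    |Var[fun ω => c + X ω + Y ω; μ] - ∫ ω, X ω ^ 2 ∂μ| ≤
      2 * (√(∫ ω, X ω ^ 2 ∂μ) * √(∫ ω, Y ω ^ 2 ∂μ)) + ∫ ω, Y ω ^ 2 ∂μ := by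
  set b := ∫ ω, Y ω ∂μ with hb
  have hY' : MemLp (fun ω => Y ω - b) 2 μ := hY.sub (memLp_const b)
  have hvar : Var[fun ω => c + X ω + Y ω; μ] = ∫ ω, (X ω + (Y ω - b)) ^ 2 ∂μ := by
    have hXi := hX.integrable one_le_two
    have hYi := hY.integrable one_le_two
    have hm : AEMeasurable (fun ω => c + X ω + Y ω) μ :=
      (hX.aestronglyMeasurable.aemeasurable.const_add c).add
        hY.aestronglyMeasurable.aemeasurable
    rw [variance_eq_integral hm]
    have : ∫ ω, (c + X ω + Y ω) ∂μ = c + b := by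
      rw [integral_add ((integrable_const c).fun_add hXi) hYi, integral_add (integrable_const c) hXi]
      simp [hX0, hb]
    rw [this]
    congr 1 with ω
    ring
  have hle : ∫ ω, (Y ω - b) ^ 2 ∂μ ≤ ∫ ω, Y ω ^ 2 ∂μ := by
    rw [hb, ← variance_eq_integral hY.aestronglyMeasurable.aemeasurable]
    exact variance_le_expectation_sq hY.aestronglyMeasurable
  rw [hvar]
  refine (abs_integral_add_sq_sub_le hX hY').trans ?_
  gcongr

lemma memLp_four_iff {X : Ω → ℝ} (hX : AEStronglyMeasurable X μ) :
    MemLp X 4 μ ↔ Integrable (fun ω => X ω ^ 4) μ := by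
  rw [← integrable_norm_rpow_iff hX (by norm_num) (by norm_num)]
  refine integrable_congr (ae_of_all _ fun ω => ?_)
  simp only [ENNReal.toReal_ofNat, Real.norm_eq_abs]
  rw [show (4 : ℝ) = ((4 : ℕ) : ℝ) by norm_num, Real.rpow_natCast, Even.pow_abs (by decide)]

lemma memLp_sq_of_memLp_four {X : Ω → ℝ} (hX : MemLp X 4 μ) : MemLp (fun ω => X ω ^ 2) 2 μ := by
  refine (memLp_two_iff_integrable_sq (hX.aestronglyMeasurable.fun_pow 2)).2 ?_
  have := (memLp_four_iff hX.aestronglyMeasurable).1 hX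
  refine this.congr (ae_of_all _ fun ω => ?_)
  ring

lemma MemLp.two_of_four [IsFiniteMeasure μ] {X : Ω → ℝ} (hX : MemLp X 4 μ) : MemLp X 2 μ :=
  hX.mono_exponent (by norm_num)

lemma sq_integral_sq_le [IsProbabilityMeasure μ] {X : Ω → ℝ} (hX : MemLp X 4 μ) :
    (∫ ω, X ω ^ 2 ∂μ) ^ 2 ≤ ∫ ω, X ω ^ 4 ∂μ := by
  have := sq_integral_le (memLp_sq_of_memLp_four hX)
  simpa only [← pow_mul] using this

lemma integral_sq_le_sqrt [IsProbabilityMeasure μ] {X : Ω → ℝ} (hX : MemLp X 4 μ) :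
    ∫ ω, X ω ^ 2 ∂μ ≤ √(∫ ω, X ω ^ 4 ∂μ) :=
  Real.le_sqrt_of_sq_le (sq_integral_sq_le hX)

lemma integrable_cube [IsFiniteMeasure μ] {X : Ω → ℝ} (hX : MemLp X 4 μ) :
    Integrable (fun ω => X ω ^ 3) μ := by
  have h1 := MemLp.integrable_mul (p := 2) (q := 2) (memLp_sq_of_memLp_four hX)
    (MemLp.two_of_four hX)
  refine h1.congr (ae_of_all _ fun ω => ?_)
  simp only [Pi.mul_apply]
  ring

lemma add_pow_four_le (a b : ℝ) : (a + b) ^ 4 ≤ 8 * (a ^ 4 + b ^ 4) := by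
  nlinarith [sq_nonneg (a - b), sq_nonneg (a + b), sq_nonneg (a ^ 2 - b ^ 2),
    sq_nonneg (a * (a - b)), sq_nonneg (b * (a - b)), sq_nonneg (a ^ 2 + b ^ 2),
    sq_nonneg (a ^ 2 + b ^ 2 - 2 * a * b)]

/-- By Jensen the fourth power of the distance from `c` to the mean is at most the fourth moment
about `c`; with `(a + b)⁴ ≤ 8 (a⁴ + b⁴)` this gives `8 (1 + 1) = 16`. -/
lemma integral_pow_four_sub_mean_le [IsProbabilityMeasure μ] {X : Ω → ℝ} (hX : MemLp X 4 μ)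
    (c : ℝ) : ∫ ω, (X ω - ∫ ω, X ω ∂μ) ^ 4 ∂μ ≤ 16 * ∫ ω, (X ω - c) ^ 4 ∂μ := by
  set a := ∫ ω, X ω ∂μ with ha
  have hc : MemLp (fun ω => X ω - c) 4 μ := hX.sub (memLp_const c)
  have hc4 : Integrable (fun ω => (X ω - c) ^ 4) μ :=
    (memLp_four_iff hc.aestronglyMeasurable).1 hc
  have h1 : (c - a) ^ 4 ≤ ∫ ω, (X ω - c) ^ 4 ∂μ := by
    have h2 : (∫ ω, (X ω - c) ∂μ) = a - c := by
      rw [integral_sub (hX.integrable (by norm_num)) (integrable_const c)]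
      simp [ha]
    have h3 := sq_integral_le (MemLp.two_of_four hc)
    have h4 := sq_integral_sq_le hc
    rw [h2] at h3
    calc (c - a) ^ 4 = ((a - c) ^ 2) ^ 2 := by ring
      _ ≤ (∫ ω, (X ω - c) ^ 2 ∂μ) ^ 2 := by gcongr
      _ ≤ _ := h4
  calc ∫ ω, (X ω - a) ^ 4 ∂μ ≤ ∫ ω, 8 * ((X ω - c) ^ 4 + (c - a) ^ 4) ∂μ := by
        refine integral_mono_of_nonneg (ae_of_all _ fun ω => by positivity)
          ((hc4.add (integrable_const _)).const_mul 8) (ae_of_all _ fun ω => ?_)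
        have := add_pow_four_le (X ω - c) (c - a)
        simpa using this
    _ = 8 * ((∫ ω, (X ω - c) ^ 4 ∂μ) + (c - a) ^ 4) := by
        rw [integral_const_mul, integral_add hc4 (integrable_const _)]
        simp
    _ ≤ _ := by linarith

/-- The fourth moment of a sum of independent centred random variables. -/
lemma integral_sum_pow_four_le [IsProbabilityMeasure μ] {ι : Type*} {X : ι → Ω → ℝ}
    (hind : iIndepFun X μ) (hX : ∀ i, MemLp (X i) 4 μ) (hmean : ∀ i, ∫ ω, X i ω ∂μ = 0)
    {M : ℝ} (hM : ∀ i, ∫ ω, X i ω ^ 4 ∂μ ≤ M) (s : Finset ι) :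
    ∫ ω, (∑ i ∈ s, X i ω) ^ 2 ∂μ ≤ s.card * √M ∧
    ∫ ω, (∑ i ∈ s, X i ω) ^ 4 ∂μ ≤ 3 * (s.card : ℝ) ^ 2 * M := by
  classical
  -- Both bounds are proved together because the fourth-moment step has a cross term `6 E[S²]
  -- E[Z²]`. The terms with a first power of `S` or `Z` vanish, and `3 k² + 6 k + 1 ≤ 3 (k + 1)²`.
  induction s using Finset.induction_on with
  | empty => simp
  | insert a s ha ih =>
    have hM0 : 0 ≤ M := (integral_nonneg fun ω => by positivity).trans (hM a)
    have hS : MemLp (fun ω => ∑ i ∈ s, X i ω) 4 μ := memLp_finsetSum s fun i _ => hX i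
    set S : Ω → ℝ := fun ω => ∑ i ∈ s, X i ω with hSdef
    set Z := X a with hZ
    have hZ4 := hX a
    have hSZ : IndepFun S Z μ := by
      have := hind.indepFun_finsetSum_of_notMem₀ (fun i => (hX i).aestronglyMeasurable.aemeasurable)
        ha
      convert this using 1
      ext ω
      simp [hSdef]
    have hSm : ∫ ω, S ω ∂μ = 0 := by
      simp only [hSdef]
      rw [integral_finsetSum _ fun i _ => (hX i).integrable (by norm_num)]
      exact Finset.sum_eq_zero fun i _ => hmean i
    have hprod : ∀ p q : ℕ, Integrable (fun ω => S ω ^ p) μ → Integrable (fun ω => Z ω ^ q) μ →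
        Integrable (fun ω => S ω ^ p * Z ω ^ q) μ ∧
        ∫ ω, S ω ^ p * Z ω ^ q ∂μ = (∫ ω, S ω ^ p ∂μ) * ∫ ω, Z ω ^ q ∂μ := by
      intro p q hp hq
      have hi : IndepFun (fun ω => S ω ^ p) (fun ω => Z ω ^ q) μ :=
        hSZ.comp (φ := fun t : ℝ => t ^ p) (ψ := fun t : ℝ => t ^ q) (by fun_prop) (by fun_prop)
      exact ⟨hi.integrable_mul hp hq,
        hi.integral_fun_mul_eq_mul_integral hp.aestronglyMeasurable hq.aestronglyMeasurable⟩
    have s1 : Integrable (fun ω => S ω ^ 1) μ := by simpa using hS.integrable (by norm_num)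
    have z1 : Integrable (fun ω => Z ω ^ 1) μ := by simpa using hZ4.integrable (by norm_num)
    have s2 := (MemLp.two_of_four hS).integrable_sq
    have z2 := (MemLp.two_of_four hZ4).integrable_sq
    have s3 := integrable_cube hS
    have z3 := integrable_cube hZ4
    have s4 := (memLp_four_iff hS.aestronglyMeasurable).1 hS
    have z4 := (memLp_four_iff hZ4.aestronglyMeasurable).1 hZ4
    have hz1 : ∫ ω, Z ω ^ 1 ∂μ = 0 := by simpa using hmean a
    have hs1 : ∫ ω, S ω ^ 1 ∂μ = 0 := by simpa using hSm
    have hz2 : ∫ ω, Z ω ^ 2 ∂μ ≤ √M :=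
      (integral_sq_le_sqrt hZ4).trans (Real.sqrt_le_sqrt (hM a))
    have hz20 : 0 ≤ ∫ ω, Z ω ^ 2 ∂μ := integral_nonneg fun ω => sq_nonneg _
    have hs20 : 0 ≤ ∫ ω, S ω ^ 2 ∂μ := integral_nonneg fun ω => sq_nonneg _
    have hsq : √M * √M = M := Real.mul_self_sqrt hM0
    have e2 : ∫ ω, (S ω + Z ω) ^ 2 ∂μ = ∫ ω, S ω ^ 2 ∂μ + ∫ ω, Z ω ^ 2 ∂μ := by
      have h2 : ∀ ω, (S ω + Z ω) ^ 2 = S ω ^ 2 + 2 * (S ω ^ 1 * Z ω ^ 1) + Z ω ^ 2 :=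
        fun ω => by ring
      simp only [h2]
      rw [integral_add (s2.fun_add ((hprod 1 1 s1 z1).1.const_mul _)) z2,
        integral_add s2 ((hprod 1 1 s1 z1).1.const_mul _), integral_const_mul,
        (hprod 1 1 s1 z1).2, hs1]
      ring
    have e4 : ∫ ω, (S ω + Z ω) ^ 4 ∂μ = ∫ ω, S ω ^ 4 ∂μ
        + 6 * ((∫ ω, S ω ^ 2 ∂μ) * ∫ ω, Z ω ^ 2 ∂μ) + ∫ ω, Z ω ^ 4 ∂μ := by
      have h2 : ∀ ω, (S ω + Z ω) ^ 4 = S ω ^ 4 + 4 * (S ω ^ 3 * Z ω ^ 1)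
          + 6 * (S ω ^ 2 * Z ω ^ 2) + 4 * (S ω ^ 1 * Z ω ^ 3) + Z ω ^ 4 := fun ω => by ring
      simp only [h2]
      have i31 := (hprod 3 1 s3 z1).1.const_mul 4
      have i22 := (hprod 2 2 s2 z2).1.const_mul 6
      have i13 := (hprod 1 3 s1 z3).1.const_mul 4
      rw [integral_add (((s4.fun_add i31).fun_add i22).fun_add i13) z4,
        integral_add ((s4.fun_add i31).fun_add i22) i13, integral_add (s4.fun_add i31) i22,
        integral_add s4 i31, integral_const_mul, integral_const_mul, integral_const_mul,
        (hprod 3 1 s3 z1).2, (hprod 2 2 s2 z2).2, (hprod 1 3 s1 z3).2, hs1, hz1]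
      ring
    have hsum : ∀ ω, ∑ i ∈ insert a s, X i ω = S ω + Z ω := fun ω => by
      rw [Finset.sum_insert ha, add_comm]
    simp only [hsum, Finset.card_insert_of_notMem ha]
    push_cast
    refine ⟨?_, ?_⟩
    · rw [e2]
      linarith [ih.1]
    · rw [e4]
      have h6 : (∫ ω, S ω ^ 2 ∂μ) * ∫ ω, Z ω ^ 2 ∂μ ≤ (s.card * √M) * √M :=
        mul_le_mul ih.1 hz2 hz20 (by positivity)
      have h7 : (s.card * √M) * √M = s.card * M := by rw [mul_assoc, hsq]
      have := hM a
      nlinarith [ih.2]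

end Moments

/-! ### Averages over independent samples -/

section Averages

variable {E : Type*} [MeasurableSpace E] (ν : Measure E) [IsProbabilityMeasure ν]

lemma memLp_average {f : E → ℝ} {p : ℝ≥0∞} (hf : MemLp f p ν) (s : ℕ) :
    MemLp (fun z : Fin s → E => (∑ j, f (z j)) / s) p (Measure.pi fun _ => ν) := by
  simp only [div_eq_mul_inv]
  exact (memLp_finsetSum _ fun j _ =>
    hf.comp_measurePreserving (measurePreserving_eval (fun _ => ν) j)).mul_const _

lemma integral_eval_pi {s : ℕ} {f : E → ℝ} (hf : AEStronglyMeasurable f ν) (j : Fin s) :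
    ∫ z, f (z j) ∂(Measure.pi fun _ : Fin s => ν) = ∫ z, f z ∂ν :=
  integral_comp_eval (μ := fun _ : Fin s => ν) hf

lemma integral_average {f : E → ℝ} (hf : Integrable f ν) {s : ℕ} (hs : 0 < s) :
    ∫ z, (∑ j, f (z j)) / s ∂(Measure.pi fun _ : Fin s => ν) = ∫ z, f z ∂ν := by
  have hj : ∀ j : Fin s, Integrable (fun z : Fin s → E => f (z j)) (Measure.pi fun _ => ν) :=
    fun j => (measurePreserving_eval (fun _ : Fin s => ν) j).integrable_comp_of_integrable hf
  rw [integral_div, integral_finsetSum _ fun j _ => hj j]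
  simp only [integral_eval_pi ν hf.aestronglyMeasurable]
  have : (s : ℝ) ≠ 0 := by exact_mod_cast hs.ne'
  simp [this]

lemma variance_average {f : E → ℝ} (hf : MemLp f 2 ν) (s : ℕ) :
    Var[fun z : Fin s → E => (∑ j, f (z j)) / s; Measure.pi fun _ => ν] = Var[f; ν] / s := by
  have h := variance_sum_pi (μ := fun _ : Fin s => ν) (X := fun _ => f) fun _ => hf
  have h2 : (∑ j : Fin s, fun z : Fin s → E => f (z j)) = fun z => ∑ j, f (z j) := by
    ext z; simp
  rw [h2] at h
  simp only [div_eq_inv_mul]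
  rw [variance_const_mul, h]
  simp only [Finset.sum_const, Finset.card_univ, Fintype.card_fin, nsmul_eq_mul]
  by_cases hs : (s : ℝ) = 0
  · simp [hs]
  · field_simp

lemma integral_average_pow_four_le {f : E → ℝ} (hf : MemLp f 4 ν) (hf0 : ∫ z, f z ∂ν = 0)
    (s : ℕ) : ∫ z, ((∑ j, f (z j)) / s) ^ 4 ∂(Measure.pi fun _ : Fin s => ν)
      ≤ 3 * (∫ z, f z ^ 4 ∂ν) / (s : ℝ) ^ 2 := by
  have hind : iIndepFun (fun (j : Fin s) (z : Fin s → E) => f (z j)) (Measure.pi fun _ => ν) :=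
    iIndepFun_pi fun _ => hf.aestronglyMeasurable.aemeasurable
  have h := (integral_sum_pow_four_le hind
    (fun j => hf.comp_measurePreserving (measurePreserving_eval (fun _ => ν) j))
    (fun j => (integral_eval_pi ν hf.aestronglyMeasurable j).trans hf0)
    (fun j => (integral_eval_pi ν (hf.aestronglyMeasurable.pow 4) j).le) Finset.univ).2
  simp only [div_pow]
  rw [integral_div]
  rcases Nat.eq_zero_or_pos s with hs | hs
  · subst hs; simp
  rw [div_le_div_iff₀ (by positivity) (by positivity)]
  simp only [Finset.card_univ, Fintype.card_fin] at h
  calc _ ≤ (3 * (s : ℝ) ^ 2 * ∫ z, f z ^ 4 ∂ν) * (s : ℝ) ^ 2 := by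
        gcongr
        exact h
    _ = _ := by ring

variable {m : ℕ} {𝒴 : Fin m → Type*} [∀ i, MeasurableSpace (𝒴 i)]
  (F : ∀ i, Measure (𝒴 i)) [∀ i, IsProbabilityMeasure (F i)]

instance isProbabilityMeasure_dataLaw (s : Fin m → ℕ) : IsProbabilityMeasure (dataLaw F s) := by
  unfold dataLaw; infer_instance

/-- The sum over the input models of the sample averages of `f i`. -/
noncomputable def totalAverage (f : ∀ i, 𝒴 i → ℝ) {s : Fin m → ℕ} (z : Data 𝒴 s) : ℝ :=
  ∑ i, (∑ j, f i (z i j)) / s i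

lemma measurePreserving_eval_dataLaw (s : Fin m → ℕ) (i : Fin m) :
    MeasurePreserving (fun z : Data 𝒴 s => z i) (dataLaw F s)
      (Measure.pi fun _ : Fin (s i) => F i) :=
  measurePreserving_eval (fun i => Measure.pi fun _ : Fin (s i) => F i) i

lemma memLp_totalAverage {f : ∀ i, 𝒴 i → ℝ} {p : ℝ≥0∞} (hf : ∀ i, MemLp (f i) p (F i))
    (s : Fin m → ℕ) : MemLp (totalAverage f) p (dataLaw F s) := by
  unfold totalAverage
  exact memLp_finsetSum _ fun i _ =>
    (memLp_average (F i) (hf i) (s i)).comp_measurePreserving (measurePreserving_eval_dataLaw F s i)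

lemma integral_totalAverage {f : ∀ i, 𝒴 i → ℝ} (hf : ∀ i, Integrable (f i) (F i))
    {s : Fin m → ℕ} (hs : ∀ i, 0 < s i) :
    ∫ z, totalAverage f z ∂(dataLaw F s) = ∑ i, ∫ z, f i z ∂(F i) := by
  unfold totalAverage
  have hA : ∀ i, Integrable (fun z : Fin (s i) → 𝒴 i => (∑ j, f i (z j)) / s i)
      (Measure.pi fun _ => F i) := fun i =>
    memLp_one_iff_integrable.1 (memLp_average (F i) (memLp_one_iff_integrable.2 (hf i)) (s i))
  have hA' : ∀ i, Integrable (fun z : Data 𝒴 s => (∑ j, f i (z i j)) / s i) (dataLaw F s) :=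
    fun i => (measurePreserving_eval_dataLaw F s i).integrable_comp_of_integrable (hA i)
  rw [integral_finsetSum _ fun i _ => hA' i]
  refine Finset.sum_congr rfl fun i _ => ?_
  rw [← integral_average (F i) (hf i) (hs i)]
  exact integral_comp_eval (μ := fun i => Measure.pi fun _ : Fin (s i) => F i)
    (hA i).aestronglyMeasurable

lemma variance_totalAverage {f : ∀ i, 𝒴 i → ℝ} (hf : ∀ i, MemLp (f i) 2 (F i))
    (s : Fin m → ℕ) :
    Var[totalAverage f; dataLaw F s] = ∑ i, Var[f i; F i] / s i := by
  have h := variance_sum_pi (μ := fun i => Measure.pi fun _ : Fin (s i) => F i)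
    (X := fun i z => (∑ j, f i (z j)) / s i) fun i => memLp_average (F i) (hf i) (s i)
  simp only [variance_average (F _) (hf _)] at h
  rw [← h]
  congr 1
  ext z
  simp [totalAverage]

lemma sum_pow_four_le (u : Fin m → ℝ) : (∑ i, u i) ^ 4 ≤ (m : ℝ) ^ 3 * ∑ i, u i ^ 4 := by
  have h1 : (∑ i, u i) ^ 2 ≤ m * ∑ i, u i ^ 2 := by
    simpa using sq_sum_le_card_mul_sum_sq (s := Finset.univ) (f := u)
  have h2 : (∑ i, u i ^ 2) ^ 2 ≤ m * ∑ i, (u i ^ 2) ^ 2 := by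
    simpa using sq_sum_le_card_mul_sum_sq (s := Finset.univ) (f := fun i => u i ^ 2)
  calc (∑ i, u i) ^ 4 = ((∑ i, u i) ^ 2) ^ 2 := by ring
    _ ≤ (m * ∑ i, u i ^ 2) ^ 2 := by gcongr
    _ = (m : ℝ) ^ 2 * (∑ i, u i ^ 2) ^ 2 := by ring
    _ ≤ (m : ℝ) ^ 2 * (m * ∑ i, (u i ^ 2) ^ 2) := by gcongr
    _ = _ := by simp only [← pow_mul]; ring

lemma integral_totalAverage_pow_four_le {f : ∀ i, 𝒴 i → ℝ} (hf : ∀ i, MemLp (f i) 4 (F i))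
    (hf0 : ∀ i, ∫ z, f i z ∂(F i) = 0) (s : Fin m → ℕ) :
    ∫ z, totalAverage f z ^ 4 ∂(dataLaw F s)
      ≤ (m : ℝ) ^ 3 * ∑ i, 3 * (∫ z, f i z ^ 4 ∂(F i)) / (s i : ℝ) ^ 2 := by
  have hA : ∀ i, MemLp (fun z : Fin (s i) → 𝒴 i => (∑ j, f i (z j)) / s i) 4
      (Measure.pi fun _ => F i) := fun i => memLp_average (F i) (hf i) (s i)
  have hA4 := fun i => (memLp_four_iff (hA i).aestronglyMeasurable).1 (hA i)
  have hA4' : ∀ i, Integrable (fun z : Data 𝒴 s => ((∑ j, f i (z i j)) / s i) ^ 4)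
      (dataLaw F s) := fun i =>
    (measurePreserving_eval_dataLaw F s i).integrable_comp_of_integrable (hA4 i)
  calc ∫ z, totalAverage f z ^ 4 ∂(dataLaw F s)
      ≤ ∫ z, (m : ℝ) ^ 3 * ∑ i, ((∑ j, f i (z i j)) / s i) ^ 4 ∂(dataLaw F s) :=
        integral_mono_of_nonneg (ae_of_all _ fun z => by positivity)
          ((integrable_finsetSum _ fun i _ => hA4' i).const_mul _)
          (ae_of_all _ fun z => sum_pow_four_le _)
    _ = (m : ℝ) ^ 3 * ∑ i, ∫ z, ((∑ j, f i (z i j)) / s i) ^ 4 ∂(dataLaw F s) := by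
        rw [integral_const_mul, integral_finsetSum _ fun i _ => hA4' i]
    _ ≤ _ := by
        gcongr with i _
        refine le_trans (le_of_eq ?_) (integral_average_pow_four_le (F i) (hf i) (hf0 i) (s i))
        exact integral_comp_eval (μ := fun i => Measure.pi fun _ : Fin (s i) => F i)
          (hA4 i).aestronglyMeasurable

end Averages

/-! ### The estimator given the law of one block -/

section Runs

variable {R : ℕ}

lemma integral_abs_le_sqrt {Ω : Type*} [MeasurableSpace Ω] {μ : Measure Ω}
    [IsProbabilityMeasure μ] {X : Ω → ℝ} (hX : MemLp X 2 μ) :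
    ∫ ω, |X ω| ∂μ ≤ √(∫ ω, X ω ^ 2 ∂μ) := by
  have h := sq_integral_le hX.abs
  simp only [Pi.abs_apply, sq_abs] at h
  exact Real.le_sqrt_of_sq_le h

/-- Mean absolute error of the estimator, given the law `ν` of one block. -/
lemma integral_abs_svb_sub_le {B : ℕ} (hB : 2 ≤ B) (ν : Measure (Fin R → ℝ))
    [IsProbabilityMeasure ν] {μ w Q : ℝ}
    (hU : MemLp (fun z => rowMean z - μ) 4 ν) (hU0 : ∫ z, (rowMean z - μ) ∂ν = 0)
    (hV : MemLp rowVar 2 ν)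
    (hw : ∫ z, ((rowMean z - μ) ^ 2 - rowVar z / R) ∂ν = w)
    (hU4 : ∫ z, (rowMean z - μ) ^ 4 ∂ν ≤ Q)
    (hW2 : ∫ z, ((rowMean z - μ) ^ 2 - rowVar z / R) ^ 2 ∂ν ≤ Q) {θ : ℝ} (hθ : 0 ≤ θ) :
    Integrable (fun y => |svb θ y - θ * w|) (Measure.pi fun _ : Fin B => ν) ∧
    ∫ y, |svb θ y - θ * w| ∂(Measure.pi fun _ : Fin B => ν) ≤ θ * (5 * √(Q / B)) := by
  set π := Measure.pi fun _ : Fin B => ν with hπ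
  have hB' : (2 : ℝ) ≤ B := by exact_mod_cast hB
  have hB0 : 0 < B := by omega
  set U : (Fin R → ℝ) → ℝ := fun z => rowMean z - μ with hUdef
  set W : (Fin R → ℝ) → ℝ := fun z => U z ^ 2 - rowVar z / R with hWdef
  have hUsq : MemLp (fun z => U z ^ 2) 2 ν := memLp_sq_of_memLp_four hU
  have hW : MemLp W 2 ν := hUsq.sub (by simpa only [div_eq_mul_inv] using hV.mul_const _)
  have hU2 := MemLp.two_of_four hU
  set A : (Fin B → Fin R → ℝ) → ℝ := fun y => (∑ b, W (y b)) / B with hA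
  set C : (Fin B → Fin R → ℝ) → ℝ := fun y => (∑ b, U (y b) ^ 2) / B with hC
  set D : (Fin B → Fin R → ℝ) → ℝ := fun y => (∑ b, U (y b)) / B with hD
  have mA : MemLp A 2 π := memLp_average ν hW B
  have mC : Integrable C π :=
    memLp_one_iff_integrable.1 (memLp_average ν (memLp_one_iff_integrable.2 hU2.integrable_sq) B)
  have mD : MemLp D 2 π := memLp_average ν hU2 B
  have iC : ∫ y, C y ∂π = ∫ z, U z ^ 2 ∂ν := integral_average ν hU2.integrable_sq hB0
  have iA : ∫ y, A y ∂π = w := (integral_average ν (hW.integrable one_le_two) hB0).trans hw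
  have iD0 : ∫ y, D y ∂π = 0 := (integral_average ν (hU2.integrable one_le_two) hB0).trans hU0
  have iD : ∫ y, D y ^ 2 ∂π = (∫ z, U z ^ 2 ∂ν) / B := by
    rw [← variance_of_integral_eq_zero mD.aestronglyMeasurable.aemeasurable iD0,
      variance_average ν hU2, variance_of_integral_eq_zero
        hU2.aestronglyMeasurable.aemeasurable hU0]
  have iA2 : ∫ y, (A y - w) ^ 2 ∂π ≤ Q / B := by
    have h1 := variance_average ν hW B
    rw [variance_eq_integral mA.aestronglyMeasurable.aemeasurable, iA] at h1
    rw [h1]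
    gcongr
    exact (variance_le_expectation_sq hW.aestronglyMeasurable).trans hW2
  have hQ0 : 0 ≤ Q := (integral_nonneg fun z => sq_nonneg _).trans hW2
  -- The first summand is a centred average of i.i.d. terms; the second pays for the unknown mean
  -- and for `B - 1` in place of `B`, and is of order `1 / B` because `E[B D²] = E[U²]`.
  have hdecomp : ∀ y, svb θ y - θ * w = θ * ((A y - w) + (C y - B * D y ^ 2) / ((B : ℝ) - 1)) := by
    intro y
    have hm : ∀ b, rowMean (y b) - (∑ b, rowMean (y b)) / B
        = U (y b) - (∑ b, U (y b)) / B := by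
      intro b
      simp only [hUdef, Finset.sum_sub_distrib, Finset.sum_const, Finset.card_univ,
        Fintype.card_fin, nsmul_eq_mul]
      have : (B : ℝ) ≠ 0 := by linarith
      field_simp
      ring
    rw [svb_eq]
    simp only [hm]
    rw [sum_sub_mean_sq hB0 fun b => U (y b)]
    simp only [hA, hC, hD, hWdef, Finset.sum_sub_distrib, ← Finset.sum_div]
    have h1 : (B : ℝ) ≠ 0 := by linarith
    have h2 : (B : ℝ) - 1 ≠ 0 := by linarith
    generalize ∑ b, U (y b) = p
    generalize ∑ b, U (y b) ^ 2 = q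
    generalize ∑ b, rowVar (y b) = r
    field_simp
    ring
  have hAw : MemLp (fun y => A y - w) 2 π := mA.sub (memLp_const w)
  have int2 : Integrable (fun y => (C y + B * D y ^ 2) / ((B : ℝ) - 1)) π :=
    (mC.fun_add (mD.integrable_sq.const_mul _)).div_const _
  have int3 : Integrable (fun y => (C y - B * D y ^ 2) / ((B : ℝ) - 1)) π :=
    (mC.sub (mD.integrable_sq.const_mul _)).div_const _
  have int1 : Integrable (fun y => |A y - w|) π := (hAw.integrable one_le_two).abs
  have intS : Integrable (fun y => |svb θ y - θ * w|) π := by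
    simp only [hdecomp]
    exact (((hAw.integrable one_le_two).fun_add int3).const_mul θ).abs
  refine ⟨intS, ?_⟩
  have hBm : (0 : ℝ) < (B : ℝ) - 1 := by linarith
  have hU2Q : ∫ z, U z ^ 2 ∂ν ≤ √Q := (integral_sq_le_sqrt hU).trans (Real.sqrt_le_sqrt hU4)
  calc ∫ y, |svb θ y - θ * w| ∂π
      ≤ ∫ y, θ * (|A y - w| + (C y + B * D y ^ 2) / ((B : ℝ) - 1)) ∂π := by
        refine integral_mono intS ((int1.fun_add int2).const_mul θ) fun y => ?_
        simp only [hdecomp, abs_mul, abs_of_nonneg hθ]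
        gcongr
        refine (abs_add_le _ _).trans ?_
        gcongr
        rw [abs_div, abs_of_pos hBm]
        gcongr
        have hC0 : 0 ≤ C y := by positivity
        have hD0 : 0 ≤ (B : ℝ) * D y ^ 2 := by positivity
        rw [abs_le]
        constructor <;> linarith
    _ = θ * ((∫ y, |A y - w| ∂π) + (∫ z, U z ^ 2 ∂ν + ∫ z, U z ^ 2 ∂ν) / ((B : ℝ) - 1)) := by
        rw [integral_const_mul, integral_add int1 int2, integral_div,
          integral_add mC (mD.integrable_sq.const_mul _), integral_const_mul, iC, iD]
        rw [mul_div_cancel₀ _ (by linarith : (B : ℝ) ≠ 0)]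
    _ ≤ θ * (√(Q / B) + (√Q + √Q) / ((B : ℝ) - 1)) := by
        gcongr
        exact (integral_abs_le_sqrt hAw).trans (Real.sqrt_le_sqrt iA2)
    _ ≤ θ * (5 * √(Q / B)) := by
        gcongr
        have hsB : √(B : ℝ) * √B = B := Real.mul_self_sqrt (by linarith)
        have hsB1 : 1 ≤ √(B : ℝ) := Real.one_le_sqrt.2 (by linarith)
        -- This is `√B ≤ 2 (B - 1)`, valid for `B ≥ 2`; together with the leading `√(Q / B)` it
        -- gives the constant `5`.
        have h4 : (√Q + √Q) / ((B : ℝ) - 1) ≤ 4 * √(Q / B) := by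
          rw [Real.sqrt_div hQ0, div_le_iff₀ hBm]
          have hsq := Real.sqrt_nonneg Q
          have e : 4 * (√Q / √B) * ((B : ℝ) - 1) = √Q * (4 * ((B : ℝ) - 1) / √B) := by ring
          rw [e, ← mul_two]
          gcongr
          rw [le_div_iff₀ (by linarith)]
          nlinarith
        linarith

lemma measure_svb_far_le {B : ℕ} (hB : 2 ≤ B) (ν : Measure (Fin R → ℝ))
    [IsProbabilityMeasure ν] {μ w Q : ℝ}
    (hU : MemLp (fun z => rowMean z - μ) 4 ν) (hU0 : ∫ z, (rowMean z - μ) ∂ν = 0)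
    (hV : MemLp rowVar 2 ν)
    (hw : ∫ z, ((rowMean z - μ) ^ 2 - rowVar z / R) ∂ν = w)
    (hU4 : ∫ z, (rowMean z - μ) ^ 4 ∂ν ≤ Q)
    (hW2 : ∫ z, ((rowMean z - μ) ^ 2 - rowVar z / R) ^ 2 ∂ν ≤ Q) {θ : ℝ} (hθ : 0 ≤ θ)
    {c : ℝ} (hc : 0 < c) :
    (Measure.pi fun _ : Fin B => ν) {y | c ≤ |svb θ y - θ * w|} ≤
      ENNReal.ofReal (θ * (5 * √(Q / B)) / c) := by
  obtain ⟨hi, hle⟩ := integral_abs_svb_sub_le hB ν hU hU0 hV hw hU4 hW2 hθ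
  have h := mul_meas_ge_le_integral_of_nonneg (ae_of_all _ fun y => abs_nonneg _) hi c
  rw [← ENNReal.ofReal_toReal (measure_ne_top (Measure.pi fun _ : Fin B => ν) _)]
  refine ENNReal.ofReal_le_ofReal ?_
  rw [le_div_iff₀ hc, mul_comm]
  exact h.trans hle

end Runs

/-! ### The law of one block as a mixture -/

section Mixtures

variable {R : ℕ}

lemma rowMean_sub (hR : 0 < R) (y : Fin R → ℝ) (a : ℝ) :
    rowMean y - a = (∑ r, (y r - a)) / R := by
  have : (R : ℝ) ≠ 0 := by exact_mod_cast hR.ne'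
  simp only [rowMean, Finset.sum_sub_distrib, Finset.sum_const, Finset.card_univ,
    Fintype.card_fin, nsmul_eq_mul]
  field_simp

/-- With `a` the true mean, unbiasedness of the sample variance and its bound by twice the mean
square become immediate. -/
lemma rowVar_eq (hR : 0 < R) (y : Fin R → ℝ) (a : ℝ) :
    rowVar y = (R * ((∑ r, (y r - a) ^ 2) / R) - R * (rowMean y - a) ^ 2) / ((R : ℝ) - 1) := by
  have hR0 : (R : ℝ) ≠ 0 := by exact_mod_cast hR.ne'
  have h := sum_sub_mean_sq hR fun r => y r - a
  rw [← rowMean_sub hR] at h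
  rw [rowMean_sub hR, rowVar, mul_div_cancel₀ _ hR0]
  congr 1
  have e : ∀ r, y r - a - (rowMean y - a) = y r - rowMean y := fun r => by ring
  simp only [e] at h
  rw [h, div_pow]
  field_simp

/-- The moments of a block of i.i.d. replications with law `κ`. -/
lemma block_moments (hR : 2 ≤ R) (κ : Measure ℝ) [IsProbabilityMeasure κ] {a : ℝ}
    (h4 : MemLp (fun y => y - a) 4 κ) (ha : ∫ y, (y - a) ∂κ = 0) :
    MemLp (fun z => rowMean z - a) 4 (Measure.pi fun _ : Fin R => κ) ∧
    ∫ z, (rowMean z - a) ∂(Measure.pi fun _ : Fin R => κ) = 0 ∧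
    ∫ z, (rowMean z - a) ^ 2 ∂(Measure.pi fun _ : Fin R => κ) = (∫ y, (y - a) ^ 2 ∂κ) / R ∧
    ∫ z, (rowMean z - a) ^ 4 ∂(Measure.pi fun _ : Fin R => κ)
      ≤ 3 * (∫ y, (y - a) ^ 4 ∂κ) / (R : ℝ) ^ 2 ∧
    MemLp rowVar 2 (Measure.pi fun _ : Fin R => κ) ∧
    ∫ z, rowVar z ∂(Measure.pi fun _ : Fin R => κ) = ∫ y, (y - a) ^ 2 ∂κ ∧
    ∫ z, rowVar z ^ 2 ∂(Measure.pi fun _ : Fin R => κ) ≤ 4 * ∫ y, (y - a) ^ 4 ∂κ := by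
  have hR' : (2 : ℝ) ≤ R := by exact_mod_cast hR
  have hR0 : 0 < R := by omega
  have hRm : (0 : ℝ) < (R : ℝ) - 1 := by linarith
  set f : ℝ → ℝ := fun y => y - a with hf
  set π := Measure.pi fun _ : Fin R => κ with hπ
  have hmean : ∀ z : Fin R → ℝ, rowMean z - a = (∑ r, f (z r)) / R := fun z => rowMean_sub hR0 z a
  have mM : MemLp (fun z => rowMean z - a) 4 π := by
    simp only [hmean]; exact memLp_average κ h4 R
  have f2 := MemLp.two_of_four h4
  have i0 : ∫ z, (rowMean z - a) ∂π = 0 := by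
    simp only [hmean]
    exact (integral_average κ (f2.integrable one_le_two) hR0).trans ha
  have i2 : ∫ z, (rowMean z - a) ^ 2 ∂π = (∫ y, f y ^ 2 ∂κ) / R := by
    rw [← variance_of_integral_eq_zero mM.aestronglyMeasurable.aemeasurable i0,
      ← variance_of_integral_eq_zero f2.aestronglyMeasurable.aemeasurable ha]
    simp only [hmean]
    exact variance_average κ f2 R
  have i4 : ∫ z, (rowMean z - a) ^ 4 ∂π ≤ 3 * (∫ y, f y ^ 4 ∂κ) / (R : ℝ) ^ 2 := by
    simp only [hmean]
    exact integral_average_pow_four_le κ h4 ha R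
  set G : (Fin R → ℝ) → ℝ := fun z => (∑ r, f (z r) ^ 2) / R with hG
  have mG : MemLp G 2 π := memLp_average κ (f := fun y => f y ^ 2) (memLp_sq_of_memLp_four h4) R
  have iG : ∫ z, G z ∂π = ∫ y, f y ^ 2 ∂κ := integral_average κ f2.integrable_sq hR0
  have hv : ∀ z : Fin R → ℝ, rowVar z = (R * G z - R * (rowMean z - a) ^ 2) / ((R : ℝ) - 1) :=
    fun z => rowVar_eq hR0 z a
  have mV : MemLp rowVar 2 π := by
    have : (rowVar : (Fin R → ℝ) → ℝ)
        = fun z => (R * G z - R * (rowMean z - a) ^ 2) * ((R : ℝ) - 1)⁻¹ := by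
      ext z; rw [hv, div_eq_mul_inv]
    rw [this]
    exact ((mG.const_mul _).sub ((memLp_sq_of_memLp_four mM).const_mul _)).mul_const _
  have iV : ∫ z, rowVar z ∂π = ∫ y, f y ^ 2 ∂κ := by
    simp only [hv]
    rw [integral_div, integral_sub ((mG.integrable one_le_two).const_mul _)
      ((MemLp.two_of_four mM).integrable_sq.const_mul _), integral_const_mul, integral_const_mul,
      iG, i2]
    field_simp
  have iV2 : ∫ z, rowVar z ^ 2 ∂π ≤ 4 * ∫ y, f y ^ 4 ∂κ := by
    have f4 : Integrable (fun y => f y ^ 4) κ := (memLp_four_iff h4.aestronglyMeasurable).1 h4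
    have i4' : Integrable (fun z : Fin R → ℝ => (∑ r, f (z r) ^ 4) / R) π :=
      memLp_one_iff_integrable.1 (memLp_average κ (f := fun y => f y ^ 4)
        (memLp_one_iff_integrable.2 f4) R)
    have h1 : ∫ z, 4 * ((∑ r, f (z r) ^ 4) / R) ∂π = 4 * ∫ y, f y ^ 4 ∂κ := by
      rw [integral_const_mul]
      congr 1
      exact integral_average κ (f := fun y => f y ^ 4) f4 hR0
    rw [← h1]
    refine integral_mono mV.integrable_sq (i4'.const_mul 4) fun z => ?_
    have hG0 : 0 ≤ G z := by positivity
    have hle : rowVar z ≤ 2 * G z := by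
      rw [hv, div_le_iff₀ hRm]
      have : 0 ≤ (R : ℝ) * (rowMean z - a) ^ 2 := by positivity
      nlinarith
    have hsq : G z ^ 2 ≤ (∑ r, f (z r) ^ 4) / R := by
      have h2 : (∑ r, f (z r) ^ 2) ^ 2 ≤ R * ∑ r, (f (z r) ^ 2) ^ 2 := by
        simpa using sq_sum_le_card_mul_sum_sq (s := Finset.univ) (f := fun r => f (z r) ^ 2)
      simp only [← pow_mul] at h2
      simp only [hG, div_pow]
      rw [div_le_div_iff₀ (by positivity) (by positivity)]
      calc _ ≤ (R * ∑ r, f (z r) ^ (2 * 2)) * (R : ℝ) := by gcongr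
        _ = _ := by ring
    have h0 := rowVar_nonneg hR z
    calc rowVar z ^ 2 ≤ (2 * G z) ^ 2 := by gcongr
      _ = 4 * G z ^ 2 := by ring
      _ ≤ _ := by gcongr
  exact ⟨mM, i0, i2, i4, mV, iV, iV2⟩

variable {I : Type*} [Fintype I]

/-- The average of a function on a finite type. -/
noncomputable def uMean (f : I → ℝ) : ℝ := (∑ i, f i) / (Fintype.card I : ℝ)

lemma uMean_mono {f g : I → ℝ} (h : ∀ i, f i ≤ g i) : uMean f ≤ uMean g := by
  unfold uMean
  gcongr with i _
  exact h i

lemma uMean_add (f g : I → ℝ) : uMean (fun i => f i + g i) = uMean f + uMean g := by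
  simp only [uMean, Finset.sum_add_distrib, add_div]

lemma uMean_const_mul (c : ℝ) (f : I → ℝ) : uMean (fun i => c * f i) = c * uMean f := by
  simp only [uMean, ← Finset.mul_sum, mul_div_assoc]

lemma uMean_sub_self [Nonempty I] (f : I → ℝ) : uMean (fun i => f i - uMean f) = 0 := by
  have : (Fintype.card I : ℝ) ≠ 0 := by exact_mod_cast Fintype.card_ne_zero
  simp only [uMean, Finset.sum_sub_distrib, Finset.sum_const, Finset.card_univ, nsmul_eq_mul]
  field_simp
  ring

/-- The uniform mixture of finitely many measures. -/
noncomputable def uMix {E : Type*} [MeasurableSpace E] (κ : I → Measure E) : Measure E :=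
  (Fintype.card I : ℝ≥0∞)⁻¹ • ∑ i, κ i

lemma integrable_uMix [Nonempty I] {E : Type*} [MeasurableSpace E] {κ : I → Measure E}
    {f : E → ℝ} (hf : ∀ i, Integrable f (κ i)) : Integrable f (uMix κ) :=
  (integrable_finsetSum_measure.2 fun i _ => hf i).smul_measure
    (ENNReal.inv_ne_top.2 (by exact_mod_cast Fintype.card_ne_zero))

lemma integral_uMix {E : Type*} [MeasurableSpace E] {κ : I → Measure E}
    {f : E → ℝ} (hf : ∀ i, Integrable f (κ i)) :
    ∫ z, f z ∂(uMix κ) = uMean fun i => ∫ z, f z ∂(κ i) := by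
  rw [uMix, integral_smul_measure, integral_finsetSum_measure fun i _ => hf i, uMean,
    ENNReal.toReal_inv, ENNReal.toReal_natCast, smul_eq_mul, inv_mul_eq_div]

/-- The estimator given the data: the block law is a uniform mixture of product measures. -/
lemma measure_svb_far_uMix_le [Nonempty I] {B : ℕ} (hB : 2 ≤ B) (hR : 2 ≤ R)
    (κ : I → Measure ℝ) [∀ i, IsProbabilityMeasure (κ i)] {a : I → ℝ}
    (h4 : ∀ i, MemLp (fun y => y - a i) 4 (κ i)) (ha : ∀ i, ∫ y, (y - a i) ∂(κ i) = 0)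
    [IsProbabilityMeasure (uMix fun i => Measure.pi fun _ : Fin R => κ i)]
    {K M : ℝ} (hK : uMean (fun i => (a i - uMean a) ^ 4) ≤ K)
    (hM : uMean (fun i => ∫ y, (y - a i) ^ 4 ∂(κ i)) ≤ M)
    {θ : ℝ} (hθ : 0 ≤ θ) {c : ℝ} (hc : 0 < c) :
    (Measure.pi fun _ : Fin B => uMix fun i => Measure.pi fun _ : Fin R => κ i)
      {y | c ≤ |svb θ y - θ * uMean (fun i => (a i - uMean a) ^ 2)|} ≤
      ENNReal.ofReal (θ * (5 * √((16 * K + 56 * M / (R : ℝ) ^ 2) / B)) / c) := by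
  set μ := uMean a with hμ
  set P : I → Measure (Fin R → ℝ) := fun i => Measure.pi fun _ : Fin R => κ i with hP
  have hR' : (2 : ℝ) ≤ R := by exact_mod_cast hR
  have hmom := fun i => block_moments hR (κ i) (h4 i) (ha i)
  have hsplit : ∀ (i : I) (z : Fin R → ℝ), rowMean z - μ = (rowMean z - a i) + (a i - μ) :=
    fun i z => by ring
  have mU : ∀ i, MemLp (fun z => rowMean z - μ) 4 (P i) := by
    intro i
    simp only [hsplit i]
    exact (hmom i).1.add (memLp_const _)
  have mU4 : ∀ i, Integrable (fun z => (rowMean z - μ) ^ 4) (P i) := fun i =>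
    (memLp_four_iff (mU i).aestronglyMeasurable).1 (mU i)
  have mV := fun i => (hmom i).2.2.2.2.1
  have mV2 := fun i => (mV i).integrable_sq
  have hUi : MemLp (fun z => rowMean z - μ) 4 (uMix P) :=
    (memLp_four_iff (by fun_prop)).2 (integrable_uMix mU4)
  have hVi : MemLp rowVar 2 (uMix P) :=
    (memLp_two_iff_integrable_sq (by fun_prop)).2 (integrable_uMix mV2)
  have iU : ∀ i, ∫ z, (rowMean z - μ) ∂(P i) = a i - μ := by
    intro i
    simp only [hsplit i]
    rw [integral_add ((hmom i).1.integrable (by norm_num)) (integrable_const _), (hmom i).2.1]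
    simp
  have iU2 : ∀ i, ∫ z, (rowMean z - μ) ^ 2 ∂(P i)
      = (a i - μ) ^ 2 + (∫ y, (y - a i) ^ 2 ∂(κ i)) / R := by
    intro i
    have e : ∀ z : Fin R → ℝ, (rowMean z - μ) ^ 2 = (rowMean z - a i) ^ 2
        + 2 * (a i - μ) * (rowMean z - a i) + (a i - μ) ^ 2 := fun z => by ring
    simp only [e]
    have j1 := (hmom i).1.integrable (by norm_num)
    have j2 := (MemLp.two_of_four (hmom i).1).integrable_sq
    rw [integral_add (j2.fun_add (j1.const_mul _)) (integrable_const _),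
      integral_add j2 (j1.const_mul _), integral_const_mul, (hmom i).2.1, (hmom i).2.2.1]
    simp [add_comm]
  -- The correction cancels the simulation variance within each component of the mixture, so
  -- averaging over `i` leaves the variance of `a` with no simulation bias.
  have iW : ∀ i, ∫ z, ((rowMean z - μ) ^ 2 - rowVar z / R) ∂(P i) = (a i - μ) ^ 2 := by
    intro i
    rw [integral_sub (MemLp.two_of_four (mU i)).integrable_sq
      (((mV i).integrable one_le_two).div_const _), integral_div, iU2,
      (hmom i).2.2.2.2.2.1]
    ring
  have iU4 : ∀ i, ∫ z, (rowMean z - μ) ^ 4 ∂(P i)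
      ≤ 8 * (a i - μ) ^ 4 + 24 / (R : ℝ) ^ 2 * ∫ y, (y - a i) ^ 4 ∂(κ i) := by
    intro i
    have j4 := (memLp_four_iff (hmom i).1.aestronglyMeasurable).1 (hmom i).1
    calc ∫ z, (rowMean z - μ) ^ 4 ∂(P i)
        ≤ ∫ z, 8 * ((rowMean z - a i) ^ 4 + (a i - μ) ^ 4) ∂(P i) := by
          refine integral_mono (mU4 i) ((j4.fun_add (integrable_const _)).const_mul 8) fun z => ?_
          simp only [hsplit i z]
          exact add_pow_four_le _ _
      _ = 8 * ((∫ z, (rowMean z - a i) ^ 4 ∂(P i)) + (a i - μ) ^ 4) := by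
          rw [integral_const_mul, integral_add j4 (integrable_const _)]
          simp [hP]
      _ ≤ 8 * (3 * (∫ y, (y - a i) ^ 4 ∂(κ i)) / (R : ℝ) ^ 2 + (a i - μ) ^ 4) := by
          gcongr
          exact (hmom i).2.2.2.1
      _ = _ := by ring
  have tU4 : ∫ z, (rowMean z - μ) ^ 4 ∂(uMix P) ≤ 8 * K + 24 / (R : ℝ) ^ 2 * M := by
    rw [integral_uMix mU4]
    refine (uMean_mono iU4).trans ?_
    rw [uMean_add, uMean_const_mul, uMean_const_mul]
    gcongr
  have tV2 : ∫ z, rowVar z ^ 2 ∂(uMix P) ≤ 4 * M := by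
    rw [integral_uMix mV2]
    refine (uMean_mono fun i => (hmom i).2.2.2.2.2.2).trans ?_
    rw [uMean_const_mul]
    gcongr
  have hK0 : 0 ≤ K := le_trans (div_nonneg (Finset.sum_nonneg fun i _ => by positivity)
    (by positivity)) hK
  have hM0 : 0 ≤ M := by linarith [(integral_nonneg fun z => sq_nonneg _).trans tV2]
  refine measure_svb_far_le hB (uMix P) (μ := μ) hUi ?_ hVi ?_ ?_ ?_ hθ hc
  · rw [integral_uMix fun i => (mU i).integrable (by norm_num)]
    simp only [iU]
    exact uMean_sub_self a
  · have jW : ∀ i, Integrable (fun z => (rowMean z - μ) ^ 2 - rowVar z / R) (P i) := fun i =>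
      (MemLp.two_of_four (mU i)).integrable_sq.sub (((mV i).integrable one_le_two).div_const _)
    rw [integral_uMix jW]
    simp only [iW]
  · refine tU4.trans ?_
    have : 0 ≤ M / (R : ℝ) ^ 2 := by positivity
    have e1 : 24 / (R : ℝ) ^ 2 * M = 24 * (M / (R : ℝ) ^ 2) := by ring
    have e2 : 56 * M / (R : ℝ) ^ 2 = 56 * (M / (R : ℝ) ^ 2) := by ring
    rw [e1, e2]
    linarith
  -- Here the constants arise: `2 · 8 = 16` in front of `K`, and `2 · 24 + 2 · 4 = 56` in front of
  -- `M / R²`.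
  · have jU4 := integrable_uMix mU4
    have jV2 := integrable_uMix mV2
    calc ∫ z, ((rowMean z - μ) ^ 2 - rowVar z / R) ^ 2 ∂(uMix P)
        ≤ ∫ z, (2 * (rowMean z - μ) ^ 4 + 2 / (R : ℝ) ^ 2 * rowVar z ^ 2) ∂(uMix P) := by
          refine integral_mono_of_nonneg (ae_of_all _ fun z => sq_nonneg _)
            ((jU4.const_mul _).fun_add (jV2.const_mul _)) (ae_of_all _ fun z => ?_)
          have e : 2 / (R : ℝ) ^ 2 * rowVar z ^ 2 = 2 * (rowVar z / R) ^ 2 := by ring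
          simp only [e]
          nlinarith [sq_nonneg ((rowMean z - μ) ^ 2 + rowVar z / R)]
      _ = 2 * ∫ z, (rowMean z - μ) ^ 4 ∂(uMix P)
          + 2 / (R : ℝ) ^ 2 * ∫ z, rowVar z ^ 2 ∂(uMix P) := by
          rw [integral_add (jU4.const_mul _) (jV2.const_mul _), integral_const_mul,
            integral_const_mul]
      _ ≤ 2 * (8 * K + 24 / (R : ℝ) ^ 2 * M) + 2 / (R : ℝ) ^ 2 * (4 * M) := by gcongr
      _ = _ := by ring

end Mixtures

/-! ### Resampling -/

section Empirical

variable {E : Type*} [MeasurableSpace E] [MeasurableSingletonClass E]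

lemma isProbabilityMeasure_empirical {E : Type*} [MeasurableSpace E] {s : ℕ} (hs : 0 < s)
    (x : Fin s → E) : IsProbabilityMeasure (empirical x) := by
  refine ⟨?_⟩
  simp only [empirical, Measure.smul_apply, Measure.finsetSum_apply, measure_univ,
    Finset.sum_const, Finset.card_univ, smul_eq_mul, nsmul_eq_mul, mul_one, Fintype.card_fin]
  exact ENNReal.inv_mul_cancel (by exact_mod_cast hs.ne') (ENNReal.natCast_ne_top _)

lemma integral_empirical {s : ℕ} (x : Fin s → E) (f : E → ℝ) :
    ∫ z, f z ∂(empirical x) = (∑ j, f (x j)) / s := by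
  rw [empirical, integral_smul_measure, integral_finsetSum_measure fun i _ =>
    integrable_dirac (by simp)]
  simp [integral_dirac, inv_mul_eq_div]

end Empirical

/-! ### Resamples as independent draws of indices -/

section Resampling

variable {m : ℕ} {n s : Fin m → ℕ}

/-- The uniform distribution on resamples, seen as the law of a data set. -/
noncomputable abbrev resampleLaw (n s : Fin m → ℕ) : Measure (Resample n s) :=
  dataLaw (fun i => empirical (id : Fin (n i) → Fin (n i))) s

lemma resampleLaw_singleton (hn : ∀ i, 0 < n i) (ι : Resample n s) :
    (resampleLaw n s).real {ι} = (Fintype.card (Resample n s) : ℝ)⁻¹ := by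
  have := fun i => isProbabilityMeasure_empirical (hn i) (id : Fin (n i) → Fin (n i))
  have h1 : ∀ i (j : Fin (n i)), empirical (id : Fin (n i) → Fin (n i)) {j} = (n i : ℝ≥0∞)⁻¹ := by
    intro i j
    simp only [empirical, Measure.smul_apply, Measure.finsetSum_apply, id, smul_eq_mul]
    rw [Finset.sum_eq_single j]
    · simp
    · intro b _ hb
      simp [hb]
    · simp
  rw [measureReal_def, resampleLaw, dataLaw, Measure.pi_singleton]
  simp only [Measure.pi_singleton, h1, Finset.prod_const, Finset.card_univ, Fintype.card_fin,
    ENNReal.toReal_prod, ENNReal.toReal_pow, ENNReal.toReal_inv, ENNReal.toReal_natCast]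
  simp only [Resample, Fintype.card_pi, Finset.prod_const, Finset.card_univ, Fintype.card_fin,
    Nat.cast_prod, Nat.cast_pow, inv_pow, Finset.prod_inv_distrib]

/-- Makes the uniform average over resamples an integral against a product law of independent draws,
so the moment bounds for independent samples apply to the bootstrap unchanged. -/
lemma integral_resampleLaw (hn : ∀ i, 0 < n i) (f : Resample n s → ℝ) :
    ∫ ι, f ι ∂(resampleLaw n s) = uMean f := by
  have := fun i => isProbabilityMeasure_empirical (hn i) (id : Fin (n i) → Fin (n i))
  rw [integral_fintype (Integrable.of_finite)]
  simp only [resampleLaw_singleton hn, smul_eq_mul, uMean, inv_mul_eq_div, Finset.sum_div]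

/-- The bootstrap variance and fourth central moment of a linear statistic with an error term. -/
lemma resample_moments (hn : ∀ i, 0 < n i) (hs : ∀ i, 0 < s i) (h : ∀ i, Fin (n i) → ℝ)
    (h0 : ∀ i, ∑ j, h i j = 0) (e : Resample n s → ℝ) (c : ℝ) :
    |uMean (fun ι => (c + totalAverage h ι + e ι
        - uMean fun ι => c + totalAverage h ι + e ι) ^ 2)
      - ∑ i, (∑ j, h i j ^ 2) / n i / s i| ≤
        2 * (√(∑ i, (∑ j, h i j ^ 2) / n i / s i) * √√(uMean fun ι => e ι ^ 4))
          + √(uMean fun ι => e ι ^ 4) ∧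
    uMean (fun ι => (c + totalAverage h ι + e ι
        - uMean fun ι => c + totalAverage h ι + e ι) ^ 4) ≤
      128 * ((m : ℝ) ^ 3 * (∑ i, 3 * ((∑ j, h i j ^ 4) / n i) / (s i : ℝ) ^ 2)
        + uMean fun ι => e ι ^ 4) := by
  have := fun i => isProbabilityMeasure_empirical (hn i) (id : Fin (n i) → Fin (n i))
  set π := resampleLaw n s with hπ
  have hF : ∀ i p, MemLp (h i) p (empirical (id : Fin (n i) → Fin (n i))) :=
    fun i p => MemLp.of_discrete
  have hF0 : ∀ i, ∫ z, h i z ∂(empirical (id : Fin (n i) → Fin (n i))) = 0 := by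
    intro i
    rw [integral_empirical]
    simp [h0 i]
  have hT : ∀ p, MemLp (fun ι : Resample n s => totalAverage h ι) p π :=
    fun p => MemLp.of_discrete
  have he : ∀ p, MemLp e p π := fun p => MemLp.of_discrete
  have ha : ∀ p, MemLp (fun ι => c + totalAverage h ι + e ι) p π := fun p => MemLp.of_discrete
  have hvarT : Var[totalAverage h; π] = ∑ i, (∑ j, h i j ^ 2) / n i / s i := by
    rw [hπ, resampleLaw, variance_totalAverage _ (fun i => hF i 2)]
    refine Finset.sum_congr rfl fun i _ => ?_
    rw [variance_of_integral_eq_zero (hF i 2).aestronglyMeasurable.aemeasurable (hF0 i),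
      integral_empirical]
    rfl
  have hT4 := integral_totalAverage_pow_four_le
    (fun i => empirical (id : Fin (n i) → Fin (n i))) (fun i => hF i 4) hF0 s
  simp only [integral_empirical, id] at hT4
  have he4 : ∫ ι, e ι ^ 4 ∂π = uMean fun ι => e ι ^ 4 := integral_resampleLaw hn _
  have hmean : ∫ ι, (c + totalAverage h ι + e ι) ∂π
      = uMean fun ι => c + totalAverage h ι + e ι := integral_resampleLaw hn _
  have he2 : ∫ ι, e ι ^ 2 ∂π ≤ √(uMean fun ι => e ι ^ 4) := by
    rw [← he4]; exact integral_sq_le_sqrt (he 4)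
  constructor
  · have hT0 : ∫ ι, totalAverage h ι ∂π = 0 := by
      rw [hπ, resampleLaw, integral_totalAverage _ (fun i => (hF i 1).integrable le_rfl) hs]
      exact Finset.sum_eq_zero fun i _ => hF0 i
    have key := abs_variance_add_sub_le (hT 2) hT0 (he 2) c
    rw [variance_eq_integral (ha 2).aestronglyMeasurable.aemeasurable, hmean,
      integral_resampleLaw hn,
      ← variance_of_integral_eq_zero (hT 2).aestronglyMeasurable.aemeasurable hT0, hvarT] at key
    refine key.trans ?_
    gcongr
  -- Recentring at `c` costs a factor `16` and separating the linear part from the error a factor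
  -- `8`, hence `128`.
  · have key := integral_pow_four_sub_mean_le (ha 4) c
    rw [hmean, integral_resampleLaw hn] at key
    refine key.trans ?_
    have hTi : Integrable (fun ι : Resample n s => totalAverage h ι ^ 4) π := Integrable.of_finite
    have hei : Integrable (fun ι => e ι ^ 4) π := Integrable.of_finite
    have h2 : ∫ ι, (c + totalAverage h ι + e ι - c) ^ 4 ∂π
        ≤ 8 * ((∫ ι, totalAverage h ι ^ 4 ∂π) + uMean fun ι => e ι ^ 4) := by
      rw [← he4, ← integral_add hTi hei, ← integral_const_mul]
      refine integral_mono_of_nonneg (ae_of_all _ fun ι => by positivity)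
        ((hTi.fun_add hei).const_mul 8) (ae_of_all _ fun ι => ?_)
      have := add_pow_four_le (totalAverage h ι) (e ι)
      simpa [add_assoc] using this
    calc 16 * ∫ ι, (c + totalAverage h ι + e ι - c) ^ 4 ∂π
        ≤ 16 * (8 * ((∫ ι, totalAverage h ι ^ 4 ∂π) + uMean fun ι => e ι ^ 4)) := by gcongr
      _ = 128 * ((∫ ι, totalAverage h ι ^ 4 ∂π) + uMean fun ι => e ι ^ 4) := by ring
      _ ≤ _ := by gcongr

end Resampling

/-! ### Bounds at a fixed sample size -/

section FixedSize

variable {m : ℕ}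

/-- A nonempty subsample loses at most half its nominal size to rounding, since `t < ⌊t⌋ + 1 ≤ 2
⌊t⌋`. -/
lemma half_le_floor {t : ℝ} (h : 1 ≤ ⌊t⌋₊) : t / 2 ≤ ⌊t⌋₊ := by
  have h1 : t < ⌊t⌋₊ + 1 := Nat.lt_floor_add_one t
  have h2 : (1 : ℝ) ≤ ⌊t⌋₊ := by exact_mod_cast h
  linarith

variable {n : Fin m → ℕ} {θ c : ℝ}

lemma mul_avgSize_div_subSize_le (hn : ∀ i, 0 < n i) (hθ : 0 < θ)
    (hs : ∀ i, 1 ≤ subSize θ n i) (hc : ∀ i, avgSize n ≤ c * n i) (i : Fin m) :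
    avgSize n * θ / subSize θ n i ≤ 2 * c := by
  have hi : (0 : ℝ) < n i := by exact_mod_cast hn i
  have h1 : θ * n i / 2 ≤ subSize θ n i := half_le_floor (hs i)
  have h2 : (0 : ℝ) < subSize θ n i := by exact_mod_cast hs i
  have hc0 : 0 ≤ c := by
    have : 0 ≤ avgSize n := div_nonneg (Finset.sum_nonneg fun i _ => by positivity) (by positivity)
    have := this.trans (hc i)
    exact nonneg_of_mul_nonneg_left this hi
  rw [div_le_iff₀ h2]
  calc avgSize n * θ ≤ c * n i * θ := by gcongr; exact hc i
    _ = 2 * c * (θ * n i / 2) := by ring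
    _ ≤ _ := by gcongr

lemma mul_avgSize_le (hm : 0 < m) (hs : ∀ i, 1 ≤ subSize θ n i) :
    avgSize n * θ ≤ 2 * avgSize (subSize θ n) := by
  have hm' : (0 : ℝ) < m := by exact_mod_cast hm
  have h : ∑ i, (θ * n i / 2) ≤ ∑ i, (subSize θ n i : ℝ) :=
    Finset.sum_le_sum fun i _ => half_le_floor (hs i)
  rw [← Finset.sum_div, ← Finset.mul_sum] at h
  rw [avgSize, avgSize, ← mul_div_assoc, div_mul_eq_mul_div, div_le_div_iff_of_pos_right hm']
  linarith

lemma abs_sum_div_subSize_sub_le (hm : 0 < m) (hn : ∀ i, 0 < n i) (hθ : 0 < θ)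
    (hs : ∀ i, 1 ≤ subSize θ n i) (hc : ∀ i, avgSize n ≤ c * n i) (V σ : Fin m → ℝ)
    (hσ : ∀ i, 0 ≤ σ i) :
    avgSize n * |θ * (∑ i, V i / subSize θ n i) - ∑ i, σ i / n i| ≤
      ∑ i, (2 * c * |V i - σ i| + 2 * c ^ 2 * σ i * (θ * avgSize n)⁻¹) := by
  have hN := avgSize_pos hm hn
  rw [Finset.mul_sum, ← Finset.sum_sub_distrib]
  refine (mul_le_mul_of_nonneg_left (Finset.abs_sum_le_sum_abs _ _) hN.le).trans ?_
  rw [Finset.mul_sum]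
  refine Finset.sum_le_sum fun i _ => ?_
  have hi : (0 : ℝ) < n i := by exact_mod_cast hn i
  have hsi : (0 : ℝ) < subSize θ n i := by exact_mod_cast hs i
  have h1 := mul_avgSize_div_subSize_le hn hθ hs hc i
  have hc0 : 0 ≤ c := nonneg_of_mul_nonneg_left (hN.le.trans (hc i)) hi
  have hfl : (subSize θ n i : ℝ) ≤ θ * n i := Nat.floor_le (by positivity)
  have hfl2 : θ * n i < subSize θ n i + 1 := Nat.lt_floor_add_one _
  -- Separates the estimation error `V i - σ i` from the rounding error `θ n i - s i`. The latter
  -- lies in `[0, 1)`, so after scaling by `n` it contributes only order `1 / (θ n)`.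
  have e : θ * (V i / subSize θ n i) - σ i / n i
      = θ / subSize θ n i * (V i - σ i)
        + σ i * ((θ * n i - subSize θ n i) / (subSize θ n i * n i)) := by
    field_simp
    ring
  rw [e]
  calc avgSize n * |θ / subSize θ n i * (V i - σ i)
        + σ i * ((θ * n i - subSize θ n i) / (subSize θ n i * n i))|
      ≤ avgSize n * (θ / subSize θ n i * |V i - σ i|
        + σ i * (1 / (subSize θ n i * n i))) := by
        gcongr
        refine (abs_add_le _ _).trans ?_
        rw [abs_mul, abs_of_nonneg (by positivity : 0 ≤ θ / subSize θ n i), abs_mul,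
          abs_of_nonneg (hσ i), abs_of_nonneg (a := (θ * n i - subSize θ n i) / _)
            (div_nonneg (sub_nonneg.2 hfl) (by positivity))]
        have := hσ i
        gcongr
        linarith
    _ = avgSize n * θ / subSize θ n i * |V i - σ i|
        + σ i * (avgSize n / n i) * (avgSize n * θ / subSize θ n i) * (θ * avgSize n)⁻¹ := by
        field_simp
    _ ≤ 2 * c * |V i - σ i| + σ i * c * (2 * c) * (θ * avgSize n)⁻¹ := by
        have := hσ i
        have h3 : avgSize n / n i ≤ c := by rw [div_le_iff₀ hi]; exact hc i
        gcongr
    _ = _ := by ring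

end FixedSize

/-! ### The data -/

section DataSide

variable {m : ℕ} {𝒳 : Fin m → Type*} [∀ i, MeasurableSpace (𝒳 i)]

@[fun_prop]
lemma measurable_empirical {E : Type*} [MeasurableSpace E] {s : ℕ} :
    Measurable (empirical : (Fin s → E) → Measure E) := by
  refine Measure.measurable_of_measurable_coe _ fun A hA => ?_
  simp only [empirical, Measure.smul_apply, Measure.finsetSum_apply, smul_eq_mul,
    Measure.dirac_apply' _ hA]
  refine Measurable.const_mul (Finset.measurable_sum _ fun j _ => ?_) _
  exact (measurable_one.indicator hA).comp (measurable_pi_apply j)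

@[fun_prop]
lemma measurable_empAll {n : Fin m → ℕ} :
    Measurable (empAll : Data 𝒳 n → ∀ i, Measure (𝒳 i)) :=
  measurable_pi_lambda _ fun i => measurable_empirical.comp (measurable_pi_apply i)

lemma measurable_influence {g : ∀ i, (∀ j, Measure (𝒳 j)) → 𝒳 i → ℝ}
    (hg : ∀ i, Measurable (Function.uncurry (g i))) {n : Fin m → ℕ} (i : Fin m) (j : Fin (n i)) :
    Measurable fun x : Data 𝒳 n => g i (empAll x) (x i j) :=
  (hg i).comp (measurable_empAll.prodMk (by fun_prop))

lemma measurable_influence_apply {g : ∀ i, (∀ j, Measure (𝒳 j)) → 𝒳 i → ℝ}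
    (hg : ∀ i, Measurable (Function.uncurry (g i))) (P : ∀ i, Measure (𝒳 i)) (i : Fin m) :
    Measurable (g i P) :=
  (hg i).comp (measurable_const.prodMk measurable_id)

/-! ### Almost surely the data lie in the supports, and empirical distributions in the hulls -/

section Support

variable [∀ i, TopologicalSpace (𝒳 i)]

/-- All data points lie in the supports of the input distributions. -/
def InSupport (F : ∀ i, Measure (𝒳 i)) {n : Fin m → ℕ} (x : Data 𝒳 n) : Prop :=
  ∀ i j, x i j ∈ (F i).support

lemma ae_inSupport [∀ i, SecondCountableTopology (𝒳 i)] (F : ∀ i, Measure (𝒳 i))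
    [∀ i, IsProbabilityMeasure (F i)] (n : Fin m → ℕ) :
    ∀ᵐ x ∂(dataLaw F n), InSupport F x := by
  refine ae_all_iff.2 fun i => ae_all_iff.2 fun j => ?_
  have h1 : ∀ᵐ z ∂(F i), z ∈ (F i).support := Measure.support_mem_ae
  have h2 : ∀ᵐ z ∂(Measure.pi fun _ : Fin (n i) => F i), z j ∈ (F i).support :=
    (measurePreserving_eval (fun _ : Fin (n i) => F i) j).quasiMeasurePreserving.ae h1
  exact (measurePreserving_eval_dataLaw F n i).quasiMeasurePreserving.ae h2

lemma empirical_mem_hull {E : Type*} [TopologicalSpace E] [MeasurableSpace E] {F : Measure E}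
    {s : ℕ} (hs : 0 < s) {x : Fin s → E} (hx : ∀ j, x j ∈ F.support) : empirical x ∈ hull F := by
  refine ⟨s, 0, fun _ => (s : ℝ≥0)⁻¹, x, ?_, hx, ?_⟩
  · have : (s : ℝ≥0) ≠ 0 := by exact_mod_cast hs.ne'
    simp [this]
  · rw [zero_smul, zero_add, empirical, Finset.smul_sum]
    refine Finset.sum_congr rfl fun j _ => ?_
    ext A hA
    have : (s : ℝ≥0) ≠ 0 := by exact_mod_cast hs.ne'
    simp only [Measure.smul_apply, smul_eq_mul, ENNReal.smul_def, ENNReal.coe_inv this,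
      ENNReal.coe_natCast]

lemma self_mem_hull {E : Type*} [TopologicalSpace E] [MeasurableSpace E] (F : Measure E) :
    F ∈ hull F :=
  ⟨0, 1, Fin.elim0, Fin.elim0, by simp, fun k => k.elim0, by simp⟩

lemma InSupport.empAll_mem {F : ∀ i, Measure (𝒳 i)} {n : Fin m → ℕ} (hn : ∀ i, 0 < n i)
    {x : Data 𝒳 n} (hx : InSupport F x) (i : Fin m) : empAll x i ∈ hull (F i) :=
  empirical_mem_hull (hn i) (hx i)

lemma InSupport.barF_mem {F : ∀ i, Measure (𝒳 i)} {n s : Fin m → ℕ} (hn : ∀ i, 0 < n i)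
    (hs : ∀ i, 0 < s i) {x : Data 𝒳 n} (hx : InSupport F x) (S : Finset (Fin m))
    (ι : Resample n s) (i : Fin m) : barF S x ι i ∈ hull (F i) := by
  unfold barF
  split_ifs
  · exact empirical_mem_hull (hs i) fun j => hx i _
  · exact empirical_mem_hull (hn i) (hx i)

/-- No measurability of `ψ` is assumed. On the hulls it agrees with the mean of the simulation
kernel, which is measurable in the input distributions, and the empirical distributions lie there
almost surely. -/
lemma aestronglyMeasurable_performance [∀ i, SecondCountableTopology (𝒳 i)]
    (F : ∀ i, Measure (𝒳 i)) [∀ i, IsProbabilityMeasure (F i)] {ψ : (∀ i, Measure (𝒳 i)) → ℝ}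
    {sim : Kernel (∀ i, Measure (𝒳 i)) ℝ} [IsMarkovKernel sim] (hsim : Unbiased F ψ sim)
    {n : Fin m → ℕ} (hn : ∀ i, 0 < n i) :
    AEStronglyMeasurable (fun x : Data 𝒳 n => ψ (empAll x)) (dataLaw F n) := by
  have h1 : StronglyMeasurable fun P : (∀ i, Measure (𝒳 i)) => ∫ y, y ∂(sim P) :=
    StronglyMeasurable.integral_kernel stronglyMeasurable_id
  refine ⟨fun x => ∫ y, y ∂(sim (empAll x)), h1.comp_measurable measurable_empAll, ?_⟩
  filter_upwards [ae_inSupport F n] with x hx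
  exact (hsim _ fun i => hx.empAll_mem hn i).2.symm

end Support

/-! ### Exchangeability -/

lemma measurePreserving_comp_perm {E : Type*} [MeasurableSpace E] (ν : Measure E)
    [IsProbabilityMeasure ν] {s : ℕ} (σ : Equiv.Perm (Fin s)) :
    MeasurePreserving (fun z : Fin s → E => z ∘ σ) (Measure.pi fun _ => ν)
      (Measure.pi fun _ => ν) := by
  have h := measurePreserving_piCongrLeft (fun _ : Fin s => ν) σ.symm
  convert h using 1
  ext z j
  have := MeasurableEquiv.piCongrLeft_apply_apply (β := fun _ => E) σ.symm z (σ j)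
  simpa using this.symm

lemma empirical_comp_perm {E : Type*} [MeasurableSpace E] {s : ℕ} (σ : Equiv.Perm (Fin s))
    (x : Fin s → E) : empirical (x ∘ σ) = empirical x := by
  simp only [empirical, Function.comp]
  rw [Equiv.sum_comp σ fun j => Measure.dirac (x j)]

/-- Swapping positions `j₀` and `j` in the `i`-th data set preserves both the law of the data and
all empirical distributions. -/
lemma lintegral_exchange (F : ∀ i, Measure (𝒳 i)) [∀ i, IsProbabilityMeasure (F i)]
    {n : Fin m → ℕ} (i : Fin m) (j₀ j : Fin (n i))
    {h : (∀ i, Measure (𝒳 i)) → 𝒳 i → ℝ≥0∞} (hh : Measurable (Function.uncurry h)) :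
    ∫⁻ x : Data 𝒳 n, h (empAll x) (x i j) ∂(dataLaw F n)
      = ∫⁻ x : Data 𝒳 n, h (empAll x) (x i j₀) ∂(dataLaw F n) := by
  let σ : ∀ i', Equiv.Perm (Fin (n i')) :=
    Function.update (fun i' => Equiv.refl _) i (Equiv.swap j₀ j)
  have hT : MeasurePreserving (fun (x : Data 𝒳 n) i' => x i' ∘ σ i') (dataLaw F n)
      (dataLaw F n) :=
    measurePreserving_pi (fun i' => Measure.pi fun _ : Fin (n i') => F i') _
      fun i' => measurePreserving_comp_perm (F i') (σ i')
  have hm : Measurable fun x : Data 𝒳 n => h (empAll x) (x i j₀) :=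
    hh.comp (measurable_empAll.prodMk (by fun_prop))
  rw [← hT.lintegral_comp hm]
  refine lintegral_congr fun x => ?_
  have e1 : empAll (fun i' => x i' ∘ σ i') = empAll x := by
    ext1 i'
    exact empirical_comp_perm _ _
  rw [e1]
  simp [σ]

/-! ### Laws of large numbers -/

/-- The empirical fourth moment of the error of the influence function. -/
noncomputable def influenceError (F : ∀ i, Measure (𝒳 i))
    (g : ∀ i, (∀ j, Measure (𝒳 j)) → 𝒳 i → ℝ) {n : Fin m → ℕ} (i : Fin m) (x : Data 𝒳 n) : ℝ :=
  (∑ j, (g i (empAll x) (x i j) - g i F (x i j)) ^ 4) / n i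

/-- Carries the hypothesis `InfluenceConverges`, which concerns the first data point, over to the
empirical average: by exchangeability all summands have the same expectation. -/
lemma lintegral_influenceError (F : ∀ i, Measure (𝒳 i)) [∀ i, IsProbabilityMeasure (F i)]
    {g : ∀ i, (∀ j, Measure (𝒳 j)) → 𝒳 i → ℝ} (hg : ∀ i, Measurable (Function.uncurry (g i)))
    {n : Fin m → ℕ} (i : Fin m) (hn : 0 < n i) :
    ∫⁻ x : Data 𝒳 n, ENNReal.ofReal (influenceError F g i x) ∂(dataLaw F n)
      = ∫⁻ x : Data 𝒳 n, ENNReal.ofReal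
        ((g i (empAll x) (x i ⟨0, hn⟩) - g i F (x i ⟨0, hn⟩)) ^ 4) ∂(dataLaw F n) := by
  have hn' : (0 : ℝ) < n i := by exact_mod_cast hn
  have hgF := measurable_influence_apply hg F i
  obtain ⟨h, hdef⟩ : ∃ h : (∀ i, Measure (𝒳 i)) → 𝒳 i → ℝ≥0∞,
    ∀ P z, h P z = ENNReal.ofReal ((g i P z - g i F z) ^ 4) := ⟨_, fun _ _ => rfl⟩
  have hh : Measurable (Function.uncurry h) := by
    have h1 : Measurable fun p : (∀ i, Measure (𝒳 i)) × 𝒳 i =>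
        ENNReal.ofReal ((Function.uncurry (g i) p - g i F p.2) ^ 4) :=
      (((hg i).sub (hgF.comp measurable_snd)).pow_const 4).ennreal_ofReal
    convert h1 using 1
    ext p
    exact hdef p.1 p.2
  simp only [← hdef]
  have hm : ∀ j, Measurable fun x : Data 𝒳 n => h (empAll x) (x i j) := fun j =>
    hh.comp (measurable_empAll.prodMk (by fun_prop))
  have e : ∀ x : Data 𝒳 n, ENNReal.ofReal (influenceError F g i x)
      = (∑ j, h (empAll x) (x i j)) * (n i : ℝ≥0∞)⁻¹ := by
    intro x
    rw [influenceError, ENNReal.ofReal_div_of_pos hn', ENNReal.ofReal_natCast,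
      ENNReal.ofReal_sum_of_nonneg fun j _ => by positivity, div_eq_mul_inv]
    simp only [hdef]
  simp only [e]
  rw [lintegral_mul_const _ (Finset.measurable_sum _ fun j _ => hm j),
    lintegral_finsetSum _ fun j _ => hm j]
  rw [Finset.sum_congr rfl fun j _ => lintegral_exchange F i ⟨0, hn⟩ j hh]
  simp only [Finset.sum_const, Finset.card_univ, Fintype.card_fin, nsmul_eq_mul]
  rw [mul_comm, ← mul_assoc, ENNReal.inv_mul_cancel (by exact_mod_cast hn.ne')
    (ENNReal.natCast_ne_top _), one_mul]

variable {n : ℕ → Fin m → ℕ}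

lemma tendsto_influenceError (F : ∀ i, Measure (𝒳 i)) [∀ i, IsProbabilityMeasure (F i)]
    {g : ∀ i, (∀ j, Measure (𝒳 j)) → 𝒳 i → ℝ} (hg : ∀ i, Measurable (Function.uncurry (g i)))
    (hn : ∀ k i, 0 < n k i) (hinfl : InfluenceConverges F g n hn) (i : Fin m)
    {ρ : ℝ} (hρ : 0 < ρ) :
    Tendsto (fun k => dataLaw F (n k) {x | ρ ≤ influenceError F g i x}) atTop (𝓝 0) := by
  have h1 : Tendsto (fun k => (∫⁻ x : Data 𝒳 (n k), ENNReal.ofReal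
      ((g i (empAll x) (x i ⟨0, hn k i⟩) - g i F (x i ⟨0, hn k i⟩)) ^ 4) ∂(dataLaw F (n k)))
      / ENNReal.ofReal ρ) atTop (𝓝 0) := by
    have := ENNReal.Tendsto.div_const (hinfl i) (b := ENNReal.ofReal ρ)
      (Or.inr (ENNReal.ofReal_pos.2 hρ).ne')
    simpa using this
  refine tendsto_of_tendsto_of_tendsto_of_le_of_le tendsto_const_nhds h1 (fun _ => zero_le)
    fun k => ?_
  have hgF := measurable_influence_apply hg F i
  have hm : Measurable fun x : Data 𝒳 (n k) => influenceError F g i x := by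
    refine Measurable.div_const (Finset.measurable_sum _ fun j _ => ?_) _
    exact ((measurable_influence hg i j).sub (hgF.comp (by fun_prop))).pow_const 4
  simp only
  rw [← lintegral_influenceError F hg i (hn k i)]
  refine le_trans (measure_mono fun x hx => ?_) (meas_ge_le_lintegral_div
    hm.ennreal_ofReal.aemeasurable (ENNReal.ofReal_pos.2 hρ).ne' ENNReal.ofReal_ne_top)
  exact ENNReal.ofReal_le_ofReal hx

lemma tendsto_average_far (F : ∀ i, Measure (𝒳 i)) [∀ i, IsProbabilityMeasure (F i)]
    (i : Fin m) (hni : Tendsto (fun k => n k i) atTop atTop) {f : 𝒳 i → ℝ}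
    (hf : MemLp f 2 (F i)) {η : ℝ} (hη : 0 < η) :
    Tendsto (fun k => dataLaw F (n k)
      {x | η ≤ |(∑ j, f (x i j)) / n k i - ∫ z, f z ∂(F i)|}) atTop (𝓝 0) := by
  have h0 : Tendsto (fun k => Var[f; F i] / (n k i : ℝ) / η ^ 2) atTop (𝓝 0) := by
    have h1 : Tendsto (fun k => (n k i : ℝ)) atTop atTop :=
      tendsto_natCast_atTop_atTop.comp hni
    have := (h1.const_div_atTop Var[f; F i]).div_const (η ^ 2)
    simpa using this
  have h1 := ENNReal.tendsto_ofReal h0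
  rw [ENNReal.ofReal_zero] at h1
  refine tendsto_of_tendsto_of_tendsto_of_le_of_le' tendsto_const_nhds h1
    (Eventually.of_forall fun _ => zero_le) ?_
  filter_upwards [hni.eventually_gt_atTop 0] with k hk
  have hA := memLp_average (F i) hf (n k i)
  have key := meas_ge_le_variance_div_sq hA hη
  rw [integral_average (F i) (hf.integrable one_le_two) hk, variance_average (F i) hf] at key
  refine le_trans (le_of_eq ?_) key
  exact (measurePreserving_eval_dataLaw F (n k) i).measure_preimage
    (s := {z | η ≤ |(∑ j, f (z j)) / n k i - ∫ z, f z ∂(F i)|})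
    (nullMeasurableSet_le aemeasurable_const
      (hA.aestronglyMeasurable.aemeasurable.sub_const _).abs)

/-- Markov's inequality, intended for the fourth powers of the influence functions, whose
integrability does not support a Chebyshev bound. -/
lemma measure_average_ge_le (F : ∀ i, Measure (𝒳 i)) [∀ i, IsProbabilityMeasure (F i)]
    (i : Fin m) {n : Fin m → ℕ} (hn : 0 < n i) {f : 𝒳 i → ℝ} (hf0 : ∀ z, 0 ≤ f z)
    (hf : Integrable f (F i)) {M : ℝ} (hM : 0 < M) :
    dataLaw F n {x | M ≤ (∑ j, f (x i j)) / n i} ≤ ENNReal.ofReal ((∫ z, f z ∂(F i)) / M) := by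
  have hA : Integrable (fun z : Fin (n i) → 𝒳 i => (∑ j, f (z j)) / n i)
      (Measure.pi fun _ => F i) :=
    memLp_one_iff_integrable.1 (memLp_average (F i) (memLp_one_iff_integrable.2 hf) (n i))
  have hA' : Integrable (fun x : Data 𝒳 n => (∑ j, f (x i j)) / n i) (dataLaw F n) :=
    (measurePreserving_eval_dataLaw F n i).integrable_comp_of_integrable hA
  have hint : ∫ x : Data 𝒳 n, (∑ j, f (x i j)) / n i ∂(dataLaw F n) = ∫ z, f z ∂(F i) := by
    rw [← integral_average (F i) hf hn]
    exact integral_comp_eval (μ := fun i => Measure.pi fun _ : Fin (n i) => F i)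
      hA.aestronglyMeasurable
  have key := mul_meas_ge_le_integral_of_nonneg
    (ae_of_all _ fun x => div_nonneg (Finset.sum_nonneg fun j _ => hf0 _) (by positivity)) hA' M
  rw [hint] at key
  rw [← ENNReal.ofReal_toReal (measure_ne_top (dataLaw F n) _)]
  refine ENNReal.ofReal_le_ofReal ?_
  rwa [le_div_iff₀ hM, mul_comm]

/-! ### The input variance -/

lemma performance_eq [∀ i, TopologicalSpace (𝒳 i)] [∀ i, MeasurableSingletonClass (𝒳 i)]
    {F : ∀ i, Measure (𝒳 i)} {ψ : (∀ i, Measure (𝒳 i)) → ℝ}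
    {g : ∀ i, (∀ j, Measure (𝒳 j)) → 𝒳 i → ℝ} (hdiff : FirstOrderDiff F ψ g)
    {n : Fin m → ℕ} (x : Data 𝒳 n) :
    ψ (empAll x) = ψ F + totalAverage (fun i => g i F) x + remainder ψ g F (empAll x) := by
  have h0 := (hdiff F fun i => self_mem_hull (F i)).1
  simp only [remainder, h0, sub_zero, empAll, integral_empirical, totalAverage]
  ring

lemma tendsto_inputVar [∀ i, TopologicalSpace (𝒳 i)] [∀ i, SecondCountableTopology (𝒳 i)]
    [∀ i, MeasurableSingletonClass (𝒳 i)] (hm : 0 < m)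
    (F : ∀ i, Measure (𝒳 i)) [∀ i, IsProbabilityMeasure (F i)]
    {ψ : (∀ i, Measure (𝒳 i)) → ℝ} {sim : Kernel (∀ i, Measure (𝒳 i)) ℝ} [IsMarkovKernel sim]
    (hsim : Unbiased F ψ sim) {g : ∀ i, (∀ j, Measure (𝒳 j)) → 𝒳 i → ℝ}
    (hg : ∀ i, Measurable (Function.uncurry (g i))) (hn : ∀ k i, 0 < n k i)
    (hbal : BalancedData n) (hdiff : FirstOrderDiff F ψ g) (htruth : SmoothAtTruth F ψ g n) :
    Tendsto (fun k => avgSize (n k) *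
      |inputVar F ψ (n k) - ∑ i, (∫ z, g i F z ^ 2 ∂(F i)) / n k i|) atTop (𝓝 0) := by
  obtain ⟨c, hc, hcn⟩ := hbal.exists_le hm
  set σ : Fin m → ℝ := fun i => ∫ z, g i F z ^ 2 ∂(F i) with hσ
  have hσ0 : ∀ i, 0 ≤ σ i := fun i => integral_nonneg fun z => sq_nonneg _
  have h0 := (hdiff F fun i => self_mem_hull (F i)).1
  have hg4 : ∀ i, MemLp (g i F) 4 (F i) := fun i =>
    (memLp_four_iff (measurable_influence_apply hg F i).aestronglyMeasurable).2 (htruth.2 i).2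
  have hg2 := fun i => MemLp.two_of_four (hg4 i)
  set rem : ∀ k, Data 𝒳 (n k) → ℝ := fun k x => remainder ψ g F (empAll x) with hrem
  set q : ℕ → ℝ≥0∞ := fun k => ENNReal.ofReal (avgSize (n k)) *
    ∫⁻ x : Data 𝒳 (n k), ENNReal.ofReal (rem k x ^ 2) ∂(dataLaw F (n k)) with hq
  have hq0 : Tendsto q atTop (𝓝 0) := htruth.1
  have hqr : Tendsto (fun k => (q k).toReal) atTop (𝓝 0) := by
    exact (ENNReal.tendsto_toReal ENNReal.zero_ne_top).comp hq0
  have hlim : Tendsto (fun k => 2 * (√(c * ∑ i, σ i) * √((q k).toReal)) + (q k).toReal)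
      atTop (𝓝 0) := by
    have := ((hqr.sqrt.const_mul (√(c * ∑ i, σ i))).const_mul 2).add hqr
    simpa using this
  refine tendsto_of_tendsto_of_tendsto_of_le_of_le' tendsto_const_nhds hlim
    (Eventually.of_forall fun k => ?_) ?_
  · exact mul_nonneg (avgSize_pos hm (hn k)).le (abs_nonneg _)
  filter_upwards [hcn, hq0.eventually_lt_const one_pos] with k hk hqk
  have hN := avgSize_pos hm (hn k)
  -- Square integrability of the remainder is not assumed for each `k`; it follows for large `k`
  -- from `q k < 1`.
  have hfin : ∫⁻ x : Data 𝒳 (n k), ENNReal.ofReal (rem k x ^ 2) ∂(dataLaw F (n k)) ≠ ⊤ := by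
    intro htop
    simp only [hq, htop] at hqk
    rw [ENNReal.mul_top (ENNReal.ofReal_pos.2 hN).ne'] at hqk
    simp at hqk
  have hTm : MemLp (totalAverage fun i => g i F) 2 (dataLaw F (n k)) :=
    memLp_totalAverage F hg2 (n k)
  have hrm : AEStronglyMeasurable (rem k) (dataLaw F (n k)) := by
    have : rem k = fun x => ψ (empAll x) - (ψ F + totalAverage (fun i => g i F) x) := by
      ext x
      rw [performance_eq hdiff x]
      simp [hrem]
    rw [this]
    exact (aestronglyMeasurable_performance F hsim (hn k)).sub
      (hTm.aestronglyMeasurable.const_add _)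
  have hr2 : MemLp (rem k) 2 (dataLaw F (n k)) := by
    rw [memLp_two_iff_integrable_sq hrm]
    refine ⟨hrm.pow 2, ?_⟩
    rw [hasFiniteIntegral_iff_ofReal (ae_of_all _ fun x => sq_nonneg _)]
    exact lt_top_iff_ne_top.2 hfin
  have hT0 : ∫ x, totalAverage (fun i => g i F) x ∂(dataLaw F (n k)) = 0 := by
    rw [integral_totalAverage F (fun i => (hg2 i).integrable one_le_two) (hn k)]
    exact Finset.sum_eq_zero fun i _ => h0 i
  have key := abs_variance_add_sub_le hTm hT0 hr2 (ψ F)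
  have e1 : inputVar F ψ (n k)
      = Var[fun x => ψ F + totalAverage (fun i => g i F) x + rem k x; dataLaw F (n k)] := by
    rw [inputVar]
    congr 1
    ext x
    exact performance_eq hdiff x
  have e2 : ∫ x, totalAverage (fun i => g i F) x ^ 2 ∂(dataLaw F (n k))
      = ∑ i, σ i / n k i := by
    rw [← variance_of_integral_eq_zero hTm.aestronglyMeasurable.aemeasurable hT0]
    rw [variance_totalAverage F hg2]
    refine Finset.sum_congr rfl fun i _ => ?_
    rw [variance_of_integral_eq_zero (hg2 i).aestronglyMeasurable.aemeasurable (h0 i)]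
  have e3 : avgSize (n k) * ∫ x, rem k x ^ 2 ∂(dataLaw F (n k)) = (q k).toReal := by
    rw [integral_eq_lintegral_of_nonneg_ae (ae_of_all _ fun x => sq_nonneg _) (hrm.pow 2),
      hq, ENNReal.toReal_mul, ENNReal.toReal_ofReal hN.le]
  rw [← e1, e2] at key
  set N := avgSize (n k) with hNdef
  set r := ∫ x, rem k x ^ 2 ∂(dataLaw F (n k)) with hr
  have hr0 : 0 ≤ r := integral_nonneg fun x => sq_nonneg _
  have hv : N * ∑ i, σ i / n k i ≤ c * ∑ i, σ i := by
    rw [Finset.mul_sum, Finset.mul_sum]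
    refine Finset.sum_le_sum fun i _ => ?_
    have hi : (0 : ℝ) < n k i := by exact_mod_cast hn k i
    rw [← mul_div_assoc, div_le_iff₀ hi]
    calc N * σ i ≤ c * n k i * σ i := mul_le_mul_of_nonneg_right (hk i) (hσ0 i)
      _ = _ := by ring
  -- The factor `N` is split as `√N * √N` over the Cauchy–Schwarz term: `N` times the linear
  -- variance stays bounded while `N * r` tends to `0`.
  calc N * |inputVar F ψ (n k) - ∑ i, σ i / n k i|
      ≤ N * (2 * (√(∑ i, σ i / n k i) * √r) + r) := by gcongr
    _ = 2 * (√(N * ∑ i, σ i / n k i) * √(N * r)) + N * r := by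
        rw [Real.sqrt_mul hN.le, Real.sqrt_mul hN.le]
        have := Real.mul_self_sqrt hN.le
        linear_combination (-2 * √(∑ i, σ i / n k i) * √r) * this
    _ ≤ _ := by
        rw [e3]
        gcongr

end DataSide

/-! ### Conditional bounds given the data -/

section Conditional

variable {m : ℕ} {𝒳 : Fin m → Type*} [∀ i, MeasurableSpace (𝒳 i)]

/-- The empirical `p`-th moment of the empirical influence function. -/
noncomputable def influenceMoment (g : ∀ i, (∀ j, Measure (𝒳 j)) → 𝒳 i → ℝ) (p : ℕ)
    {n : Fin m → ℕ} (i : Fin m) (x : Data 𝒳 n) : ℝ :=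
  (∑ j, g i (empAll x) (x i j) ^ p) / n i

/-- Write the empirical influence function as the true one plus an error and work under the uniform
law on indices: Cauchy–Schwarz and Jensen bound the second moment, and `(a + b)⁴ ≤ 8 (a⁴ + b⁴)` the
fourth. -/
lemma influenceMoment_bounds (F : ∀ i, Measure (𝒳 i))
    (g : ∀ i, (∀ j, Measure (𝒳 j)) → 𝒳 i → ℝ) {n : Fin m → ℕ} (hn : ∀ i, 0 < n i) (x : Data 𝒳 n) (i : Fin m) :
    |influenceMoment g 2 i x - (∑ j, g i F (x i j) ^ 2) / n i| ≤
      2 * (√((∑ j, g i F (x i j) ^ 2) / n i) * √√(influenceError F g i x))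
        + √(influenceError F g i x) ∧
    influenceMoment g 4 i x ≤
      8 * (influenceError F g i x + (∑ j, g i F (x i j) ^ 4) / n i) := by
  set f : Fin (n i) → ℝ := fun j => g i F (x i j) with hf
  set d : Fin (n i) → ℝ := fun j => g i (empAll x) (x i j) - g i F (x i j) with hd
  have := isProbabilityMeasure_empirical (hn i) (id : Fin (n i) → Fin (n i))
  have hfd : ∀ j, g i (empAll x) (x i j) = f j + d j := fun j => by simp [hf, hd]
  constructor
  · have h1 := abs_integral_add_sq_sub_le (μ := empirical (id : Fin (n i) → Fin (n i)))
      (X := f) (Y := d) MemLp.of_discrete MemLp.of_discrete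
    have h2 := integral_sq_le_sqrt (μ := empirical (id : Fin (n i) → Fin (n i))) (X := d)
      MemLp.of_discrete
    simp only [integral_empirical, id] at h1 h2
    simp only [influenceMoment, hfd]
    refine h1.trans ?_
    change (∑ j, d j ^ 2) / n i ≤ √(influenceError F g i x) at h2
    gcongr
  · simp only [influenceMoment, hfd]
    change _ ≤ 8 * ((∑ j, d j ^ 4) / n i + (∑ j, f j ^ 4) / n i)
    rw [← add_div, ← mul_div_assoc, ← Finset.sum_add_distrib, Finset.mul_sum]
    gcongr with j _
    rw [add_comm]
    exact add_pow_four_le _ _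

variable [∀ i, TopologicalSpace (𝒳 i)]

/-- The bootstrap variance of the performance measure. -/
noncomputable def bootVar (ψ : (∀ i, Measure (𝒳 i)) → ℝ) {n : Fin m → ℕ} (s : Fin m → ℕ)
    (x : Data 𝒳 n) : ℝ :=
  uMean fun ι : Resample n s => (ψ (barF Finset.univ x ι)
    - uMean fun ι : Resample n s => ψ (barF Finset.univ x ι)) ^ 2

/-- The bootstrap fourth central moment of the performance measure. -/
noncomputable def bootFourth (ψ : (∀ i, Measure (𝒳 i)) → ℝ) {n : Fin m → ℕ} (s : Fin m → ℕ)
    (x : Data 𝒳 n) : ℝ :=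
  uMean fun ι : Resample n s => (ψ (barF Finset.univ x ι)
    - uMean fun ι : Resample n s => ψ (barF Finset.univ x ι)) ^ 4

/-- Deviations of the estimator from the bootstrap variance. -/
lemma runLaw_far_le {F : ∀ i, Measure (𝒳 i)}
    {ψ : (∀ i, Measure (𝒳 i)) → ℝ} {sim : Kernel (∀ i, Measure (𝒳 i)) ℝ} [IsMarkovKernel sim]
    (hsim : Unbiased F ψ sim) {n s : Fin m → ℕ} (hn : ∀ i, 0 < n i) (hs : ∀ i, 0 < s i)
    {x : Data 𝒳 n} (hx : InSupport F x) {B R : ℕ} (hB : 2 ≤ B) (hR : 2 ≤ R) {M : ℝ≥0}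
    (hM : starMeanENN (fun ι : Resample n s => mu4 ψ sim (barF Finset.univ x ι)) ≤ M)
    {θ : ℝ} (hθ : 0 ≤ θ) {c : ℝ} (hc : 0 < c) :
    runLaw sim s B R x {y | c ≤ |svb θ y - θ * bootVar ψ s x|} ≤
      ENNReal.ofReal (θ * (5 * √((16 * bootFourth ψ s x + 56 * M / (R : ℝ) ^ 2) / B)) / c) := by
  have hcard := card_resample_pos hn s
  have : Nonempty (Resample n s) := Fintype.card_pos_iff.1 hcard
  have hprob := isProbabilityMeasure_blockLaw sim hn s R x
  set a : Resample n s → ℝ := fun ι => ψ (barF Finset.univ x ι) with ha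
  set κ : Resample n s → Measure ℝ := fun ι => sim (barF Finset.univ x ι) with hκ
  -- `blockLaw` unfolds definitionally to this mixture, which is what lets the mixture bound close
  -- the proof.
  have : IsProbabilityMeasure (uMix fun ι => Measure.pi fun _ : Fin R => κ ι) := hprob
  have hunb := fun ι => hsim (barF Finset.univ x ι) fun i =>
    hx.barF_mem hn hs Finset.univ ι i
  have hsum : ∑ ι : Resample n s, mu4 ψ sim (barF Finset.univ x ι) ≤ M * Fintype.card (Resample n s) := by
    rw [starMeanENN] at hM
    exact (ENNReal.div_le_iff (by exact_mod_cast hcard.ne') (ENNReal.natCast_ne_top _)).1 hM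
  -- There are finitely many resamples, so a finite average fourth moment makes each one finite.
  -- This supplies the integrability needed for every component.
  have hsumtop : ∑ ι : Resample n s, mu4 ψ sim (barF Finset.univ x ι) ≠ ⊤ :=
    ne_top_of_le_ne_top (ENNReal.mul_ne_top ENNReal.coe_ne_top (ENNReal.natCast_ne_top _)) hsum
  have hfin : ∀ ι : Resample n s, mu4 ψ sim (barF Finset.univ x ι) ≠ ⊤ := fun ι =>
    ENNReal.sum_ne_top.1 hsumtop ι (Finset.mem_univ ι)
  have h4 : ∀ ι, MemLp (fun y => y - a ι) 4 (κ ι) := by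
    intro ι
    have hm : AEStronglyMeasurable (fun y : ℝ => y - a ι) (κ ι) := by fun_prop
    refine (memLp_four_iff hm).2 ⟨by fun_prop, ?_⟩
    rw [hasFiniteIntegral_iff_ofReal (ae_of_all _ fun y => by positivity)]
    exact lt_top_iff_ne_top.2 (hfin ι)
  have h0 : ∀ ι, ∫ y, (y - a ι) ∂(κ ι) = 0 := by
    intro ι
    rw [integral_sub (hunb ι).1 (integrable_const _)]
    simp [ha, (hunb ι).2]
  have hi4 : ∀ ι, ∫ y, (y - a ι) ^ 4 ∂(κ ι) = (mu4 ψ sim (barF Finset.univ x ι)).toReal := by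
    intro ι
    rw [integral_eq_lintegral_of_nonneg_ae (ae_of_all _ fun y => by positivity) (by fun_prop)]
    rfl
  have hM' : uMean (fun ι => ∫ y, (y - a ι) ^ 4 ∂(κ ι)) ≤ M := by
    simp only [hi4, uMean]
    rw [← ENNReal.toReal_sum fun ι _ => hfin ι, div_le_iff₀ (by exact_mod_cast hcard)]
    have := ENNReal.toReal_mono
      (ENNReal.mul_ne_top ENNReal.coe_ne_top (ENNReal.natCast_ne_top _)) hsum
    simpa using this
  exact measure_svb_far_uMix_le hB hR κ h4 h0 le_rfl hM' hθ hc

variable [∀ i, MeasurableSingletonClass (𝒳 i)] {F : ∀ i, Measure (𝒳 i)} {ψ : (∀ i, Measure (𝒳 i)) → ℝ}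
  {g : ∀ i, (∀ j, Measure (𝒳 j)) → 𝒳 i → ℝ}

/-- The bootstrap fourth moment of the remainder. -/
noncomputable def bootRemainder (ψ : (∀ i, Measure (𝒳 i)) → ℝ)
    (g : ∀ i, (∀ j, Measure (𝒳 j)) → 𝒳 i → ℝ) {n : Fin m → ℕ} (s : Fin m → ℕ)
    (x : Data 𝒳 n) : ℝ :=
  starMean fun ι : Resample n s => remainder ψ g (empAll x) (barF Finset.univ x ι) ^ 4

lemma performance_barF_eq (hdiff : FirstOrderDiff F ψ g) {n s : Fin m → ℕ} (hn : ∀ i, 0 < n i)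
    {x : Data 𝒳 n} (hx : InSupport F x) (ι : Resample n s) :
    ψ (barF Finset.univ x ι) = ψ (empAll x)
      + totalAverage (fun i j => g i (empAll x) (x i j)) ι
      + remainder ψ g (empAll x) (barF Finset.univ x ι) := by
  have h0 := (hdiff (empAll x) fun i => hx.empAll_mem hn i).1
  simp only [remainder, h0, sub_zero, barF, Finset.mem_univ, if_true, integral_empirical,
    totalAverage]
  ring

/-- On the support event the empirical influence values sum to zero over each data set, so the
expansion at the empirical distributions is a centred linear statistic of the resample plus a
remainder. -/
lemma boot_moments (hdiff : FirstOrderDiff F ψ g) {n s : Fin m → ℕ} (hn : ∀ i, 0 < n i)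
    (hs : ∀ i, 0 < s i) {x : Data 𝒳 n} (hx : InSupport F x) :
    |bootVar ψ s x - ∑ i, influenceMoment g 2 i x / s i| ≤
      2 * (√(∑ i, influenceMoment g 2 i x / s i) * √√(bootRemainder ψ g s x))
        + √(bootRemainder ψ g s x) ∧
    bootFourth ψ s x ≤ 128 * ((m : ℝ) ^ 3 *
      (∑ i, 3 * influenceMoment g 4 i x / (s i : ℝ) ^ 2) + bootRemainder ψ g s x) := by
  have h0 : ∀ i, ∑ j, g i (empAll x) (x i j) = 0 := by
    intro i
    have h := (hdiff (empAll x) fun i => hx.empAll_mem hn i).1 i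
    change ∫ z, g i (empAll x) z ∂(empirical (x i)) = 0 at h
    rw [integral_empirical] at h
    have hi : (n i : ℝ) ≠ 0 := by exact_mod_cast (hn i).ne'
    simpa [hi] using h
  have key := resample_moments hn hs (fun i j => g i (empAll x) (x i j)) h0
    (fun ι => remainder ψ g (empAll x) (barF Finset.univ x ι)) (ψ (empAll x))
  simp only [← performance_barF_eq hdiff hn hx] at key
  exact key

/-- The scaled bias and fourth moment of the bootstrap. -/
lemma boot_moments_scaled (hm : 0 < m) (hdiff : FirstOrderDiff F ψ g) {n : Fin m → ℕ}
    (hn : ∀ i, 0 < n i) {θ c : ℝ} (hθ : 0 < θ) (hs : ∀ i, 1 ≤ subSize θ n i) (hc0 : 0 < c)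
    (hc : ∀ i, avgSize n ≤ c * n i) {x : Data 𝒳 n} (hx : InSupport F x)
    {σ : Fin m → ℝ} (hσ : ∀ i, 0 ≤ σ i) {η M : ℝ}
    (hV : ∀ i, |influenceMoment g 2 i x - σ i| ≤ η) (hG : ∀ i, influenceMoment g 4 i x ≤ M)
    (he : bootRemainder ψ g (subSize θ n) x * avgSize (subSize θ n) ^ 2 ≤ η)
    (hθη : (θ * avgSize n)⁻¹ ≤ η) :
    avgSize n * |θ * bootVar ψ (subSize θ n) x - ∑ i, σ i / n i| ≤
      ∑ i, (2 * c * η + 2 * c ^ 2 * σ i * η)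
        + (2 * (√(2 * c * ∑ i, (σ i + η)) * √(2 * √η)) + 2 * √η) ∧
    (avgSize n * θ) ^ 2 * bootFourth ψ (subSize θ n) x ≤
      128 * ((m : ℝ) ^ 3 * (∑ _i : Fin m, 12 * c ^ 2 * M) + 4 * η) := by
  have hN := avgSize_pos hm hn
  set N := avgSize n with hNdef
  set s := subSize θ n with hsdef
  set E := bootRemainder ψ g s x with hE
  have hE0 : 0 ≤ E := div_nonneg (Finset.sum_nonneg fun _ _ => by positivity) (by positivity)
  have hsz : N * θ ≤ 2 * avgSize s := mul_avgSize_le hm hs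
  have hNθ : 0 < N * θ := by positivity
  have hEs : (N * θ) ^ 2 * E ≤ 4 * η := by
    calc (N * θ) ^ 2 * E ≤ (2 * avgSize s) ^ 2 * E := by gcongr
      _ = 4 * (E * avgSize s ^ 2) := by ring
      _ ≤ 4 * η := by gcongr
  -- The hypothesis `o_p(s⁻²)` on the fourth moment is used through its square root, at scale `θ n ≤
  -- 2 s`.
  have hq : N * θ * √E ≤ 2 * √η := by
    have h1 : N * θ * √E = √((N * θ) ^ 2 * E) := by
      rw [Real.sqrt_mul (by positivity), Real.sqrt_sq hNθ.le]
    have h2 : 2 * √η = √(4 * η) := by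
      rw [show (4 : ℝ) = 2 ^ 2 by norm_num, Real.sqrt_mul (by positivity),
        Real.sqrt_sq (by norm_num)]
    rw [h1, h2]
    exact Real.sqrt_le_sqrt hEs
  have hV0 : ∀ i, 0 ≤ influenceMoment g 2 i x := fun i =>
    div_nonneg (Finset.sum_nonneg fun _ _ => sq_nonneg _) (by positivity)
  have hdiv := mul_avgSize_div_subSize_le hn hθ hs hc
  obtain ⟨h1, h2⟩ := boot_moments hdiff hn (s := s) hs hx
  constructor
  · set A := ∑ i, influenceMoment g 2 i x / s i with hA
    have hA0 : 0 ≤ A := Finset.sum_nonneg fun i _ => div_nonneg (hV0 i) (by positivity)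
    have hbias := abs_sum_div_subSize_sub_le hm hn hθ hs hc
      (fun i => influenceMoment g 2 i x) σ hσ
    have hNA : N * θ * A ≤ 2 * c * ∑ i, (σ i + η) := by
      rw [hA, Finset.mul_sum, Finset.mul_sum]
      refine Finset.sum_le_sum fun i _ => ?_
      calc N * θ * (influenceMoment g 2 i x / s i)
          = N * θ / s i * influenceMoment g 2 i x := by ring
        _ ≤ 2 * c * (σ i + η) := by
          have := (abs_le.1 (hV i)).2
          have h3 := hdiv i
          have h4 := hV0 i
          gcongr
          linarith
    calc N * |θ * bootVar ψ s x - ∑ i, σ i / n i|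
        ≤ N * (|θ * A - ∑ i, σ i / n i| + θ * |bootVar ψ s x - A|) := by
          gcongr
          have e : θ * bootVar ψ s x - ∑ i, σ i / n i
              = (θ * A - ∑ i, σ i / n i) + θ * (bootVar ψ s x - A) := by ring
          rw [e]
          refine (abs_add_le _ _).trans ?_
          rw [abs_mul, abs_of_pos hθ]
      _ = N * |θ * A - ∑ i, σ i / n i| + N * θ * |bootVar ψ s x - A| := by ring
      _ ≤ ∑ i, (2 * c * |influenceMoment g 2 i x - σ i| + 2 * c ^ 2 * σ i * (θ * N)⁻¹)
          + N * θ * (2 * (√A * √√E) + √E) := by gcongr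
      _ = ∑ i, (2 * c * |influenceMoment g 2 i x - σ i| + 2 * c ^ 2 * σ i * (θ * N)⁻¹)
          + (2 * (√(N * θ * A) * √(N * θ * √E)) + N * θ * √E) := by
          rw [Real.sqrt_mul hNθ.le, Real.sqrt_mul hNθ.le]
          have := Real.mul_self_sqrt hNθ.le
          linear_combination (-2 * √A * √√E) * this
      _ ≤ _ := by
          gcongr with i _ i _
          · exact hV i
          · exact mul_nonneg (by positivity) (hσ i)
  · have hM0 : ∀ i, 0 ≤ influenceMoment g 4 i x := fun i =>
      div_nonneg (Finset.sum_nonneg fun _ _ => by positivity) (by positivity)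
    calc (N * θ) ^ 2 * bootFourth ψ s x
        ≤ (N * θ) ^ 2 * (128 * ((m : ℝ) ^ 3 *
          (∑ i, 3 * influenceMoment g 4 i x / (s i : ℝ) ^ 2) + E)) := by gcongr
      _ = 128 * ((m : ℝ) ^ 3 * (∑ i, 3 * (N * θ / s i) ^ 2 * influenceMoment g 4 i x)
          + (N * θ) ^ 2 * E) := by
          have e : ∑ i, 3 * (N * θ / s i) ^ 2 * influenceMoment g 4 i x
              = (N * θ) ^ 2 * ∑ i, 3 * influenceMoment g 4 i x / (s i : ℝ) ^ 2 := by
            rw [Finset.mul_sum]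
            exact Finset.sum_congr rfl fun i _ => by ring
          rw [e]; ring
      _ ≤ 128 * ((m : ℝ) ^ 3 * (∑ i : Fin m, 3 * (2 * c) ^ 2 * M) + 4 * η) := by
          gcongr with i _
          · exact hM0 i
          · exact hdiv i
          · exact hG i
      _ = _ := by
          congr 4
          ext i
          ring

end Conditional

/-! ### Relative consistency -/

section Consistency

variable {m : ℕ} {𝒳 : Fin m → Type*} [∀ i, MeasurableSpace (𝒳 i)]
  {F : ∀ i, Measure (𝒳 i)}
  {g : ∀ i, (∀ j, Measure (𝒳 j)) → 𝒳 i → ℝ} {n : ℕ → Fin m → ℕ}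

lemma tendsto_influenceMoment_far [∀ i, IsProbabilityMeasure (F i)]
    (hg : ∀ i, Measurable (Function.uncurry (g i)))
    (hn : ∀ k i, 0 < n k i) (hni : ∀ i, Tendsto (fun k => n k i) atTop atTop)
    (hinfl : InfluenceConverges F g n hn) (hg4 : ∀ i, Integrable (fun x => g i F x ^ 4) (F i))
    {η : ℝ} (hη : 0 < η) :
    Tendsto (fun k => dataLaw F (n k)
      {x | ∃ i, η < |influenceMoment g 2 i x - ∫ z, g i F z ^ 2 ∂(F i)|}) atTop (𝓝 0) := by
  have hone : ∀ i, Tendsto (fun k => dataLaw F (n k)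
      {x | η < |influenceMoment g 2 i x - ∫ z, g i F z ^ 2 ∂(F i)|}) atTop (𝓝 0) := by
    intro i
    set σ := ∫ z, g i F z ^ 2 ∂(F i) with hσ
    -- Half of `η` is reserved for the law of large numbers; `ρ` is then taken small enough that the
    -- influence error uses less than the other half.
    have hcont : Tendsto (fun r : ℝ => 2 * (√(σ + η / 2) * √√r) + √r) (𝓝[>] 0) (𝓝 0) := by
      have : Continuous fun r : ℝ => 2 * (√(σ + η / 2) * √√r) + √r := by fun_prop
      have h := (this.tendsto 0).mono_left (nhdsWithin_le_nhds (s := Set.Ioi 0))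
      simpa using h
    obtain ⟨ρ, hρ1, hρ⟩ := ((hcont.eventually_lt_const (half_pos hη)).and
      self_mem_nhdsWithin).exists
    have hρ0 : 0 < ρ := hρ
    have hf : MemLp (fun z => g i F z ^ 2) 2 (F i) := memLp_sq_of_memLp_four
      ((memLp_four_iff (measurable_influence_apply hg F i).aestronglyMeasurable).2 (hg4 i))
    have h1 := tendsto_average_far F i (hni i) hf (half_pos hη)
    have h2 := tendsto_influenceError F hg hn hinfl i hρ0
    have h3 := h1.add h2
    rw [add_zero] at h3
    refine tendsto_of_tendsto_of_tendsto_of_le_of_le tendsto_const_nhds h3 (fun _ => zero_le)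
      fun k => ?_
    refine le_trans (measure_mono fun x hx => ?_) (measure_union_le _ _)
    by_contra hcon
    simp only [Set.mem_union, Set.mem_ofPred_eq, not_or, not_le] at hcon hx
    obtain ⟨c1, c2⟩ := hcon
    have hb := (influenceMoment_bounds F g (hn k) x i).1
    have h5 : (∑ j, g i F (x i j) ^ 2) / (n k i : ℝ) ≤ σ + η / 2 := by
      have := (abs_lt.1 c1).2
      linarith
    have h6 : 2 * (√((∑ j, g i F (x i j) ^ 2) / (n k i : ℝ)) * √√(influenceError F g i x))
        + √(influenceError F g i x) ≤ 2 * (√(σ + η / 2) * √√ρ) + √ρ := by gcongr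
    have h7 := abs_sub_le (influenceMoment g 2 i x) ((∑ j, g i F (x i j) ^ 2) / (n k i : ℝ)) σ
    linarith
  have hsum := tendsto_finsetSum Finset.univ fun i _ => hone i
  rw [Finset.sum_const_zero] at hsum
  refine tendsto_of_tendsto_of_tendsto_of_le_of_le tendsto_const_nhds hsum (fun _ => zero_le)
    fun k => ?_
  refine le_trans (measure_mono fun x hx => ?_) (measure_iUnion_fintype_le _ _)
  obtain ⟨i, hi⟩ := hx
  exact Set.mem_iUnion.2 ⟨i, hi⟩

/-- Boundedness in probability is enough here: the influence error is eventually below `1`, and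
Markov's inequality controls the average of the true fourth powers. -/
lemma exists_influenceMoment_bound [∀ i, IsProbabilityMeasure (F i)]
    (hg : ∀ i, Measurable (Function.uncurry (g i)))
    (hn : ∀ k i, 0 < n k i) (hinfl : InfluenceConverges F g n hn)
    (hg4 : ∀ i, Integrable (fun x => g i F x ^ 4) (F i)) {δ : ℝ≥0∞} (hδ : 0 < δ) :
    ∃ M : ℝ, 0 < M ∧ ∀ᶠ k in atTop, dataLaw F (n k)
      {x | ∃ i, M < influenceMoment g 4 i x} ≤ δ := by
  have hδ2 : 0 < δ / 2 := ENNReal.div_pos hδ.ne' (by simp)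
  have hM : Tendsto (fun M : ℝ => ∑ i, ENNReal.ofReal ((∫ z, g i F z ^ 4 ∂(F i)) / M)) atTop
      (𝓝 0) := by
    have h1 : ∀ i, Tendsto (fun M : ℝ => ENNReal.ofReal ((∫ z, g i F z ^ 4 ∂(F i)) / M)) atTop
        (𝓝 0) := by
      intro i
      have := ENNReal.tendsto_ofReal (tendsto_id.const_div_atTop (∫ z, g i F z ^ 4 ∂(F i)))
      simpa using this
    have := tendsto_finsetSum Finset.univ fun i _ => h1 i
    simpa using this
  obtain ⟨M, hM1, hM0⟩ := ((hM.eventually_lt_const hδ2).and (eventually_gt_atTop (0 : ℝ))).exists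
  have herr := tendsto_finsetSum Finset.univ fun i _ =>
    tendsto_influenceError F hg hn hinfl i one_pos
  rw [Finset.sum_const_zero] at herr
  refine ⟨8 * (1 + M), by positivity, ?_⟩
  filter_upwards [herr.eventually_lt_const hδ2] with k hk
  have hsub : {x : Data 𝒳 (n k) | ∃ i, 8 * (1 + M) < influenceMoment g 4 i x} ⊆
      (⋃ i, {x | 1 ≤ influenceError F g i x}) ∪
        ⋃ i, {x | M ≤ (∑ j, g i F (x i j) ^ 4) / n k i} := by
    rintro x ⟨i, hi⟩
    by_contra hcon
    simp only [Set.mem_union, Set.mem_iUnion, Set.mem_ofPred_eq, not_or, not_exists,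
      not_le] at hcon
    have h1 := hcon.1 i
    have h2 := hcon.2 i
    have h3 := (influenceMoment_bounds F g (hn k) x i).2
    linarith
  refine (measure_mono hsub).trans ((measure_union_le _ _).trans ?_)
  rw [← ENNReal.add_halves δ]
  refine add_le_add ((measure_iUnion_fintype_le _ _).trans hk.le)
    ((measure_iUnion_fintype_le _ _).trans (le_trans (Finset.sum_le_sum fun i _ => ?_) hM1.le))
  exact measure_average_ge_le F i (hn k i) (fun z => by positivity) (hg4 i) hM0

variable [∀ i, TopologicalSpace (𝒳 i)] [∀ i, MeasurableSingletonClass (𝒳 i)]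
  {ψ : (∀ i, Measure (𝒳 i)) → ℝ} {sim : Kernel (∀ i, Measure (𝒳 i)) ℝ} [IsMarkovKernel sim]

/-- On a good event the estimator is close to the input variance with high conditional
probability. -/
lemma runLaw_svb_ratio_le (hm : 0 < m) (hsim : Unbiased F ψ sim) (hdiff : FirstOrderDiff F ψ g)
    {n : Fin m → ℕ} (hn : ∀ i, 0 < n i) {θ c : ℝ} (hθ : 0 < θ)
    (hs : ∀ i, 1 ≤ subSize θ n i) (hc0 : 0 < c) (hc : ∀ i, avgSize n ≤ c * n i)
    {B R : ℕ} (hB : 2 ≤ B) (hR : 2 ≤ R) {x : Data 𝒳 n} (hx : InSupport F x)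
    {σ : Fin m → ℝ} (hσ : ∀ i, 0 ≤ σ i) {η M : ℝ}
    (hV : ∀ i, |influenceMoment g 2 i x - σ i| ≤ η) (hG : ∀ i, influenceMoment g 4 i x ≤ M)
    (he : bootRemainder ψ g (subSize θ n) x * avgSize (subSize θ n) ^ 2 ≤ η)
    (hθη : (θ * avgSize n)⁻¹ ≤ η) {M' : ℝ≥0}
    (hM' : starMeanENN (fun ι : Resample n (subSize θ n) =>
      mu4 ψ sim (barF Finset.univ x ι)) ≤ M')
    {C : ℝ} (hC : 0 < C) (hCR : C ≤ |(R : ℝ) / (θ * avgSize n)|) {κ ρ ε : ℝ} (hρ : 0 < ρ)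
    (hε : 0 < ε) (hρκ : ρ ≤ κ / 2) (hρε : ρ ≤ ε * κ / 6)
    (hκ : κ ≤ avgSize n * ∑ i, σ i / n i)
    (hinput : avgSize n * |inputVar F ψ n - ∑ i, σ i / n i| ≤ ρ)
    (hΦ : ∑ i, (2 * c * η + 2 * c ^ 2 * σ i * η)
        + (2 * (√(2 * c * ∑ i, (σ i + η)) * √(2 * √η)) + 2 * √η) ≤ ρ) :
    runLaw sim (subSize θ n) B R x {y | ε ≤ |svb θ y / inputVar F ψ n - 1|} ≤
      ENNReal.ofReal (5 * √((16 * (128 * ((m : ℝ) ^ 3 * (∑ _i : Fin m, 12 * c ^ 2 * M) + 4 * η))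
        + 56 * M' / C ^ 2) / B) / ρ) := by
  have hN := avgSize_pos hm hn
  obtain ⟨b1, b2⟩ := boot_moments_scaled hm hdiff hn hθ hs hc0 hc hx hσ hV hG he hθη
  set N := avgSize n with hNdef
  set s := subSize θ n with hsdef
  set v := ∑ i, σ i / n i with hv
  set I := inputVar F ψ n with hI
  have hκ0 : 0 < κ := by linarith
  have hIκ : κ / 2 ≤ N * I := by
    have h1 : N * v - N * I ≤ N * |I - v| := by
      rw [← mul_sub]
      gcongr
      rw [abs_sub_comm]
      exact le_abs_self _
    linarith
  have hI0 : 0 < I := by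
    by_contra! h
    have := mul_nonpos_of_nonneg_of_nonpos hN.le h
    linarith
  have hsub : {y : Fin B → Fin R → ℝ | ε ≤ |svb θ y / I - 1|} ⊆
      {y | ρ / N ≤ |svb θ y - θ * bootVar ψ s x|} := by
    intro y hy
    simp only [Set.mem_ofPred_eq] at hy ⊢
    have e1 : svb θ y / I - 1 = (svb θ y - I) / I := by field_simp
    rw [e1, abs_div, abs_of_pos hI0, le_div_iff₀ hI0] at hy
    rw [div_le_iff₀ hN]
    have h2 : ε * (κ / 2) ≤ |svb θ y - I| * N := by
      calc ε * (κ / 2) ≤ ε * (N * I) := by gcongr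
        _ = ε * I * N := by ring
        _ ≤ _ := by gcongr
    have h3 : |svb θ y - I| ≤ |svb θ y - θ * bootVar ψ s x|
        + (|θ * bootVar ψ s x - v| + |I - v|) := by
      have t1 := abs_sub_le (svb θ y) (θ * bootVar ψ s x) I
      have t2 := abs_sub_le (θ * bootVar ψ s x) v I
      rw [abs_sub_comm v I] at t2
      linarith
    have h4 : |svb θ y - I| * N ≤ |svb θ y - θ * bootVar ψ s x| * N
        + (N * |θ * bootVar ψ s x - v| + N * |I - v|) := by
      calc _ ≤ (|svb θ y - θ * bootVar ψ s x|
            + (|θ * bootVar ψ s x - v| + |I - v|)) * N := by gcongr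
        _ = _ := by ring
    have h5 := b1.trans hΦ
    linarith
  refine (measure_mono hsub).trans ((runLaw_far_le hsim hn hs hx hB hR hM' hθ.le
    (div_pos hρ hN)).trans (ENNReal.ofReal_le_ofReal ?_))
  have hB0 : (0 : ℝ) < B := by exact_mod_cast (by omega : 0 < B)
  have hR0 : (0 : ℝ) < R := by exact_mod_cast (by omega : 0 < R)
  have hNθ : 0 < N * θ := by positivity
  -- The condition `R = Ω(θ n)` enters here: it brings the simulation noise of order `1 / R²` down
  -- to the order `(θ n)⁻²` of the bootstrap fourth moment.
  have hRN : (N * θ) / R ≤ 1 / C := by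
    rw [abs_of_pos (by positivity), le_div_iff₀ (by positivity)] at hCR
    rw [div_le_div_iff₀ hR0 hC]
    linarith
  have e2 : θ * (5 * √((16 * bootFourth ψ s x + 56 * M' / (R : ℝ) ^ 2) / B)) / (ρ / N)
      = 5 * √((N * θ) ^ 2 * ((16 * bootFourth ψ s x + 56 * M' / (R : ℝ) ^ 2) / B)) / ρ := by
    rw [Real.sqrt_mul (by positivity), Real.sqrt_sq hNθ.le]
    field_simp
  rw [e2]
  gcongr
  calc (N * θ) ^ 2 * ((16 * bootFourth ψ s x + 56 * M' / (R : ℝ) ^ 2) / B)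
      = (16 * ((N * θ) ^ 2 * bootFourth ψ s x) + 56 * M' * ((N * θ) / R) ^ 2) / B := by
        field_simp
    _ ≤ (16 * (128 * ((m : ℝ) ^ 3 * (∑ _i : Fin m, 12 * c ^ 2 * M) + 4 * η))
        + 56 * M' * (1 / C) ^ 2) / B := by gcongr
    _ = _ := by rw [one_div, inv_pow, ← div_eq_mul_inv]

variable [∀ i, SecondCountableTopology (𝒳 i)]

/-- Off a data event of small probability, the conditional probability of a relative error `ε` is at
most a constant times `B ^ (-1/2)`, with a constant not depending on `k`. -/
lemma relConsistent [∀ i, IsProbabilityMeasure (F i)]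
    (hm : 0 < m) (hsim : Unbiased F ψ sim)
    (hg : ∀ i, Measurable (Function.uncurry (g i))) (hn : ∀ k i, 0 < n k i)
    (hbal : BalancedData n) (hdiff : FirstOrderDiff F ψ g) (htruth : SmoothAtTruth F ψ g n)
    (hinfl : InfluenceConverges F g n hn) {θ : ℕ → ℝ} {B R : ℕ → ℕ} (hadm : Admissible n θ B R)
    (hsmooth : SmoothAtEmpirical F ψ g n θ) (hfourth : FourthMomentBounded F ψ sim n θ)
    (hθ : RatioGrows n θ) (hB : IsLittleOmega (fun k => (B k : ℝ)) (fun _ => 1))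
    (hR : IsBigOmega (fun k => (R k : ℝ)) (fun k => θ k * avgSize (n k))) :
    RelConsistent F ψ sim n θ B R := by
  intro ε hε
  have hm' : (0 : ℝ) < m := by exact_mod_cast hm
  obtain ⟨c, hc0, hcn⟩ := hbal.exists_le hm
  obtain ⟨C, hC, hCR⟩ := hR
  set σ : Fin m → ℝ := fun i => ∫ z, g i F z ^ 2 ∂(F i) with hσdef
  have hσ : ∀ i, 0 < σ i := by
    intro i
    have h0 := (hdiff F fun i => self_mem_hull (F i)).1 i
    have := (htruth.2 i).1
    rwa [variance_of_integral_eq_zero (measurable_influence_apply hg F i).aemeasurable h0] at this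
  -- A lower bound for the scaled linear variance, from `n i ≤ m * avgSize n`; it keeps `σ_I²` of
  -- order at least `1 / n`.
  set κ : ℝ := (∑ i, σ i) / m with hκdef
  have : Nonempty (Fin m) := ⟨⟨0, hm⟩⟩
  have hκ0 : 0 < κ := div_pos (Finset.sum_pos (fun i _ => hσ i) Finset.univ_nonempty) hm'
  have hκ : ∀ k, κ ≤ avgSize (n k) * ∑ i, σ i / n k i := by
    intro k
    rw [hκdef, Finset.sum_div, Finset.mul_sum]
    refine Finset.sum_le_sum fun i _ => ?_
    have hi : (0 : ℝ) < n k i := by exact_mod_cast hn k i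
    rw [← mul_div_assoc, div_le_div_iff₀ hm' hi]
    have := mul_le_mul_of_nonneg_left (le_mul_avgSize hm (n k) i) (hσ i).le
    linarith
  set ρ : ℝ := min (κ / 2) (ε * κ / 6) with hρdef
  have hρ : 0 < ρ := lt_min (by positivity) (by positivity)
  -- the accuracy required from the data
  obtain ⟨η, hΦ, hη⟩ : ∃ η : ℝ, ∑ i, (2 * c * η + 2 * c ^ 2 * σ i * η)
      + (2 * (√(2 * c * ∑ i, (σ i + η)) * √(2 * √η)) + 2 * √η) < ρ ∧ 0 < η := by
    have hcont : Continuous fun η : ℝ => ∑ i, (2 * c * η + 2 * c ^ 2 * σ i * η)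
        + (2 * (√(2 * c * ∑ i, (σ i + η)) * √(2 * √η)) + 2 * √η) := by fun_prop
    have h := (hcont.tendsto 0).mono_left (nhdsWithin_le_nhds (s := Set.Ioi 0))
    simp only [mul_zero, add_zero, Real.sqrt_zero, Finset.sum_const_zero] at h
    exact ((h.eventually_lt_const hρ).and self_mem_nhdsWithin).exists
  refine ENNReal.tendsto_nhds_zero.2 fun δ hδ => ?_
  -- One fifth for each of the four non-null exceptional data events and one for the conditional
  -- probability.
  have hδ5 : 0 < δ / 5 := ENNReal.div_pos hδ.ne' (by simp)
  obtain ⟨M, hM0, hM⟩ := exists_influenceMoment_bound hg hn hinfl (fun i => (htruth.2 i).2) hδ5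
  obtain ⟨M', hM'⟩ := hfourth Finset.univ (δ / 5) hδ5
  have hV := (tendsto_influenceMoment_far hg hn hbal.1 hinfl (fun i => (htruth.2 i).2)
    hη).eventually_le_const hδ5
  have hrem := (hsmooth Finset.univ η hη).eventually_le_const hδ5
  have hgrow := tendsto_of_ratioGrows hm hn (fun k => (hadm.1 k).1) hθ
  have hinv := (tendsto_inv_atTop_zero.comp hgrow).eventually_lt_const hη
  have hinput := (tendsto_inputVar hm F hsim hg hn hbal hdiff htruth).eventually_lt_const hρ
  set K : ℝ := 16 * (128 * ((m : ℝ) ^ 3 * (∑ _i : Fin m, 12 * c ^ 2 * M) + 4 * η))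
    + 56 * M' / C ^ 2 with hK
  have hB' : Tendsto (fun k => (B k : ℝ)) atTop atTop := by
    refine hB.congr fun k => ?_
    simp
  have hrun : Tendsto (fun k => ENNReal.ofReal (5 * √(K / B k) / ρ)) atTop (𝓝 0) := by
    have h := (((hB'.const_div_atTop K).sqrt.const_mul 5).div_const ρ)
    simpa using ENNReal.tendsto_ofReal h
  filter_upwards [hM, hM', hV, hrem, hinv, hinput, hcn, hCR,
    hrun.eventually_le_const hδ5] with k kM kM' kV krem kinv kinput kc kCR krun
  set s := subSize (θ k) (n k) with hs
  set S₁ : Set (Data 𝒳 (n k)) := {x | ¬ InSupport F x}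
  set S₂ : Set (Data 𝒳 (n k)) :=
    {x | ∃ i, η < |influenceMoment g 2 i x - ∫ z, g i F z ^ 2 ∂(F i)|}
  set S₃ : Set (Data 𝒳 (n k)) := {x | ∃ i, M < influenceMoment g 4 i x}
  set S₄ : Set (Data 𝒳 (n k)) := {x | η ≤ |bootRemainder ψ g s x * avgSize s ^ 2 - 0|}
  set S₅ : Set (Data 𝒳 (n k)) := {x | (M' : ℝ≥0∞) <
    starMeanENN (fun ι : Resample (n k) s => mu4 ψ sim (barF Finset.univ x ι))}
  set S := S₁ ∪ S₂ ∪ S₃ ∪ S₄ ∪ S₅ with hS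
  have hS₁ : dataLaw F (n k) S₁ = 0 := ae_iff.1 (ae_inSupport F (n k))
  have hSm : dataLaw F (n k) S ≤ 0 + δ / 5 + δ / 5 + δ / 5 + δ / 5 := by
    refine (measure_union_le _ _).trans (add_le_add ?_ kM'.le)
    refine (measure_union_le _ _).trans (add_le_add ?_ krem)
    refine (measure_union_le _ _).trans (add_le_add ?_ kM)
    exact (measure_union_le _ _).trans (add_le_add hS₁.le kV)
  -- The exceptional set need not be measurable, since `ψ` is arbitrary off the hulls. Its
  -- measurable hull has the same measure and an indicator that can be integrated.
  have hpt : ∀ x, runLaw sim s (B k) (R k) x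
      {y | ε ≤ |svb (θ k) y / inputVar F ψ (n k) - 1|} ≤
      (toMeasurable (dataLaw F (n k)) S).indicator 1 x + δ / 5 := by
    intro x
    by_cases hx : x ∈ S
    · have hprob := isProbabilityMeasure_blockLaw sim (hn k) s (R k) x
      have h1 : runLaw sim s (B k) (R k) x
          {y | ε ≤ |svb (θ k) y / inputVar F ψ (n k) - 1|} ≤ 1 := by
        unfold runLaw; exact prob_le_one
      rw [Set.indicator_of_mem (subset_toMeasurable _ _ hx)]
      exact h1.trans le_self_add
    · simp only [hS, S₁, S₂, S₃, S₄, S₅, Set.mem_union, Set.mem_ofPred_eq, not_or, not_not,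
        not_exists, not_lt, not_le, sub_zero] at hx
      obtain ⟨⟨⟨⟨x1, x2⟩, x3⟩, x4⟩, x5⟩ := hx
      refine le_trans ?_ le_add_self
      exact (runLaw_svb_ratio_le hm hsim hdiff (hn k) (hadm.1 k).1 (hadm.1 k).2.2 hc0 kc
        (hadm.2 k).1 (hadm.2 k).2 x1 (fun i => (hσ i).le) x2 x3 ((le_abs_self _).trans x4.le)
        kinv.le x5 hC kCR hρ hε (min_le_left _ _) (min_le_right _ _) (hκ k) kinput.le
        hΦ.le).trans krun
  calc ∫⁻ x, runLaw sim s (B k) (R k) x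
        {y | ε ≤ |svb (θ k) y / inputVar F ψ (n k) - 1|} ∂(dataLaw F (n k))
      ≤ ∫⁻ x, ((toMeasurable (dataLaw F (n k)) S).indicator 1 x + δ / 5) ∂(dataLaw F (n k)) :=
        lintegral_mono hpt
    _ = dataLaw F (n k) S + δ / 5 := by
        rw [lintegral_add_right _ measurable_const,
          lintegral_indicator_one (measurableSet_toMeasurable _ _), measure_toMeasurable]
        simp
    _ ≤ 0 + δ / 5 + δ / 5 + δ / 5 + δ / 5 + δ / 5 := by gcongr
    _ = 5 * (δ / 5) := by ring
    _ = δ := ENNReal.mul_div_cancel (by norm_num) (by norm_num)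

end Consistency

end InputVariance

open InputVariance in
theorem corollary2 {m : ℕ} (hm : 0 < m) {𝒳 : Fin m → Type*}
    [∀ i, TopologicalSpace (𝒳 i)] [∀ i, PolishSpace (𝒳 i)]
    [∀ i, MeasurableSpace (𝒳 i)] [∀ i, BorelSpace (𝒳 i)]
    -- true input distributions, performance measure, simulation replications
    (F : ∀ i, Measure (𝒳 i)) [∀ i, IsProbabilityMeasure (F i)]
    (ψ : (∀ i, Measure (𝒳 i)) → ℝ)
    (sim : Kernel (∀ i, Measure (𝒳 i)) ℝ) [IsMarkovKernel sim]
    (hsim : Unbiased F ψ sim)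
    -- influence functions
    (g : ∀ i, (∀ j, Measure (𝒳 j)) → 𝒳 i → ℝ)
    (hg : ∀ i, Measurable (Function.uncurry (g i)))
    -- data sizes, indexed by `k → ∞`
    (n : ℕ → Fin m → ℕ) (hn : ∀ k i, 0 < n k i)
    (hbal : BalancedData n)
    (hdiff : FirstOrderDiff F ψ g)
    (htruth : SmoothAtTruth F ψ g n)
    (hinfl : InfluenceConverges F g n hn)
    (hvar : EmpiricalVarConverges F ψ sim n) :
    -- the choice `θ = ω(1/n)`, `B = ω(1)`, `R = Ω(θ n)` is relatively consistent
    (∀ (θ : ℕ → ℝ) (B R : ℕ → ℕ), Admissible n θ B R → ResamplingRegular F ψ sim g n θ →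
      RatioGrows n θ →
      IsLittleOmega (fun k => (B k : ℝ)) (fun _ => 1) →
      IsBigOmega (fun k => (R k : ℝ)) (fun k => θ k * avgSize (n k)) →
      Configured n θ B R ∧ RelConsistent F ψ sim n θ B R) ∧
    -- given `θ = ω(1/n)`, the budgets that meet the configuration, or allow the choice above,
    -- are exactly those of order `ω(θ n)`
    (∀ θ : ℕ → ℝ, AdmissibleRatio n θ → RatioGrows n θ →
      (∀ B R : ℕ → ℕ, Admissible n θ B R → Configured n θ B R →
        IsLittleOmega (fun k => (B k : ℝ) * (R k : ℝ)) (fun k => θ k * avgSize (n k))) ∧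
      (∀ N : ℕ → ℕ, IsLittleOmega (fun k => (N k : ℝ)) (fun k => θ k * avgSize (n k)) →
        ∃ B R : ℕ → ℕ, Admissible n θ B R ∧
          IsLittleOmega (fun k => (B k : ℝ)) (fun _ => 1) ∧
          IsBigOmega (fun k => (R k : ℝ)) (fun k => θ k * avgSize (n k)) ∧
          ∀ᶠ k in atTop, B k * R k ≤ N k)) ∧
    -- every budget `N = ω(1)`, however slowly it grows, suffices
    ((∀ θ : ℕ → ℝ, AdmissibleRatio n θ → RatioGrows n θ → ResamplingRegular F ψ sim g n θ) →
      ∀ N : ℕ → ℕ, IsLittleOmega (fun k => (N k : ℝ)) (fun _ => 1) →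
        ∃ (θ : ℕ → ℝ) (B R : ℕ → ℕ), Admissible n θ B R ∧ RatioGrows n θ ∧
          (∀ᶠ k in atTop, B k * R k ≤ N k) ∧ RelConsistent F ψ sim n θ B R) ∧
    -- and a budget `N = ω(1)` is necessary
    (∀ (θ : ℕ → ℝ) (B R : ℕ → ℕ), Admissible n θ B R → RelConsistent F ψ sim n θ B R →
      IsLittleOmega (fun k => (B k : ℝ) * (R k : ℝ)) (fun _ => 1)) := by
  have hfirst : ∀ (θ : ℕ → ℝ) (B R : ℕ → ℕ), Admissible n θ B R →
      ResamplingRegular F ψ sim g n θ → RatioGrows n θ →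
      IsLittleOmega (fun k => (B k : ℝ)) (fun _ => 1) →
      IsBigOmega (fun k => (R k : ℝ)) (fun k => θ k * avgSize (n k)) →
      Configured n θ B R ∧ RelConsistent F ψ sim n θ B R := fun θ B R hadm hreg hθ hB hR =>
    ⟨configured_of_isBigOmega hθ hB hR,
      relConsistent hm hsim hg hn hbal hdiff htruth hinfl hadm hreg.1 hreg.2.2 hθ hB hR⟩
  refine ⟨hfirst, fun θ hadm hθ => ⟨fun B R _ hconf => isLittleOmega_budget hconf,
    fun N hN => exists_replications hm hn hadm hθ hN⟩, fun hreg N hN => ?_,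
    fun θ B R hadm hrel => isLittleOmega_budget_of_relConsistent F ψ sim n hn θ B R hadm hrel⟩
  obtain ⟨θ, hadm, hθ, hNθ⟩ := exists_ratio hm hn hbal hN
  obtain ⟨B, R, hBR, hB, hR, hle⟩ := exists_replications hm hn hadm hθ hNθ
  exact ⟨θ, B, R, hBR, hθ, hle, (hfirst θ B R hBR (hreg θ hadm hθ) hθ hB hR).2⟩
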